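/- **Conventions.** All functions and distributions are complex valued, $\mathcal F f(\xi)=\widehat f(\xi)=\int e^{-2\pi i x\xi}f(x)\,dx$ (extended to $\mathcal S'(\mathbb R)$), $\langle\xi\rangle=(1+|\xi|^2)^{1/2}$, and for $s\in\mathbb R$ $$H^s_\Gamma=\{f\in\mathcal S'(\mathbb R):\ \langle\xi\rangle^s\widehat f\in L^2(\mathbb R),\ \operatorname{supp}\widehat f\subset\Gamma\},\qquad \Gamma=[0,\infty),\qquad \|f\|_{H^s}=\|\langle\xi\rangle^s\widehat f\|_{L^2}.$$ For $S,R\in\mathcal S'(\mathbb R)$ the $\mathcal S'$-convolution $S*R$ exists if $(\varphi*S^-)R\in\mathcal D'_{L^1}(\mathbb R)$ for all $\varphi\in\mathcal S(\mathbb R)$, where $S^-(x)=S(-x)$; then $\langle S*R,\varphi\rangle=\langle(\varphi*S^-)R,1\rangle$. The Fourier product of $u,v\in\mathcal S'(\mathbb R)$ is $u\cdot v=\mathcal F^{-1}(\mathcal Fu*\mathcal Fv)$, provided that this $\mathcal S'$-convolution exists, and $u^p$ is the $p$-th power with respect to the Fourier product ($u^1=u$, $u^{k+1}=u^k\cdot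 u$). For $T>0$, a *solution on $[-T,T]$ with data $(u_0,u_1)\in H^s_\Gamma\times H^{s-1}_\Gamma$* is a function $u\in C([-T,T];H^s_\Gamma)\cap C^1([-T,T];H^{s-1}_\Gamma)$ with $u(0)=u_0$, $\partial_tu(0)=u_1$, for which the Fourier power $u(t)^p$ exists for every $t\in[-T,T]$ and $$\partial_t^2u-\partial_x^2u=\pm u^p\quad\text{in the sense of distributions on }(-T,T)\times\mathbb R,$$ that is, $\int_{-T}^{T}\langle u(t),(\partial_t^2\varphi-\partial_x^2\varphi)(t,\cdot)\rangle\,dt=\pm\int_{-T}^{T}\langle u(t)^p,\varphi(t,\cdot)\rangle\,dt$ for every $\varphi\in C_c^\infty((-T,T)\times\mathbb R)$ (both integrands being integrable). **Theorem.** Fix either sign. Let $p\ge2$ be an integer and $s\in\mathbb R$, with $s>-\tfrac12$ if $p=2$ and $s>\tfrac12-\tfrac1{2p-4}$ if $p\ge3$. Let $u_0\in H^s_\Gamma$ and $u_1\in H^{s-1}_\Gamma$. Then there are $T>0$, a neighbourhood $U$ of $(u_0,u_1)$ in $H^s_\Gamma\times H^{s-1}_\Gamma$ and a constant $L$ such that: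 1. for all data $(v_0,v_1)\in U$ (in particular for $(u_0,u_1)$) there is exactly one solution on $[-T,T]$ with data $(v_0,v_1)$; 2. if $v,w$ are the solutions with data $(v_0,v_1),(w_0,w_1)\in U$, then for all $t\in[-T,T]$ both $\|v(t)-w(t)\|_{H^s}$ and $\|\partial_tv(t)-\partial_tw(t)\|_{H^{s-1}}$ are at most $L\max(\|v_0-w_0\|_{H^s},\|v_1-w_1\|_{H^{s-1}})$. -/

import Mathlib

open Set Filter Topology MeasureTheory
open scoped SchwartzMap FourierTransform Distributions LineDeriv ContDiff

noncomputable section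

namespace HalfLineNLW

/-! ### The spaces `H^s_Γ(ℝ)`, `Γ = [0, ∞)` -/

/-- The distributions `f ∈ H^s(ℝ)` with `supp (𝓕 f) ⊆ [0, ∞)`, as a subspace of `𝓢'(ℝ)`. -/
def sobolevGamma (s : ℝ) : Submodule ℂ 𝓢'(ℝ, ℂ) where
  carrier := {f | TemperedDistribution.MemSobolev s 2 f ∧
    Distribution.dsupport (𝓕 f : 𝓢'(ℝ, ℂ)) ⊆ Ici 0}
  zero_mem' := by
    refine ⟨TemperedDistribution.memSobolev_fun_zero ℝ ℂ s 2, fun x hx => ?_⟩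
    exfalso
    rw [Distribution.mem_dsupport_iff_not_isVanishingOn] at hx
    refine hx univ (mem_univ x) isOpen_univ fun ψ _ => ?_
    rw [TemperedDistribution.fourier_apply]
    rfl
  add_mem' := by
    rintro f g ⟨hf, hf'⟩ ⟨hg, hg'⟩
    refine ⟨hf.add hg, fun x hx => ?_⟩
    by_contra h0
    have h1 := notMem_subset hf' h0
    have h2 := notMem_subset hg' h0
    rw [Distribution.notMem_dsupport_iff] at h1 h2
    obtain ⟨a, ha, ha', hxa⟩ := h1
    obtain ⟨b, hb, hb', hxb⟩ := h2
    rw [Distribution.mem_dsupport_iff_not_isVanishingOn] at hx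
    refine hx (a ∩ b) ⟨hxa, hxb⟩ (ha'.inter hb') fun ψ hψ => ?_
    have e1 := ha ψ (hψ.trans inter_subset_left)
    have e2 := hb ψ (hψ.trans inter_subset_right)
    rw [TemperedDistribution.fourier_apply] at e1 e2 ⊢
    change f (𝓕 ψ) + g (𝓕 ψ) = 0
    rw [e1, e2, add_zero]
  smul_mem' := by
    rintro c f ⟨hf, hf'⟩
    refine ⟨hf.smul c, fun x hx => ?_⟩
    by_contra h0
    have h1 := notMem_subset hf' h0
    rw [Distribution.notMem_dsupport_iff] at h1
    obtain ⟨a, ha, ha', hxa⟩ := h1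
    rw [Distribution.mem_dsupport_iff_not_isVanishingOn] at hx
    refine hx a hxa ha' fun ψ hψ => ?_
    have e1 := ha ψ hψ
    rw [TemperedDistribution.fourier_apply] at e1 ⊢
    change c • f (𝓕 ψ) = 0
    rw [e1, smul_zero]

/-- The space `H^s_Γ(ℝ)`. It is a type of its own, so that it carries the topology of the
`H^s` norm and not the one of `𝓢'(ℝ)`. -/
def HGamma (s : ℝ) : Type := ↥(sobolevGamma s)

instance (s : ℝ) : AddCommGroup (HGamma s) := inferInstanceAs (AddCommGroup ↥(sobolevGamma s))

instance (s : ℝ) : Module ℂ (HGamma s) := inferInstanceAs (Module ℂ ↥(sobolevGamma s))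

/-- The tempered distribution underlying an element of `H^s_Γ(ℝ)`. -/
def HGamma.toDist {s : ℝ} : HGamma s →ₗ[ℂ] 𝓢'(ℝ, ℂ) := (sobolevGamma s).subtype

theorem HGamma.toDist_injective {s : ℝ} : Function.Injective (HGamma.toDist (s := s)) :=
  Subtype.val_injective

theorem toTemperedDistribution_injective :
    Function.Injective (Lp.toTemperedDistributionCLM ℂ (volume : Measure ℝ) 2) := by
  have h := Lp.ker_toTemperedDistributionCLM_eq_bot (F := ℂ) (μ := (volume : Measure ℝ)) (p := 2)
  exact LinearMap.ker_eq_bot.mp h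

/-- The `L²` function `𝓕⁻¹ (⟨ξ⟩^s 𝓕 f)` for `f ∈ H^s_Γ(ℝ)`. -/
def HGamma.bessel (s : ℝ) : HGamma s →ₗ[ℂ] Lp ℂ 2 (volume : Measure ℝ) where
  toFun f := Classical.choose f.2.1
  map_add' f g := by
    apply toTemperedDistribution_injective
    rw [map_add]
    simp only [Lp.toTemperedDistributionCLM_apply]
    rw [← Classical.choose_spec f.2.1, ← Classical.choose_spec g.2.1,
      ← Classical.choose_spec (f + g).2.1, ← map_add]
    rfl
  map_smul' c f := by
    apply toTemperedDistribution_injective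
    rw [RingHom.id_apply, map_smul]
    simp only [Lp.toTemperedDistributionCLM_apply]
    rw [← Classical.choose_spec f.2.1, ← Classical.choose_spec (c • f).2.1, ← map_smul]
    rfl

theorem HGamma.bessel_spec {s : ℝ} (f : HGamma s) :
    TemperedDistribution.besselPotential ℝ ℂ s (HGamma.toDist f) =
      Lp.toTemperedDistribution (HGamma.bessel s f) :=
  Classical.choose_spec f.2.1

theorem HGamma.bessel_injective (s : ℝ) : Function.Injective (HGamma.bessel s) := by
  intro f g h
  apply HGamma.toDist_injective
  have h' : TemperedDistribution.besselPotential ℝ ℂ s (HGamma.toDist f) =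
      TemperedDistribution.besselPotential ℝ ℂ s (HGamma.toDist g) := by
    rw [HGamma.bessel_spec, HGamma.bessel_spec, h]
  have := congrArg (TemperedDistribution.besselPotential ℝ ℂ (-s)) h'
  simpa using this

/-- The norm `‖f‖_{H^s} = ‖𝓕⁻¹ (⟨ξ⟩^s 𝓕 f)‖_{L²} = ‖⟨ξ⟩^s 𝓕 f‖_{L²}`. -/
instance (s : ℝ) : NormedAddCommGroup (HGamma s) :=
  NormedAddCommGroup.induced (HGamma s) (Lp ℂ 2 (volume : Measure ℝ)) (HGamma.bessel s)
    (HGamma.bessel_injective s)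

theorem HGamma.norm_def {s : ℝ} (f : HGamma s) : ‖f‖ = ‖HGamma.bessel s f‖ := rfl

instance (s : ℝ) : NormedSpace ℂ (HGamma s) where
  norm_smul_le c f := by
    rw [HGamma.norm_def, HGamma.norm_def, map_smul]
    exact norm_smul_le _ _

theorem HGamma.toDist_mk {s : ℝ} (f : 𝓢'(ℝ, ℂ)) (hf : f ∈ sobolevGamma s) :
    HGamma.toDist (⟨f, hf⟩ : HGamma s) = f := rfl

/-- The inclusion `H^s_Γ(ℝ) ⊆ H^{s-1}_Γ(ℝ)`. -/
def HGamma.incl {s : ℝ} (f : HGamma s) : HGamma (s - 1) :=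
  ⟨HGamma.toDist f, f.2.1.mono (by linarith), f.2.2⟩

theorem HGamma.toDist_incl {s : ℝ} (f : HGamma s) :
    HGamma.toDist (HGamma.incl f) = HGamma.toDist f :=
  HGamma.toDist_mk _ _

/-! ### The Fourier product -/

/-- The function `φ ∗ S⁻`, where `S⁻(x) = S(-x)`; that is, `x ↦ ⟨S, φ(x + ·)⟩`. -/
def convReflect (φ : 𝓢(ℝ, ℂ)) (S : 𝓢'(ℝ, ℂ)) : ℝ → ℂ :=
  fun x => S (SchwartzMap.compSubConstCLM ℂ (-x) φ)

/-- The dilation `x ↦ χ(x / (n + 1))` of a Schwartz function. -/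
def dilate (χ : 𝓢(ℝ, ℂ)) (n : ℕ) : 𝓢(ℝ, ℂ) :=
  SchwartzMap.compCLMOfContinuousLinearEquiv ℂ
    (ContinuousLinearEquiv.unitsEquivAut ℝ
      (Units.mk0 (((n : ℝ) + 1)⁻¹) (inv_ne_zero (Nat.cast_add_one_ne_zero n)))) χ

theorem dilate_apply (χ : 𝓢(ℝ, ℂ)) (n : ℕ) (x : ℝ) : dilate χ n x = χ (x / ((n : ℝ) + 1)) := by
  simp [dilate, div_eq_mul_inv]

/-- `T ∈ 𝓓'_{L¹}(ℝ)`, the dual of the space `𝓑̇` of smooth functions all of whose derivatives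
vanish at infinity, topologized by the suprema of the derivatives. Since `𝓢` is dense in `𝓑̇`, this
says that `T` is continuous on `𝓢` for that topology. -/
def MemDPrimeL1 (T : 𝓢'(ℝ, ℂ)) : Prop :=
  ∃ (m : ℕ) (C : ℝ), ∀ ψ : 𝓢(ℝ, ℂ),
    ‖T ψ‖ ≤ C * ∑ k ∈ Finset.range (m + 1), SchwartzMap.seminorm ℂ 0 k ψ

/-- For `T ∈ 𝓓'_{L¹}(ℝ)`: the pairing `⟨T, 1⟩` has the value `a`. It is obtained by approximating
`1` by the functions `χ(x / (n + 1))`, `χ ∈ 𝓢`, `χ(0) = 1`, which are bounded together with all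
their derivatives and converge to `1` with all derivatives, locally uniformly. -/
def PairingWithOneEq (T : 𝓢'(ℝ, ℂ)) (a : ℂ) : Prop :=
  ∀ χ : 𝓢(ℝ, ℂ), χ 0 = 1 → Tendsto (fun n : ℕ => T (dilate χ n)) atTop (𝓝 a)

/-- The `𝓢'`-convolution of `S` and `T` exists and equals `W`:
`(φ ∗ S⁻) T ∈ 𝓓'_{L¹}` and `⟨W, φ⟩ = ⟨(φ ∗ S⁻) T, 1⟩` for all `φ ∈ 𝓢`. -/
def IsSConvolution (S T W : 𝓢'(ℝ, ℂ)) : Prop :=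
  ∀ φ : 𝓢(ℝ, ℂ),
    MemDPrimeL1 (TemperedDistribution.smulLeftCLM ℂ (convReflect φ S) T) ∧
    PairingWithOneEq (TemperedDistribution.smulLeftCLM ℂ (convReflect φ S) T) (W φ)

/-- The Fourier product `u · v = 𝓕⁻¹ (𝓕 u ∗ 𝓕 v)` exists and equals `w`. -/
def IsFourierProduct (u v w : 𝓢'(ℝ, ℂ)) : Prop :=
  IsSConvolution (𝓕 u) (𝓕 v) (𝓕 w)

/-- The power `u^p`, formed by means of the Fourier product, exists and equals `w`:
`u^1 = u` and `u^(k+1) = u^k · u`. -/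
def IsFourierPower (u : 𝓢'(ℝ, ℂ)) : ℕ → 𝓢'(ℝ, ℂ) → Prop
  | 0, w => ∀ ψ : 𝓢(ℝ, ℂ), w ψ = ∫ x, ψ x
  | 1, w => w = u
  | k + 2, w => ∃ v : 𝓢'(ℝ, ℂ), IsFourierPower u (k + 1) v ∧ IsFourierProduct v u w

/-! ### The Cauchy problem -/

/-- The open set `{(t, x) : -T < t < T}`. -/
def slab (T : ℝ) : TopologicalSpace.Opens (ℝ × ℝ) :=
  ⟨Ioo (-T) T ×ˢ univ, isOpen_Ioo.prod isOpen_univ⟩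

/-- The function `x ↦ φ(t, x)`. -/
def slice {T : ℝ} (φ : 𝓓(slab T, ℂ)) (t : ℝ) : 𝓢(ℝ, ℂ) :=
  HasCompactSupport.toSchwartzMap (f := fun x : ℝ => φ (t, x))
    (φ.hasCompactSupport.comp_isClosedEmbedding
      (Isometry.isClosedEmbedding fun x y => by simp [Prod.edist_eq]))
    (φ.contDiff.comp (contDiff_prodMk_right t))

theorem slice_apply {T : ℝ} (φ : 𝓓(slab T, ℂ)) (t x : ℝ) : slice φ t x = φ (t, x) := rfl

/-- The test function `∂_t² φ - ∂_x² φ`. -/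
def waveOp {T : ℝ} (φ : 𝓓(slab T, ℂ)) : 𝓓(slab T, ℂ) :=
  ∂_{((1, 0) : ℝ × ℝ)} (∂_{((1, 0) : ℝ × ℝ)} φ) - ∂_{((0, 1) : ℝ × ℝ)} (∂_{((0, 1) : ℝ × ℝ)} φ)

/-- The time derivative at time `t ∈ [-T, T]`, one-sided at `±T` and formed in `H^{s-1}_Γ`, of a
curve `u` in `H^s_Γ`. -/
def velocity {s : ℝ} (T : ℝ) (u : ℝ → HGamma s) (t : ℝ) : HGamma (s - 1) :=
  derivWithin (fun τ => HGamma.incl (u τ)) (Icc (-T) T) t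

/-- `u ∈ C([-T,T]; H^s_Γ) ∩ C¹([-T,T]; H^{s-1}_Γ)` is a distributional solution of
`∂_t² u - ∂_x² u = ε u^p`, `u(0) = u₀`, `∂_t u(0) = u₁`. (The values of `u` outside `[-T,T]` play no
role.) -/
structure IsSolution {s : ℝ} (p : ℕ) (ε T : ℝ) (u₀ : HGamma s) (u₁ : HGamma (s - 1))
    (u : ℝ → HGamma s) : Prop where
  continuousOn : ContinuousOn u (Icc (-T) T)
  contDiffOn : ContDiffOn ℝ 1 (fun t => HGamma.incl (u t)) (Icc (-T) T)
  initial_position : u 0 = u₀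
  initial_velocity : velocity T u 0 = u₁
  /-- The Fourier power `N t` of `u t` exists for all `t`, and
  `∂_t² u - ∂_x² u = ε N` in the sense of distributions on `(-T, T) × ℝ`, where `u` and `N` act on
  test functions by `φ ↦ ∫ ⟨u(t), φ(t, ·)⟩ dt` and `φ ↦ ∫ ⟨N(t), φ(t, ·)⟩ dt`. -/
  equation : ∃ N : ℝ → 𝓢'(ℝ, ℂ),
    (∀ t ∈ Icc (-T) T, IsFourierPower (HGamma.toDist (u t)) p (N t)) ∧
    ∀ φ : 𝓓(slab T, ℂ),
      IntegrableOn (fun t => HGamma.toDist (u t) (slice (waveOp φ) t)) (Ioo (-T) T) ∧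
      IntegrableOn (fun t => N t (slice φ t)) (Ioo (-T) T) ∧
      ∫ t in Ioo (-T) T, HGamma.toDist (u t) (slice (waveOp φ) t) =
        (ε : ℂ) * ∫ t in Ioo (-T) T, N t (slice φ t)

end HalfLineNLW

end

open HalfLineNLW

noncomputable section

namespace HalfLineNLW

/-! ### The Fourier picture of `H^s_Γ(ℝ)` -/

/-! On the Fourier side `H^s_Γ` is `L²(0, ∞)`: write `û = ⟨ξ⟩^{-s} f`. Since all densities live on
the half-line, a convolution evaluated at `ξ` involves only the bounded interval `0 < η < ξ`. It is
therefore finite pointwise by Cauchy–Schwarz, with no decay of `f` beyond square integrability. It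
is also the `𝓢'`-convolution (`isSConvolution_of_hasDensity`), because for `x, y > 0` the decay of
`φ(x + y)` is decay in both variables.

The square of `u` has a Fourier density of size `⟨ξ⟩^{-s + max(-s, 0)}`. If `0 ≤ σ ≤ s` and `σ <
1/2`, each further factor costs at most `1/2 - σ` in the exponent, because one of `η` and `ξ - η` is
at least `ξ/2`. So the density of `u^p` is `O(⟨ξ⟩^{-s + γ})` with `γ = max(-s, 0)` if `p = 2` and `γ
= (p - 2)(1/2 - σ)` if `p ≥ 3`. It belongs to `H^{s-1}` once `⟨ξ⟩^{-1 + γ}` is square integrable,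
that is, once `γ < 1/2`; the hypothesis on `s` says that this can be achieved. By multilinearity `u
↦ u^p` is Lipschitz from bounded sets of `H^s_Γ` to `H^{s-1}_Γ` (`exists_power_map`).

The wave propagator `sin(2πtξ)/(2πξ)` regains the lost derivative. Replace `u(t)` by its profile,
the data at time `0` of the free wave which has the position and velocity of `u` at time `t`. The
equation becomes an ordinary differential equation in `L² × L²` with a locally Lipschitz right-hand
side. Picard–Lindelöf (`exists_local_flow`) gives existence and Lipschitz dependence on the data.

Uniqueness is claimed among all distributional solutions. The power in the equation is determined
because `𝓢'`-convolutions are unique. Testing with `θ(t) ψ(x)` and the lemma of du Bois-Reymond turn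
the weak equation into a strong one with values in `H^{s-2}`
(`hasDerivWithinAt_of_integral_pairing_eq_zero`). The profile then solves its differential equation
after multiplication by `⟨ξ⟩^{-2}`; this multiplier is injective and the right-hand side is
continuous, so it can be removed (`hasDerivWithinAt_of_injective`). Uniqueness for ordinary
differential equations concludes. -/

instance hasTemperateGrowth_restrict {E : Type*} [NormedAddCommGroup E] [MeasurableSpace E]
    (μ : Measure E) [h : μ.HasTemperateGrowth] (s : Set E) : (μ.restrict s).HasTemperateGrowth :=
  ⟨h.exists_integrable.imp fun _ hn => hn.integrableOn⟩

/-- Lebesgue measure on the half-line. -/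
abbrev halfLine : Measure ℝ := volume.restrict (Ioi (0 : ℝ))

/-- The space `L²(0, ∞)`. -/
abbrev HalfL2 : Type := Lp ℂ 2 halfLine

/-- The weight `⟨ξ⟩^r`. -/
def jap (r : ℝ) (ξ : ℝ) : ℝ := (1 + ‖ξ‖ ^ 2) ^ (r / 2)

theorem jap_pos (r ξ : ℝ) : 0 < jap r ξ := by unfold jap; positivity

theorem jap_ne_zero (r ξ : ℝ) : (jap r ξ : ℂ) ≠ 0 := by exact_mod_cast (jap_pos r ξ).ne'

theorem jap_add (r r' ξ : ℝ) : jap (r + r') ξ = jap r ξ * jap r' ξ := by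
  unfold jap; rw [← Real.rpow_add (by positivity), add_div]

@[simp] theorem jap_zero (ξ : ℝ) : jap 0 ξ = 1 := by simp [jap]

theorem jap_neg_mul (r ξ : ℝ) : jap (-r) ξ * jap r ξ = 1 := by
  rw [← jap_add]; simp

theorem continuous_jap (r : ℝ) : Continuous (jap r) := by
  unfold jap
  exact Continuous.rpow_const (by fun_prop) fun ξ => .inl (by positivity)

theorem jap_mono {r r' : ℝ} (h : r ≤ r') (ξ : ℝ) : jap r ξ ≤ jap r' ξ := by
  unfold jap
  exact Real.rpow_le_rpow_of_exponent_le (by nlinarith [sq_nonneg ‖ξ‖]) (by linarith)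

theorem jap_hasTemperateGrowth (r : ℝ) :
    (fun ξ : ℝ => (jap r ξ : ℂ)).HasTemperateGrowth :=
  Function.Complex.hasTemperateGrowth_ofReal.comp
    (Function.hasTemperateGrowth_one_add_norm_sq_rpow ℝ (r / 2))

theorem smulLeftCLM_jap_neg (r : ℝ) (f : 𝓢'(ℝ, ℂ)) :
    TemperedDistribution.smulLeftCLM ℂ (fun ξ => (jap (-r) ξ : ℂ))
      (TemperedDistribution.smulLeftCLM ℂ (fun ξ => (jap r ξ : ℂ)) f) = f := by
  rw [TemperedDistribution.smulLeftCLM_smulLeftCLM_apply (jap_hasTemperateGrowth _)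
    (jap_hasTemperateGrowth _)]
  have : ((fun ξ : ℝ => (jap r ξ : ℂ)) * fun ξ : ℝ => (jap (-r) ξ : ℂ)) = fun _ => (1 : ℂ) := by
    ext ξ
    rw [Pi.mul_apply, ← Complex.ofReal_mul, mul_comm (jap r ξ), jap_neg_mul, Complex.ofReal_one]
  rw [this, TemperedDistribution.smulLeftCLM_const, one_smul]

theorem smulLeftCLM_jap_neg' (r : ℝ) (f : 𝓢'(ℝ, ℂ)) :
    TemperedDistribution.smulLeftCLM ℂ (fun ξ => (jap r ξ : ℂ))
      (TemperedDistribution.smulLeftCLM ℂ (fun ξ => (jap (-r) ξ : ℂ)) f) = f := by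
  simpa using smulLeftCLM_jap_neg (-r) f

theorem memLp_extend (z : HalfL2) : MemLp ((Ioi (0 : ℝ)).indicator z) 2 volume :=
  (memLp_indicator_iff_restrict measurableSet_Ioi).2 (Lp.memLp z)

theorem toTemperedDistribution_extend (z : HalfL2) :
    Lp.toTemperedDistribution ((memLp_extend z).toLp _) = Lp.toTemperedDistribution z := by
  ext ψ
  rw [Lp.toTemperedDistribution_apply, Lp.toTemperedDistribution_apply,
    ← integral_indicator measurableSet_Ioi]
  refine integral_congr_ae ?_
  filter_upwards [(memLp_extend z).coeFn_toLp] with ξ hξ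
  rw [hξ]
  by_cases h : ξ ∈ Ioi (0 : ℝ) <;> simp [h]

/-- The distribution whose Fourier transform is `⟨ξ⟩^{-s} z` on `(0, ∞)`. -/
def fromL2Dist (s : ℝ) (z : HalfL2) : 𝓢'(ℝ, ℂ) :=
  𝓕⁻ (TemperedDistribution.smulLeftCLM ℂ (fun ξ => (jap (-s) ξ : ℂ)) (Lp.toTemperedDistribution z))

theorem fourier_fromL2Dist (s : ℝ) (z : HalfL2) :
    𝓕 (fromL2Dist s z) = TemperedDistribution.smulLeftCLM ℂ (fun ξ => (jap (-s) ξ : ℂ))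
      (Lp.toTemperedDistribution z) := by
  rw [fromL2Dist, FourierTransform.fourier_fourierInv_eq]

theorem smulLeftCLM_fourier_fromL2Dist (s : ℝ) (z : HalfL2) :
    TemperedDistribution.smulLeftCLM ℂ (fun ξ => (jap s ξ : ℂ)) (𝓕 (fromL2Dist s z)) =
      Lp.toTemperedDistribution ((memLp_extend z).toLp _) := by
  rw [fourier_fromL2Dist, smulLeftCLM_jap_neg', toTemperedDistribution_extend]

theorem fromL2Dist_mem (s : ℝ) (z : HalfL2) : fromL2Dist s z ∈ sobolevGamma s := by
  refine ⟨TemperedDistribution.memSobolev_iff_exists_smulLeftCLM_fourier.2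
    ⟨_, smulLeftCLM_fourier_fromL2Dist s z⟩, fun x hx => ?_⟩
  by_contra h0
  rw [Distribution.mem_dsupport_iff_not_isVanishingOn] at hx
  refine hx (Iio 0) (by simpa using h0) isOpen_Iio fun ψ hψ => ?_
  rw [fourier_fromL2Dist, TemperedDistribution.smulLeftCLM_apply_apply,
    Lp.toTemperedDistribution_apply]
  refine setIntegral_eq_zero_of_forall_eq_zero fun ξ hξ => ?_
  rw [SchwartzMap.smulLeftCLM_apply_apply (jap_hasTemperateGrowth _),
    image_eq_zero_of_notMem_tsupport fun h => lt_asymm (mem_Iio.1 (hψ h)) (mem_Ioi.1 hξ)]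
  simp

theorem fourier_bessel {s : ℝ} (f : HGamma s) :
    Lp.toTemperedDistribution (𝓕 (HGamma.bessel s f)) =
      TemperedDistribution.smulLeftCLM ℂ (fun ξ => (jap s ξ : ℂ)) (𝓕 (HGamma.toDist f)) := by
  rw [← Lp.fourier_toTemperedDistribution_eq, ← HGamma.bessel_spec,
    TemperedDistribution.fourier_besselPotential_eq_smulLeftCLM_fourier_apply]
  rfl

/-- The element of `H^s_Γ(ℝ)` whose Fourier transform is `⟨ξ⟩^{-s} z` on `(0, ∞)`. -/
def fromL2 (s : ℝ) (z : HalfL2) : HGamma s := ⟨fromL2Dist s z, fromL2Dist_mem s z⟩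

theorem toDist_fromL2 (s : ℝ) (z : HalfL2) : HGamma.toDist (fromL2 s z) = fromL2Dist s z := rfl

/-- Plancherel, since the Fourier transform of the Bessel potential is the extension of `z` by zero.
-/
theorem norm_fromL2 (s : ℝ) (z : HalfL2) : ‖fromL2 s z‖ = ‖z‖ := by
  have h : 𝓕 (HGamma.bessel s (fromL2 s z)) = (memLp_extend z).toLp _ := by
    apply toTemperedDistribution_injective
    rw [Lp.toTemperedDistributionCLM_apply, Lp.toTemperedDistributionCLM_apply, fourier_bessel,
      toDist_fromL2, smulLeftCLM_fourier_fromL2Dist]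
  rw [HGamma.norm_def, ← Lp.norm_fourier_eq, h, Lp.norm_toLp,
    eLpNorm_indicator_eq_eLpNorm_restrict measurableSet_Ioi, Lp.norm_def]

/-- The isometry `z ↦ 𝓕⁻¹ (⟨ξ⟩^{-s} z)` from `L²(0, ∞)` to `H^s_Γ(ℝ)`. -/
def fromL2ₗᵢ (s : ℝ) : HalfL2 →ₗᵢ[ℂ] HGamma s where
  toFun := fromL2 s
  map_add' z w := by
    apply HGamma.toDist_injective
    rw [map_add]
    simp only [toDist_fromL2, fromL2Dist, ← Lp.toTemperedDistributionCLM_apply, map_add,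
      FourierTransform.fourierInv_add]
  map_smul' c z := by
    apply HGamma.toDist_injective
    rw [map_smul]
    simp only [toDist_fromL2, fromL2Dist, ← Lp.toTemperedDistributionCLM_apply, map_smul,
      RingHom.id_apply, FourierTransform.fourierInv_smul]
  norm_map' := norm_fromL2 s

theorem ae_eq_zero_of_isVanishingOn {g : Lp ℂ 2 (volume : Measure ℝ)} {a : Set ℝ} (ha : IsOpen a)
    (hg : Distribution.IsVanishingOn (Lp.toTemperedDistribution g) a) :
    ∀ᵐ ξ, ξ ∈ a → g ξ = 0 := by
  refine ha.ae_eq_zero_of_integral_contDiff_smul_eq_zero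
    (((Lp.memLp g).locallyIntegrable (by norm_num)).locallyIntegrableOn _) fun φ hφ hc hs => ?_
  have h₁ : HasCompactSupport (Complex.ofRealCLM ∘ φ) := hc.comp_left rfl
  have h₂ : ContDiff ℝ ∞ (Complex.ofRealCLM ∘ φ) := by fun_prop
  have h₃ : tsupport (h₁.toSchwartzMap h₂) ⊆ a :=
    (closure_mono (Function.support_comp_subset (map_zero Complex.ofRealCLM) φ)).trans hs
  simpa using hg (h₁.toSchwartzMap h₂) h₃

/-- Every point of `(-∞, 0)` has a neighbourhood on which `g` vanishes almost everywhere, and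
locally null sets are null. The point `0` has measure zero, so `L²` does not distinguish `[0, ∞)`
from `(0, ∞)`. -/
theorem ae_eq_zero_of_dsupport_subset {g : Lp ℂ 2 (volume : Measure ℝ)}
    (hg : Distribution.dsupport (Lp.toTemperedDistribution g) ⊆ Ici 0) :
    ∀ᵐ ξ, ξ ∉ Ioi (0 : ℝ) → g ξ = 0 := by
  have h : volume {ξ : ℝ | ξ < 0 ∧ g ξ ≠ 0} = 0 := by
    refine measure_null_of_locally_null _ fun x hx => ?_
    have hx' := notMem_subset hg (fun h : x ∈ Ici 0 => not_lt.2 h hx.1)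
    obtain ⟨a, ha, ha', hxa⟩ := (Distribution.notMem_dsupport_iff x).1 hx'
    refine ⟨a ∩ {ξ : ℝ | ξ < 0 ∧ g ξ ≠ 0}, inter_comm a _ ▸ inter_mem_nhdsWithin _
      (ha'.mem_nhds hxa), measure_mono_null ?_ (ae_iff.1 (ae_eq_zero_of_isVanishingOn ha' ha))⟩
    rintro ξ ⟨h1, h2⟩ h3
    exact h2.2 (h3 h1)
  have h0 : ∀ᵐ ξ : ℝ, ξ ≠ 0 := by simp [ae_iff]
  filter_upwards [measure_eq_zero_iff_ae_notMem.1 h, h0] with ξ hξ hne hle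
  by_contra hg0
  exact hξ ⟨lt_of_le_of_ne (not_lt.1 hle) hne, hg0⟩

/-- Multiplication by `⟨ξ⟩^s` does not enlarge the support, so the `L²` function `⟨ξ⟩^s 𝓕 f`
vanishes off `(0, ∞)` and is recovered from its restriction. -/
theorem fromL2_surjective (s : ℝ) : Function.Surjective (fromL2 s) := by
  intro f
  set g : Lp ℂ 2 (volume : Measure ℝ) := 𝓕 (HGamma.bessel s f) with hgdef
  have hg : Lp.toTemperedDistribution g = _ := fourier_bessel f
  have hsupp : Distribution.dsupport (Lp.toTemperedDistribution g) ⊆ Ici 0 := by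
    rw [hg]
    exact (Distribution.TemperedDistribution.dsupport_smulLeftCLM_subset
      (jap_hasTemperateGrowth s)).trans f.2.2
  have hz := (Lp.memLp g).restrict (Ioi 0)
  refine ⟨hz.toLp _, HGamma.toDist_injective ?_⟩
  have h : Lp.toTemperedDistribution (hz.toLp _) = Lp.toTemperedDistribution g := by
    rw [← toTemperedDistribution_extend]
    congr 1
    refine Lp.ext ((memLp_extend _).coeFn_toLp.trans ?_)
    filter_upwards [ae_eq_zero_of_dsupport_subset hsupp,
      (ae_restrict_iff' measurableSet_Ioi).1 hz.coeFn_toLp] with ξ h1 h2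
    by_cases h : ξ ∈ Ioi (0 : ℝ)
    · rw [indicator_of_mem h, h2 h]
    · rw [indicator_of_notMem h, h1 h]
  rw [toDist_fromL2, fromL2Dist, h, hg, smulLeftCLM_jap_neg, FourierTransform.fourierInv_fourier_eq]

/-- The isometric isomorphism `z ↦ 𝓕⁻¹ (⟨ξ⟩^{-s} z)` of `L²(0, ∞)` with `H^s_Γ(ℝ)`. -/
def fromL2Equiv (s : ℝ) : HalfL2 ≃ₗᵢ[ℂ] HGamma s :=
  LinearIsometryEquiv.ofSurjective (fromL2ₗᵢ s) (fromL2_surjective s)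

theorem fromL2Equiv_apply (s : ℝ) (z : HalfL2) : fromL2Equiv s z = fromL2 s z := rfl

theorem fourier_toDist_fromL2_apply (s : ℝ) (z : HalfL2) (ψ : 𝓢(ℝ, ℂ)) :
    (𝓕 (HGamma.toDist (fromL2 s z))) ψ = ∫ ξ in Ioi (0 : ℝ), (jap (-s) ξ * z ξ) * ψ ξ := by
  rw [toDist_fromL2, fourier_fromL2Dist, TemperedDistribution.smulLeftCLM_apply_apply,
    Lp.toTemperedDistribution_apply]
  refine integral_congr_ae (.of_forall fun ξ => ?_)
  simp only [SchwartzMap.smulLeftCLM_apply_apply (jap_hasTemperateGrowth _), smul_eq_mul]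
  ring

theorem toDist_fromL2_apply (s : ℝ) (z : HalfL2) (ψ : 𝓢(ℝ, ℂ)) :
    HGamma.toDist (fromL2 s z) ψ =
      ∫ ξ in Ioi (0 : ℝ), (jap (-s) ξ * z ξ) * (𝓕⁻ ψ : 𝓢(ℝ, ℂ)) ξ := by
  rw [← fourier_toDist_fromL2_apply, TemperedDistribution.fourier_apply,
    FourierTransform.fourier_fourierInv_eq]

/-! ### Distributions with a density on the half-line and their convolution -/

theorem jap_neg_le_one {k : ℝ} (hk : 0 ≤ k) (ξ : ℝ) : jap (-k) ξ ≤ 1 := by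
  simpa using jap_mono (neg_nonpos.2 hk) ξ

theorem jap_le_jap_of_abs_le {k x y : ℝ} (hk : 0 ≤ k) (h : |x| ≤ |y|) : jap k x ≤ jap k y := by
  unfold jap
  simp only [Real.norm_eq_abs]
  gcongr

theorem jap_neg_le_of_abs_le {k x y : ℝ} (hk : 0 ≤ k) (h : |x| ≤ |y|) :
    jap (-k) y ≤ jap (-k) x := by
  unfold jap
  simp only [Real.norm_eq_abs]
  exact Real.rpow_le_rpow_of_nonpos (by positivity) (by gcongr) (by linarith)

/-- There is no cancellation on the half-line: `|x|` and `|y|` are at most `|x + y|`. This is why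
densities of arbitrary polynomial growth can be convolved there. -/
theorem jap_neg_add_le {k l x y : ℝ} (hk : 0 ≤ k) (hl : 0 ≤ l) (hx : 0 ≤ x) (hy : 0 ≤ y) :
    jap (-(k + l)) (x + y) ≤ jap (-k) x * jap (-l) y := by
  rw [neg_add, jap_add]
  have h1 : |x| ≤ |x + y| := by rw [abs_of_nonneg hx, abs_of_nonneg (by positivity)]; linarith
  have h2 : |y| ≤ |x + y| := by rw [abs_of_nonneg hy, abs_of_nonneg (by positivity)]; linarith
  exact mul_le_mul (jap_neg_le_of_abs_le hk h1) (jap_neg_le_of_abs_le hl h2) (jap_pos _ _).le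
    (jap_pos _ _).le

/-- Peetre's inequality: `1 + y² ≤ 2 (1 + x²)(1 + (x + y)²)`, raised to the power `k/2`. -/
theorem jap_neg_add_le_peetre {k : ℝ} (hk : 0 ≤ k) (x y : ℝ) :
    jap (-k) (x + y) ≤ 2 ^ (k / 2) * jap k x * jap (-k) y := by
  have h : jap k y ≤ 2 ^ (k / 2) * jap k x * jap k (x + y) := by
    unfold jap
    simp only [Real.norm_eq_abs, sq_abs]
    rw [← Real.mul_rpow (by positivity) (by positivity),
      ← Real.mul_rpow (by positivity) (by positivity)]
    refine Real.rpow_le_rpow (by positivity) ?_ (by positivity)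
    nlinarith [sq_nonneg (2 * x + y), mul_nonneg (sq_nonneg x) (sq_nonneg (x + y))]
  have h1 := jap_neg_mul k y
  have h2 := jap_neg_mul k (x + y)
  have := mul_le_mul_of_nonneg_left h
    (mul_nonneg (jap_pos (-k) (x + y)).le (jap_pos (-k) y).le)
  calc jap (-k) (x + y) = jap (-k) (x + y) * jap (-k) y * jap k y := by
        rw [mul_assoc, h1, mul_one]
    _ ≤ _ := this
    _ = 2 ^ (k / 2) * jap k x * jap (-k) y * (jap (-k) (x + y) * jap k (x + y)) := by ring
    _ = _ := by rw [h2, mul_one]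

theorem exists_norm_le_jap (φ : 𝓢(ℝ, ℂ)) (k : ℝ) : ∃ C, 0 ≤ C ∧ ∀ x, ‖φ x‖ ≤ C * jap (-k) x := by
  refine ⟨_, apply_nonneg (SchwartzMap.seminorm ℝ 0 0)
    (SchwartzMap.smulLeftCLM ℂ (fun ξ => (jap k ξ : ℂ)) φ), fun x => ?_⟩
  have h := SchwartzMap.norm_le_seminorm ℝ
    (SchwartzMap.smulLeftCLM ℂ (fun ξ => (jap k ξ : ℂ)) φ) x
  rw [SchwartzMap.smulLeftCLM_apply_apply (jap_hasTemperateGrowth k), norm_smul, Complex.norm_real,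
    Real.norm_of_nonneg (jap_pos _ _).le] at h
  calc ‖φ x‖ = jap k x * ‖φ x‖ * jap (-k) x := by
        rw [mul_right_comm, mul_comm (jap k x), jap_neg_mul, one_mul]
    _ ≤ _ := by gcongr; exact (jap_pos _ _).le

/-- `f` is integrable on `(0, ∞)` with respect to a polynomial weight. -/
def PolyIntegrable (f : ℝ → ℂ) : Prop :=
  ∃ k : ℝ, 0 ≤ k ∧ Integrable (fun ξ => (jap (-k) ξ : ℂ) * f ξ) halfLine

/-- The distribution `S` is the function `f` on `(0, ∞)`, extended by zero. -/
def HasDensity (S : 𝓢'(ℝ, ℂ)) (f : ℝ → ℂ) : Prop :=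
  ∀ ψ : 𝓢(ℝ, ℂ), S ψ = ∫ ξ in Ioi (0 : ℝ), f ξ * ψ ξ

/-- Convolution of functions on the half-line. -/
def halfConv (f g : ℝ → ℂ) (ξ : ℝ) : ℂ := ∫ η in Ioo 0 ξ, f η * g (ξ - η)

theorem PolyIntegrable.aestronglyMeasurable {f : ℝ → ℂ} (hf : PolyIntegrable f) :
    AEStronglyMeasurable f halfLine := by
  obtain ⟨k, -, h⟩ := hf
  have h1 : AEStronglyMeasurable (fun ξ => (jap k ξ : ℂ)) halfLine :=
    (Complex.continuous_ofReal.comp (continuous_jap k)).aestronglyMeasurable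
  refine (h1.mul h.1).congr (.of_forall fun ξ => ?_)
  simp only [Pi.mul_apply]
  rw [← mul_assoc, ← Complex.ofReal_mul, mul_comm (jap k ξ), jap_neg_mul, Complex.ofReal_one,
    one_mul]

theorem halfConv_eq (f g : ℝ → ℂ) (ξ : ℝ) :
    halfConv f g ξ = ∫ η, (Ioi 0).indicator f η * (Ioi 0).indicator g (ξ - η) := by
  rw [halfConv, ← integral_indicator measurableSet_Ioo]
  refine integral_congr_ae (.of_forall fun η => ?_)
  by_cases h1 : 0 < η <;> by_cases h2 : η < ξ <;> simp [indicator, h1, h2]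

/-! ### Smoothness and polynomial growth of `φ ∗ S⁻` -/

section Reflect

variable {f : ℝ → ℂ}

/-- The function `x ↦ ∫_{y > 0} f(y) φ(y + x) dy`. -/
def shiftPairing (f : ℝ → ℂ) (φ : 𝓢(ℝ, ℂ)) (x : ℝ) : ℂ := ∫ y in Ioi (0 : ℝ), f y * φ (y + x)

theorem shiftPairing_eq (f : ℝ → ℂ) (φ : 𝓢(ℝ, ℂ)) (x : ℝ) :
    shiftPairing f φ x = ∫ y, (Ioi 0).indicator f y * φ (x + y) := by
  rw [shiftPairing, ← integral_indicator measurableSet_Ioi]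
  simp only [indicator_mul_left, add_comm]

theorem HasDensity.convReflect_eq {S : 𝓢'(ℝ, ℂ)} (hS : HasDensity S f) (φ : 𝓢(ℝ, ℂ)) :
    convReflect φ S = shiftPairing f φ := by
  ext x
  rw [convReflect, hS, shiftPairing]
  simp

theorem norm_mul_shift_le {k C : ℝ} (hk : 0 ≤ k) {φ : 𝓢(ℝ, ℂ)} (hC : 0 ≤ C)
    (h : ∀ x, ‖φ x‖ ≤ C * jap (-k) x) (x y : ℝ) :
    ‖f y * φ (y + x)‖ ≤ C * 2 ^ (k / 2) * jap k x * ‖(jap (-k) y : ℂ) * f y‖ := by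
  rw [norm_mul, norm_mul, Complex.norm_real, Real.norm_of_nonneg (jap_pos _ _).le]
  calc ‖f y‖ * ‖φ (y + x)‖ ≤ ‖f y‖ * (C * (2 ^ (k / 2) * jap k x * jap (-k) y)) := by
        gcongr
        refine (h _).trans ?_
        rw [add_comm y x]
        gcongr
        exact jap_neg_add_le_peetre hk x y
    _ = _ := by ring

theorem aestronglyMeasurable_mul_shift (hf : PolyIntegrable f) (φ : 𝓢(ℝ, ℂ)) (x : ℝ) :
    AEStronglyMeasurable (fun y => f y * φ (y + x)) halfLine :=
  hf.aestronglyMeasurable.mul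
    (φ.continuous.comp (continuous_id.add continuous_const)).aestronglyMeasurable

theorem integrable_mul_shift (hf : PolyIntegrable f) (φ : 𝓢(ℝ, ℂ)) (x : ℝ) :
    Integrable (fun y => f y * φ (y + x)) halfLine := by
  have hm := aestronglyMeasurable_mul_shift hf φ x
  obtain ⟨k, hk, hint⟩ := hf
  obtain ⟨C, hC, h⟩ := exists_norm_le_jap φ k
  exact (hint.norm.const_mul _).mono' hm (.of_forall (norm_mul_shift_le hk hC h x))

/-- Differentiation under the integral sign. By Peetre's inequality the derivative of the integrand
is bounded, on the unit ball around `x`, by a multiple of the integrable function `⟨y⟩^{-k} |f(y)|`.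
-/
theorem hasDerivAt_shiftPairing (hf : PolyIntegrable f) (φ : 𝓢(ℝ, ℂ)) (x : ℝ) :
    HasDerivAt (shiftPairing f φ) (shiftPairing f (SchwartzMap.derivCLM ℂ ℂ φ) x) x := by
  have hm := fun φ x => aestronglyMeasurable_mul_shift hf φ x
  have hi := fun φ x => integrable_mul_shift hf φ x
  obtain ⟨k, hk, hint⟩ := hf
  obtain ⟨C, hC, h⟩ := exists_norm_le_jap (SchwartzMap.derivCLM ℂ ℂ φ) k
  refine (hasDerivAt_integral_of_dominated_loc_of_deriv_le (μ := halfLine)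
    (F := fun x y => f y * φ (y + x)) (F' := fun x y => f y * SchwartzMap.derivCLM ℂ ℂ φ (y + x))
    (bound := fun y => C * 2 ^ (k / 2) * jap k (|x| + 1) * ‖(jap (-k) y : ℂ) * f y‖)
    (Metric.ball_mem_nhds x one_pos) (.of_forall (hm φ)) (hi φ x)
    (hm (SchwartzMap.derivCLM ℂ ℂ φ) x) (.of_forall fun y z hz => ?_)
    (hint.norm.const_mul _) (.of_forall fun y z _ => ?_)).2
  · refine (norm_mul_shift_le hk hC h z y).trans ?_
    have : jap k z ≤ jap k (|x| + 1) := by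
      refine jap_le_jap_of_abs_le hk ?_
      rw [abs_of_nonneg (by positivity : 0 ≤ |x| + 1)]
      have := abs_sub_abs_le_abs_sub z x
      rw [Metric.mem_ball, Real.dist_eq] at hz
      linarith
    gcongr
  · have := (φ.hasDerivAt (y + z)).comp_const_add y z
    exact this.const_mul (f y)

theorem norm_shiftPairing_le (hf : PolyIntegrable f) (φ : 𝓢(ℝ, ℂ)) :
    ∃ (k : ℕ) (C : ℝ), ∀ x, ‖shiftPairing f φ x‖ ≤ C * (1 + ‖x‖) ^ k := by
  obtain ⟨k, hk, hint⟩ := hf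
  obtain ⟨C, hC, h⟩ := exists_norm_le_jap φ k
  refine ⟨⌈k⌉₊, C * 2 ^ (k / 2) * ∫ y in Ioi (0 : ℝ), ‖(jap (-k) y : ℂ) * f y‖, fun x => ?_⟩
  refine (norm_integral_le_of_norm_le (hint.norm.const_mul (C * 2 ^ (k / 2) * jap k x))
    (.of_forall (norm_mul_shift_le hk hC h x))).trans ?_
  rw [integral_const_mul]
  have : jap k x ≤ (1 + ‖x‖) ^ ⌈k⌉₊ := by
    rw [jap]
    calc (1 + ‖x‖ ^ 2) ^ (k / 2) ≤ ((1 + ‖x‖) ^ 2) ^ (k / 2) := by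
          refine Real.rpow_le_rpow (by positivity) ?_ (by positivity)
          nlinarith [norm_nonneg x]
      _ = (1 + ‖x‖) ^ k := by
          rw [← Real.rpow_natCast, ← Real.rpow_mul (by positivity)]
          congr 1; push_cast; ring
      _ ≤ (1 + ‖x‖) ^ (⌈k⌉₊ : ℝ) :=
          Real.rpow_le_rpow_of_exponent_le (by linarith [norm_nonneg x]) (Nat.le_ceil k)
      _ = _ := Real.rpow_natCast _ _
  have hI : 0 ≤ ∫ y in Ioi (0 : ℝ), ‖(jap (-k) y : ℂ) * f y‖ := integral_nonneg fun _ => norm_nonneg _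
  calc _ ≤ C * 2 ^ (k / 2) * (1 + ‖x‖) ^ ⌈k⌉₊ * ∫ y in Ioi (0 : ℝ), ‖(jap (-k) y : ℂ) * f y‖ := by
        gcongr
    _ = _ := by ring

theorem iteratedDeriv_shiftPairing (hf : PolyIntegrable f) (n : ℕ) (φ : 𝓢(ℝ, ℂ)) :
    iteratedDeriv n (shiftPairing f φ) = shiftPairing f ((SchwartzMap.derivCLM ℂ ℂ)^[n] φ) := by
  induction n generalizing φ with
  | zero => simp
  | succ n ih =>
    rw [iteratedDeriv_succ', Function.iterate_succ_apply, ← ih]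
    congr 1
    ext x
    exact (hasDerivAt_shiftPairing hf φ x).deriv

/-- All derivatives fall on `φ`, so each is a function of the same kind and grows polynomially.
Temperate growth is the condition under which `smulLeftCLM` evaluates to the actual multiplication
by `φ ∗ S⁻`. -/
theorem hasTemperateGrowth_shiftPairing (hf : PolyIntegrable f) (φ : 𝓢(ℝ, ℂ)) :
    (shiftPairing f φ).HasTemperateGrowth := by
  refine ⟨contDiff_of_differentiable_iteratedDeriv fun m _ x => ?_, fun n => ?_⟩
  · rw [iteratedDeriv_shiftPairing hf]
    exact (hasDerivAt_shiftPairing hf _ x).differentiableAt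
  · simp only [norm_iteratedFDeriv_eq_norm_iteratedDeriv, iteratedDeriv_shiftPairing hf]
    exact norm_shiftPairing_le hf _

end Reflect

/-! ### Existence and uniqueness of the `𝓢'`-convolution of densities on the half-line -/

theorem memDPrimeL1_of_integrable {T : 𝓢'(ℝ, ℂ)} {h : ℝ → ℂ} (hh : Integrable h halfLine)
    (hT : HasDensity T h) : MemDPrimeL1 T := by
  refine ⟨0, ∫ x in Ioi (0 : ℝ), ‖h x‖, fun ψ => ?_⟩
  rw [hT, Finset.sum_range_one, ← integral_mul_const]
  refine norm_integral_le_of_norm_le (hh.norm.mul_const _) (.of_forall fun x => ?_)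
  rw [norm_mul]
  gcongr
  exact SchwartzMap.norm_le_seminorm ℂ ψ x

theorem pairingWithOneEq_of_integrable {T : 𝓢'(ℝ, ℂ)} {h : ℝ → ℂ} (hh : Integrable h halfLine)
    (hT : HasDensity T h) : PairingWithOneEq T (∫ x in Ioi (0 : ℝ), h x) := by
  intro χ hχ
  simp only [hT _]
  refine tendsto_integral_of_dominated_convergence (fun x => ‖h x‖ * SchwartzMap.seminorm ℂ 0 0 χ)
    (fun n => hh.1.mul (dilate χ n).continuous.aestronglyMeasurable) (hh.norm.mul_const _)
    (fun n => .of_forall fun x => ?_) (.of_forall fun x => ?_)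
  · rw [norm_mul, dilate_apply]
    gcongr
    exact SchwartzMap.norm_le_seminorm ℂ χ _
  · have h1 : Tendsto (fun n : ℕ => x / ((n : ℝ) + 1)) atTop (𝓝 0) :=
      (tendsto_const_nhds (x := x)).div_atTop
        (tendsto_atTop_add_const_right _ _ tendsto_natCast_atTop_atTop)
    have h2 := (χ.continuous.tendsto 0).comp h1
    rw [hχ] at h2
    simpa [dilate_apply, Function.comp_def] using h2.const_mul (h x)

/-- A Schwartz function with `χ(0) = 1` exists, so the pairing with `1` is a limit along an actual
sequence and has at most one value. -/
theorem IsSConvolution.unique {S T W W' : 𝓢'(ℝ, ℂ)} (h : IsSConvolution S T W)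
    (h' : IsSConvolution S T W') : W = W' := by
  obtain ⟨χ, hχ⟩ : ∃ χ : 𝓢(ℝ, ℂ), χ 0 = 1 := by
    let b : ContDiffBump (0 : ℝ) := default
    have h₁ : HasCompactSupport (Complex.ofRealCLM ∘ b) := b.hasCompactSupport.comp_left rfl
    have h₂ : ContDiff ℝ ∞ (Complex.ofRealCLM ∘ b) := by
      exact Complex.ofRealCLM.contDiff.comp b.contDiff
    refine ⟨h₁.toSchwartzMap h₂, ?_⟩
    change ((b 0 : ℝ) : ℂ) = 1
    rw [b.one_of_mem_closedBall (by simp [b.rIn_pos.le])]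
    simp
  ext φ
  exact tendsto_nhds_unique ((h φ).2 χ hχ) ((h' φ).2 χ hχ)

section Convolution

variable {f g : ℝ → ℂ}

theorem integrable_indicator_mul_indicator (hf : PolyIntegrable f) (hg : PolyIntegrable g)
    (φ : 𝓢(ℝ, ℂ)) :
    Integrable (fun z : ℝ × ℝ => (Ioi 0).indicator g z.1 * (Ioi 0).indicator f z.2 * φ (z.1 + z.2))
      (volume.prod volume) := by
  have hmf := (aestronglyMeasurable_indicator_iff measurableSet_Ioi).2 hf.aestronglyMeasurable
  have hmg := (aestronglyMeasurable_indicator_iff measurableSet_Ioi).2 hg.aestronglyMeasurable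
  obtain ⟨k, hk, hfi⟩ := hf
  obtain ⟨l, hl, hgi⟩ := hg
  -- Decay of order `l + k` splits into order `l` in the first variable and order `k` in the second,
  -- which compensates both weights.
  obtain ⟨C, hC, h⟩ := exists_norm_le_jap φ (l + k)
  rw [← IntegrableOn, ← integrable_indicator_iff measurableSet_Ioi] at hfi hgi
  refine ((hgi.norm.mul_prod hfi.norm).const_mul C).mono' (((hmg.comp_fst).mul (hmf.comp_snd)).mul
    (φ.continuous.comp (continuous_fst.add continuous_snd)).aestronglyMeasurable)
    (.of_forall fun z => ?_)
  by_cases h1 : 0 < z.1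
  swap; · simp [h1]
  by_cases h2 : 0 < z.2
  swap; · simp [h2]
  simp only [indicator_of_mem (mem_Ioi.2 h1), indicator_of_mem (mem_Ioi.2 h2), norm_mul,
    Complex.norm_real, Real.norm_of_nonneg (jap_pos _ _).le]
  calc _ ≤ ‖g z.1‖ * ‖f z.2‖ * (C * (jap (-l) z.1 * jap (-k) z.2)) := by
        gcongr
        exact (h _).trans (by gcongr; exact jap_neg_add_le hl hk h1.le h2.le)
    _ = _ := by ring

/-- The shear `(ξ, η) ↦ (ξ - η, η)` preserves Lebesgue measure on the plane. -/
theorem integrable_halfConv_mul (hf : PolyIntegrable f) (hg : PolyIntegrable g) (φ : 𝓢(ℝ, ℂ)) :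
    Integrable (fun z : ℝ × ℝ =>
      (Ioi 0).indicator g (z.1 - z.2) * (Ioi 0).indicator f z.2 * φ z.1) (volume.prod volume) := by
  have := (measurePreserving_sub_prod (volume : Measure ℝ) (volume : Measure ℝ)).integrable_comp_of_integrable
    (integrable_indicator_mul_indicator hf hg φ)
  simpa [Function.comp_def] using this

/-- Both sides are the integral of `g(x) f(y) φ(x + y)` over `x, y > 0`, by Fubini and the
substitution `ξ = x + y`. -/
theorem integral_mul_shiftPairing (hf : PolyIntegrable f) (hg : PolyIntegrable g) (φ : 𝓢(ℝ, ℂ)) :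
    ∫ x in Ioi (0 : ℝ), g x * shiftPairing f φ x =
      ∫ ξ in Ioi (0 : ℝ), halfConv f g ξ * φ ξ := by
  have e1 : ∫ ξ in Ioi (0 : ℝ), halfConv f g ξ * φ ξ = ∫ ξ, ∫ η,
      (Ioi 0).indicator g (ξ - η) * (Ioi 0).indicator f η * φ ξ := by
    rw [← integral_indicator measurableSet_Ioi]
    refine integral_congr_ae (.of_forall fun ξ => ?_)
    simp only
    rw [integral_mul_const]
    simp_rw [mul_comm ((Ioi 0).indicator g _)]
    rw [← halfConv_eq]
    by_cases h : 0 < ξ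
    · simp [h]
    · simp [h, halfConv]
  have e2 : ∫ x in Ioi (0 : ℝ), g x * shiftPairing f φ x = ∫ x, ∫ y,
      (Ioi 0).indicator g x * (Ioi 0).indicator f y * φ (x + y) := by
    rw [← integral_indicator measurableSet_Ioi]
    refine integral_congr_ae (.of_forall fun x => ?_)
    simp only [mul_assoc]
    rw [integral_const_mul, indicator_mul_left, shiftPairing_eq]
  rw [e1, e2]
  refine (integral_integral_swap (integrable_indicator_mul_indicator hf hg φ)).trans
    (Eq.trans ?_ (integral_integral_swap (integrable_halfConv_mul hf hg φ)).symm)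
  refine integral_congr_ae (.of_forall fun η => ?_)
  simp only
  rw [← integral_sub_right_eq_self (fun x => (Ioi 0).indicator g x * (Ioi 0).indicator f η * φ (x + η)) η]
  simp

/-- The `𝓢'`-convolution of two polynomially integrable functions on the half-line exists and is
their convolution. -/
theorem isSConvolution_of_hasDensity {S T W : 𝓢'(ℝ, ℂ)} (hf : PolyIntegrable f)
    (hg : PolyIntegrable g) (hS : HasDensity S f) (hT : HasDensity T g)
    (hW : HasDensity W (halfConv f g)) : IsSConvolution S T W := by
  intro φ
  have hint : Integrable (fun x => g x * shiftPairing f φ x) halfLine := by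
    have := (integrable_indicator_mul_indicator hf hg φ).integral_prod_left
    rw [← IntegrableOn, ← integrable_indicator_iff measurableSet_Ioi]
    refine this.congr (.of_forall fun x => ?_)
    simp only [mul_assoc]
    rw [integral_const_mul, indicator_mul_left, shiftPairing_eq]
  have hd : HasDensity (TemperedDistribution.smulLeftCLM ℂ (convReflect φ S) T)
      (fun x => g x * shiftPairing f φ x) := by
    intro ψ
    rw [hS.convReflect_eq, TemperedDistribution.smulLeftCLM_apply_apply, hT]
    refine integral_congr_ae (.of_forall fun x => ?_)
    simp only [SchwartzMap.smulLeftCLM_apply_apply (hasTemperateGrowth_shiftPairing hf φ),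
      smul_eq_mul]
    ring
  refine ⟨memDPrimeL1_of_integrable hint hd, ?_⟩
  rw [hW, ← integral_mul_shiftPairing hf hg]
  exact pairingWithOneEq_of_integrable hint hd

end Convolution

/-! ### Estimates for convolution powers on the half-line -/

section Weights

theorem jap_neg_half_le {s ξ : ℝ} (hs : 0 ≤ s) {η : ℝ} (h : |ξ| ≤ 2 * |η|) :
    jap (-s) η ≤ 2 ^ s * jap (-s) ξ := by
  have h1 : jap s ξ ≤ 2 ^ s * jap s η := by
    unfold jap
    simp only [Real.norm_eq_abs]
    have : (2 : ℝ) ^ s = (2 ^ 2) ^ (s / 2) := by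
      rw [← Real.rpow_natCast, ← Real.rpow_mul (by norm_num)]; congr 1; push_cast; ring
    rw [this, ← Real.mul_rpow (by positivity) (by positivity)]
    refine Real.rpow_le_rpow (by positivity) ?_ (by positivity)
    nlinarith [abs_nonneg ξ, abs_nonneg η]
  have := mul_le_mul_of_nonneg_left h1 (mul_nonneg (jap_pos (-s) ξ).le (jap_pos (-s) η).le)
  calc jap (-s) η = jap (-s) ξ * jap (-s) η * jap s ξ := by
        rw [mul_right_comm, jap_neg_mul, one_mul]
    _ ≤ _ := this
    _ = 2 ^ s * jap (-s) ξ * (jap (-s) η * jap s η) := by ring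
    _ = _ := by rw [jap_neg_mul, mul_one]

/-- One of `η` and `ξ - η` is at least `ξ/2`, so its weight is at most `2^s ⟨ξ⟩^{-s}`. The sum on
the right contains the remaining weight in either case. -/
theorem jap_neg_mul_jap_neg_le {s ξ η : ℝ} (hs : 0 ≤ s) (hη : η ∈ Ioo 0 ξ) :
    jap (-s) η * jap (-s) (ξ - η) ≤ 2 ^ s * jap (-s) ξ * (jap (-s) η + jap (-s) (ξ - η)) := by
  obtain ⟨h1, h2⟩ := hη
  have p1 := jap_pos (-s) η
  have p2 := jap_pos (-s) (ξ - η)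
  have p3 : 0 < 2 ^ s * jap (-s) ξ := mul_pos (by positivity) (jap_pos _ _)
  rcases le_total ξ (2 * η) with h | h
  · have := jap_neg_half_le hs (ξ := ξ) (η := η)
      (by rw [abs_of_pos (h1.trans h2), abs_of_pos h1]; exact h)
    nlinarith
  · have := jap_neg_half_le hs (ξ := ξ) (η := ξ - η)
      (by rw [abs_of_pos (h1.trans h2), abs_of_pos (sub_pos.2 h2)]; linarith)
    nlinarith

/-- For `s ≥ 0` the two remaining weights are at most `1`, which gives `⟨ξ⟩^{-s}`. For `s ≤ 0` the
weights increase and each is at most `⟨ξ⟩^{-s}`, which gives `⟨ξ⟩^{-2s}`. -/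
theorem jap_mul_jap_le_of_pair {s ξ η : ℝ} (hη : η ∈ Ioo 0 ξ) :
    jap (-s) η * jap (-s) (ξ - η) ≤ 2 ^ (|s| + 1) * jap (-s + max (-s) 0) ξ := by
  rcases le_total 0 s with hs | hs
  · have := jap_neg_mul_jap_neg_le hs hη
    rw [max_eq_right (by linarith), add_zero, abs_of_nonneg hs, Real.rpow_add_one (by norm_num)]
    have p3 : 0 < 2 ^ s * jap (-s) ξ := mul_pos (by positivity) (jap_pos _ _)
    nlinarith [jap_neg_le_one hs η, jap_neg_le_one hs (ξ - η)]
  · obtain ⟨h1, h2⟩ := hη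
    have hs' : 0 ≤ -s := by linarith
    rw [max_eq_left hs', jap_add]
    have e1 : jap (-s) η ≤ jap (-s) ξ := jap_le_jap_of_abs_le hs'
      (by rw [abs_of_pos h1, abs_of_pos (h1.trans h2)]; exact h2.le)
    have e2 : jap (-s) (ξ - η) ≤ jap (-s) ξ := jap_le_jap_of_abs_le hs'
      (by rw [abs_of_pos (sub_pos.2 h2), abs_of_pos (h1.trans h2)]; linarith)
    have h3 : (1 : ℝ) ≤ 2 ^ (|s| + 1) := Real.one_le_rpow (by norm_num) (by positivity)
    calc _ ≤ jap (-s) ξ * jap (-s) ξ := mul_le_mul e1 e2 (jap_pos _ _).le (jap_pos _ _).le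
      _ ≤ _ := le_mul_of_one_le_left (mul_pos (jap_pos _ _) (jap_pos _ _)).le h3

/-- Replacing `s` by `σ < 1/2` leads to `∫_0^ξ η^{-2σ} dη = ξ^{1-2σ}/(1 - 2σ)`. This treats all `s ≥
0` alike, without a separate logarithmic case at `s = 1/2`. -/
theorem lintegral_jap_le {s σ ξ : ℝ} (hσ : 0 ≤ σ) (hσ' : σ < 1 / 2) (hs : σ ≤ s) (hξ : 0 < ξ) :
    ∫⁻ η in Ioo 0 ξ, ENNReal.ofReal (jap (-s) η) ^ 2 ≤
      ENNReal.ofReal ((1 - 2 * σ)⁻¹ * jap (1 - 2 * σ) ξ) := by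
  have h1 : ∀ η ∈ Ioo 0 ξ, ENNReal.ofReal (jap (-s) η) ^ 2 ≤ ENNReal.ofReal (η ^ (-(2 * σ))) := by
    intro η hη
    rw [← ENNReal.ofReal_pow (jap_pos _ _).le]
    refine ENNReal.ofReal_le_ofReal ?_
    calc jap (-s) η ^ 2 ≤ jap (-σ) η ^ 2 := by
          have := jap_mono (neg_le_neg hs) η
          have := jap_pos (-s) η
          gcongr
      _ = (1 + ‖η‖ ^ 2) ^ (-σ) := by
          rw [jap, ← Real.rpow_natCast, ← Real.rpow_mul (by positivity)]
          congr 1; push_cast; ring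
      _ ≤ (η ^ 2) ^ (-σ) := by
          refine Real.rpow_le_rpow_of_nonpos (by have := hη.1; positivity) ?_ (by linarith)
          rw [Real.norm_eq_abs, sq_abs]; linarith
      _ = _ := by
          rw [← Real.rpow_natCast, ← Real.rpow_mul hη.1.le]
          congr 1; push_cast; ring
  have hr : -1 < -(2 * σ) := by linarith
  have hi : IntegrableOn (fun η : ℝ => η ^ (-(2 * σ))) (Ioo 0 ξ) :=
    (intervalIntegral.integrableOn_Ioo_rpow_iff hξ).2 hr
  calc _ ≤ ∫⁻ η in Ioo 0 ξ, ENNReal.ofReal (η ^ (-(2 * σ))) :=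
        setLIntegral_mono' measurableSet_Ioo h1
    _ = ENNReal.ofReal (∫ η in Ioo 0 ξ, η ^ (-(2 * σ))) := by
        rw [ofReal_integral_eq_lintegral_ofReal hi]
        filter_upwards [self_mem_ae_restrict measurableSet_Ioo] with η hη
        exact Real.rpow_nonneg hη.1.le _
    _ = ENNReal.ofReal ((1 - 2 * σ)⁻¹ * ξ ^ (1 - 2 * σ)) := by
        rw [← integral_Ioc_eq_integral_Ioo, ← intervalIntegral.integral_of_le hξ.le,
          integral_rpow (.inl hr), Real.zero_rpow (by linarith)]
        congr 1
        rw [sub_zero, div_eq_inv_mul]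
        congr 2 <;> ring
    _ ≤ _ := by
        refine ENNReal.ofReal_le_ofReal (mul_le_mul_of_nonneg_left ?_ (by
          rw [inv_nonneg]; linarith))
        rw [jap]
        calc ξ ^ (1 - 2 * σ) = (ξ ^ 2) ^ ((1 - 2 * σ) / 2) := by
              rw [← Real.rpow_natCast, ← Real.rpow_mul hξ.le]
              congr 1; push_cast; ring
          _ ≤ _ := by
              refine Real.rpow_le_rpow (by positivity) ?_ (by linarith)
              rw [Real.norm_eq_abs, sq_abs]; linarith

theorem memLp_jap {r : ℝ} (hr : r < -(1 / 2)) : MemLp (fun ξ => (jap r ξ : ℂ)) 2 halfLine := by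
  have hc : Continuous fun ξ => (jap r ξ : ℂ) := Complex.continuous_ofReal.comp (continuous_jap r)
  refine MemLp.restrict _ ((memLp_two_iff_integrable_sq_norm hc.aestronglyMeasurable).2 ?_)
  have := integrable_rpow_neg_one_add_norm_sq (E := ℝ) (μ := volume) (r := -(2 * r))
    (by rw [Module.finrank_self]; push_cast; linarith)
  refine this.congr (.of_forall fun ξ => ?_)
  simp only [Complex.norm_real, Real.norm_of_nonneg (jap_pos _ _).le]
  rw [jap, ← Real.rpow_natCast ((1 + ‖ξ‖ ^ 2) ^ (r / 2)), ← Real.rpow_mul (by positivity)]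
  congr 1; push_cast; ring

end Weights

/-! ### Pointwise bounds for convolutions by weighted Cauchy–Schwarz -/

section Convolution

/-- The convolution of the absolute values. -/
def lconv (f g : ℝ → ℂ) (ξ : ℝ) : ENNReal := ∫⁻ η in Ioo 0 ξ, ‖f η‖ₑ * ‖g (ξ - η)‖ₑ

variable {f g : ℝ → ℂ}

theorem lintegral_Ioo_sub (φ : ℝ → ENNReal) (ξ : ℝ) :
    ∫⁻ η in Ioo 0 ξ, φ (ξ - η) = ∫⁻ η in Ioo 0 ξ, φ η := by
  rw [← lintegral_indicator measurableSet_Ioo, ← lintegral_indicator measurableSet_Ioo,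
    ← lintegral_sub_left_eq_self _ ξ]
  refine lintegral_congr fun η => ?_
  by_cases h1 : 0 < η <;> by_cases h2 : η < ξ <;> simp [indicator, h1, h2]

theorem lintegral_Ioo_sq_le (f : ℝ → ℂ) (ξ : ℝ) :
    (∫⁻ η in Ioo 0 ξ, ‖f η‖ₑ ^ (2 : ℝ)) ^ (1 / 2 : ℝ) ≤ eLpNorm f 2 halfLine := by
  rw [eLpNorm_eq_lintegral_rpow_enorm_toReal (by norm_num) (by norm_num)]
  simp only [ENNReal.toReal_ofNat]
  exact ENNReal.rpow_le_rpow (lintegral_mono_set Ioo_subset_Ioi_self) (by norm_num)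

theorem lintegral_Ioo_mul_le {u : ℝ → ENNReal} (hu : Measurable u) (hg : StronglyMeasurable g)
    (ξ : ℝ) : ∫⁻ η in Ioo 0 ξ, u η * ‖g (ξ - η)‖ₑ ≤
      (∫⁻ η in Ioo 0 ξ, u η ^ 2) ^ (1 / 2 : ℝ) * eLpNorm g 2 halfLine := by
  have hg' : Measurable fun η => ‖g (ξ - η)‖ₑ :=
    (hg.comp_measurable (measurable_const.sub measurable_id)).enorm
  refine (ENNReal.lintegral_mul_le_Lp_mul_Lq (volume.restrict (Ioo 0 ξ)) Real.HolderConjugate.two_two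
    hu.aemeasurable hg'.aemeasurable).trans ?_
  rw [lintegral_Ioo_sub (fun η => ‖g η‖ₑ ^ (2 : ℝ))]
  simp only [ENNReal.rpow_ofNat]
  gcongr
  simpa only [ENNReal.rpow_ofNat] using lintegral_Ioo_sq_le g ξ

/-- The first multiplication: both factors are only square integrable. The weights are bounded by a
function of `ξ`, and Cauchy–Schwarz on `(0, ξ)` does the rest. -/
theorem lconv_weighted_le {s : ℝ} (hf : StronglyMeasurable f) (hg : StronglyMeasurable g) (ξ : ℝ) :
    lconv (fun η => jap (-s) η * f η) (fun η => jap (-s) η * g η) ξ ≤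
      ENNReal.ofReal (2 ^ (|s| + 1) * jap (-s + max (-s) 0) ξ) *
        (eLpNorm f 2 halfLine * eLpNorm g 2 halfLine) := by
  calc _ ≤ ∫⁻ η in Ioo 0 ξ, ENNReal.ofReal (2 ^ (|s| + 1) * jap (-s + max (-s) 0) ξ) *
        (‖f η‖ₑ * ‖g (ξ - η)‖ₑ) := by
        refine setLIntegral_mono' measurableSet_Ioo fun η hη => ?_
        rw [enorm_mul, enorm_mul, mul_mul_mul_comm]
        gcongr
        rw [← ofReal_norm, ← ofReal_norm, Complex.norm_real, Complex.norm_real,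
          Real.norm_of_nonneg (jap_pos _ _).le, Real.norm_of_nonneg (jap_pos _ _).le,
          ← ENNReal.ofReal_mul (jap_pos _ _).le]
        exact ENNReal.ofReal_le_ofReal (jap_mul_jap_le_of_pair hη)
    _ = ENNReal.ofReal (2 ^ (|s| + 1) * jap (-s + max (-s) 0) ξ) *
        ∫⁻ η in Ioo 0 ξ, ‖f η‖ₑ * ‖g (ξ - η)‖ₑ := lintegral_const_mul' _ _ ENNReal.ofReal_ne_top
    _ ≤ _ := by
        gcongr
        refine (lintegral_Ioo_mul_le hf.enorm hg ξ).trans ?_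
        gcongr
        simpa only [ENNReal.rpow_ofNat] using lintegral_Ioo_sq_le f ξ

/-- The later multiplications: one factor has a pointwise bound. Since `η < ξ`, the factor `⟨η⟩^γ`
is at most `⟨ξ⟩^γ`; splitting the two weights extracts `⟨ξ⟩^{-s}`. Cauchy–Schwarz of the remaining
weight against `g` contributes the square root of `∫_0^ξ ⟨η⟩^{-2s} dη`, of size `⟨ξ⟩^{1/2 - σ}`. -/
theorem lconv_le_of_bound {s σ γ A : ℝ} (hσ : 0 ≤ σ) (hσ' : σ < 1 / 2) (hs : σ ≤ s) (hγ : 0 ≤ γ)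
    (hA : 0 ≤ A) (hf : ∀ η, 0 < η → ‖f η‖ ≤ A * jap (-s + γ) η) (hg : StronglyMeasurable g) {ξ : ℝ}
    (hξ : 0 < ξ) :
    lconv f (fun η => jap (-s) η * g η) ξ ≤
      ENNReal.ofReal (2 ^ (s + 1) * (1 - 2 * σ)⁻¹ ^ (1 / 2 : ℝ) * A *
        jap (-s + (γ + (1 / 2 - σ))) ξ) * eLpNorm g 2 halfLine := by
  have hs0 : 0 ≤ s := hσ.trans hs
  set B : ENNReal := ENNReal.ofReal (A * 2 ^ s * jap (-s + γ) ξ) with hB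
  have hmj : Measurable fun η => ENNReal.ofReal (jap (-s) η) :=
    (continuous_jap _).measurable.ennreal_ofReal
  have hmj' : Measurable fun η => ENNReal.ofReal (jap (-s) (ξ - η)) :=
    hmj.comp (measurable_const.sub measurable_id)
  have hgm : Measurable fun η => ‖g (ξ - η)‖ₑ :=
    (hg.comp_measurable (measurable_const.sub measurable_id)).enorm
  have hW := lintegral_jap_le hσ hσ' hs hξ
  have hW' : ∫⁻ η in Ioo 0 ξ, ENNReal.ofReal (jap (-s) (ξ - η)) ^ 2 ≤
      ENNReal.ofReal ((1 - 2 * σ)⁻¹ * jap (1 - 2 * σ) ξ) := by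
    rw [lintegral_Ioo_sub (fun η => ENNReal.ofReal (jap (-s) η) ^ 2)]
    exact hW
  have hsq : ENNReal.ofReal ((1 - 2 * σ)⁻¹ * jap (1 - 2 * σ) ξ) ^ (1 / 2 : ℝ) =
      ENNReal.ofReal ((1 - 2 * σ)⁻¹ ^ (1 / 2 : ℝ) * jap (1 / 2 - σ) ξ) := by
    have h0 : 0 ≤ (1 - 2 * σ)⁻¹ := by rw [inv_nonneg]; linarith
    rw [ENNReal.ofReal_rpow_of_nonneg (mul_nonneg h0 (jap_pos _ _).le) (by norm_num),
      Real.mul_rpow h0 (jap_pos _ _).le]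
    congr 2
    rw [jap, jap, ← Real.rpow_mul (by positivity)]
    congr 1; ring
  calc _ ≤ ∫⁻ η in Ioo 0 ξ, B * (ENNReal.ofReal (jap (-s) η) * ‖g (ξ - η)‖ₑ +
        ENNReal.ofReal (jap (-s) (ξ - η)) * ‖g (ξ - η)‖ₑ) := by
        refine setLIntegral_mono' measurableSet_Ioo fun η hη => ?_
        rw [enorm_mul, ← add_mul, ← mul_assoc, ← mul_assoc]
        refine mul_le_mul' ?_ le_rfl
        rw [← ofReal_norm, ← ofReal_norm, Complex.norm_real, Real.norm_of_nonneg (jap_pos _ _).le,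
          ← ENNReal.ofReal_mul (norm_nonneg _), ← ENNReal.ofReal_add (jap_pos _ _).le
          (jap_pos _ _).le, hB, ← ENNReal.ofReal_mul (by have := jap_pos (-s + γ) ξ; positivity)]
        refine ENNReal.ofReal_le_ofReal ?_
        have e1 : jap γ η ≤ jap γ ξ := jap_le_jap_of_abs_le hγ
          (by rw [abs_of_pos hη.1, abs_of_pos hξ]; exact hη.2.le)
        have p := jap_pos γ ξ
        have q := (mul_pos (jap_pos (-s) η) (jap_pos (-s) (ξ - η))).le
        calc ‖f η‖ * jap (-s) (ξ - η) ≤ A * jap (-s + γ) η * jap (-s) (ξ - η) := by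
              have := jap_pos (-s) (ξ - η)
              gcongr
              exact hf η hη.1
          _ = A * jap γ η * (jap (-s) η * jap (-s) (ξ - η)) := by rw [jap_add]; ring
          _ ≤ A * jap γ ξ * (2 ^ s * jap (-s) ξ * (jap (-s) η + jap (-s) (ξ - η))) :=
              mul_le_mul (mul_le_mul_of_nonneg_left e1 hA) (jap_neg_mul_jap_neg_le hs0 hη) q
                (mul_nonneg hA p.le)
          _ = _ := by rw [jap_add]; ring
    _ = B * ((∫⁻ η in Ioo 0 ξ, ENNReal.ofReal (jap (-s) η) * ‖g (ξ - η)‖ₑ) +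
        ∫⁻ η in Ioo 0 ξ, ENNReal.ofReal (jap (-s) (ξ - η)) * ‖g (ξ - η)‖ₑ) := by
        rw [lintegral_const_mul' _ _ ENNReal.ofReal_ne_top, lintegral_add_left (by exact hmj.mul hgm)]
    _ ≤ B * (ENNReal.ofReal ((1 - 2 * σ)⁻¹ ^ (1 / 2 : ℝ) * jap (1 / 2 - σ) ξ) *
          eLpNorm g 2 halfLine + ENNReal.ofReal ((1 - 2 * σ)⁻¹ ^ (1 / 2 : ℝ) *
          jap (1 / 2 - σ) ξ) * eLpNorm g 2 halfLine) := by
        rw [← hsq]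
        gcongr
        · exact (lintegral_Ioo_mul_le hmj hg ξ).trans (by gcongr)
        · exact (lintegral_Ioo_mul_le hmj' hg ξ).trans (by gcongr)
    _ = _ := by
        rw [← two_mul, ← mul_assoc, ← mul_assoc, hB, ← ENNReal.ofReal_ofNat,
          ← ENNReal.ofReal_mul (by have := jap_pos (-s + γ) ξ; positivity),
          ← ENNReal.ofReal_mul (by have := jap_pos (-s + γ) ξ; positivity)]
        congr 2
        rw [← add_assoc, jap_add (-s + γ), Real.rpow_add_one (by norm_num)]
        ring

theorem integrableOn_of_lconv_le (hf : StronglyMeasurable f) (hg : StronglyMeasurable g) {ξ : ℝ}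
    (h : lconv f g ξ ≠ ⊤) : IntegrableOn (fun η => f η * g (ξ - η)) (Ioo 0 ξ) := by
  refine ⟨(hf.mul (hg.comp_measurable (measurable_const.sub measurable_id))).aestronglyMeasurable,
    ?_⟩
  simp only [HasFiniteIntegral, enorm_mul]
  exact h.lt_top

theorem enorm_halfConv_le (f g : ℝ → ℂ) (ξ : ℝ) : ‖halfConv f g ξ‖ₑ ≤ lconv f g ξ := by
  refine (enorm_integral_le_lintegral_enorm _).trans ?_
  simp only [enorm_mul]
  rfl

theorem stronglyMeasurable_halfConv (hf : StronglyMeasurable f) (hg : StronglyMeasurable g) :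
    StronglyMeasurable (halfConv f g) := by
  rw [funext (halfConv_eq f g)]
  have h1 : StronglyMeasurable fun z : ℝ × ℝ => (Ioi 0).indicator f z.2 :=
    (hf.indicator measurableSet_Ioi).comp_measurable measurable_snd
  have h2 : StronglyMeasurable fun z : ℝ × ℝ => (Ioi 0).indicator g (z.1 - z.2) :=
    (hg.indicator measurableSet_Ioi).comp_measurable (measurable_fst.sub measurable_snd)
  exact (h1.mul h2).integral_prod_right

theorem halfConv_sub_halfConv {f' g' : ℝ → ℂ} {ξ : ℝ}
    (h1 : IntegrableOn (fun η => f η * g (ξ - η)) (Ioo 0 ξ))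
    (h2 : IntegrableOn (fun η => f' η * g (ξ - η)) (Ioo 0 ξ))
    (h3 : IntegrableOn (fun η => f' η * g' (ξ - η)) (Ioo 0 ξ)) :
    halfConv f g ξ - halfConv f' g' ξ =
      halfConv (f - f') g ξ + halfConv f' (g - g') ξ := by
  have e1 : halfConv (f - f') g ξ = halfConv f g ξ - halfConv f' g ξ := by
    unfold halfConv
    rw [← integral_sub h1 h2]
    simp only [Pi.sub_apply, sub_mul]
  have e2 : halfConv f' (g - g') ξ = halfConv f' g ξ - halfConv f' g' ξ := by
    unfold halfConv
    rw [← integral_sub h2 h3]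
    simp only [Pi.sub_apply, mul_sub]
  rw [e1, e2]; ring

end Convolution

/-! ### The power nonlinearity in the Fourier picture -/

/-- The density `⟨ξ⟩^{-s} f`. -/
def weighted (s : ℝ) (f : ℝ → ℂ) (ξ : ℝ) : ℂ := jap (-s) ξ * f ξ

/-- The `(k + 1)`-st convolution power on the half-line. -/
def convPow (f : ℝ → ℂ) : ℕ → ℝ → ℂ
  | 0 => f
  | k + 1 => halfConv (convPow f k) f

theorem stronglyMeasurable_weighted (s : ℝ) {f : ℝ → ℂ} (hf : StronglyMeasurable f) :
    StronglyMeasurable (weighted s f) :=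
  (Complex.continuous_ofReal.comp (continuous_jap _)).stronglyMeasurable.mul hf

theorem weighted_sub (s : ℝ) (f g : ℝ → ℂ) : weighted s f - weighted s g = weighted s (f - g) := by
  ext ξ; simp [weighted, mul_sub]

theorem stronglyMeasurable_convPow {f : ℝ → ℂ} (hf : StronglyMeasurable f) (k : ℕ) :
    StronglyMeasurable (convPow f k) := by
  induction k with
  | zero => exact hf
  | succ k ih => exact stronglyMeasurable_halfConv ih hf

/-- The convolution powers number `k + 1` of `⟨ξ⟩^{-s} f`, `f ∈ L²(0, ∞)`, are bounded by
`⟨ξ⟩^{-s + γ}`, and depend on `f` in a Lipschitz continuous way. -/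
def ConvPowBound (s γ : ℝ) (k : ℕ) : Prop :=
  ∃ C, 0 ≤ C ∧ ∀ (R : ℝ) (f g : ℝ → ℂ), StronglyMeasurable f → StronglyMeasurable g →
    eLpNorm f 2 halfLine ≤ ENNReal.ofReal R → eLpNorm g 2 halfLine ≤ ENNReal.ofReal R →
    ∀ δ : ℝ, 0 ≤ R → 0 ≤ δ → eLpNorm (f - g) 2 halfLine ≤ ENNReal.ofReal δ → ∀ ξ, 0 < ξ →
      ‖convPow (weighted s f) k ξ‖ ≤ C * R ^ (k + 1) * jap (-s + γ) ξ ∧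
      ‖convPow (weighted s f) k ξ - convPow (weighted s g) k ξ‖ ≤
        C * R ^ k * δ * jap (-s + γ) ξ

theorem norm_halfConv_le_of_lconv_le {f g : ℝ → ℂ} {ξ B : ℝ} (hB : 0 ≤ B)
    (h : lconv f g ξ ≤ ENNReal.ofReal B) : ‖halfConv f g ξ‖ ≤ B := by
  have := (enorm_halfConv_le f g ξ).trans h
  rwa [← ofReal_norm, ENNReal.ofReal_le_ofReal_iff hB] at this

/-- The bounds begin with the square, because a function in `L²` has no pointwise bound itself. -/
theorem convPowBound_one (s : ℝ) : ConvPowBound s (max (-s) 0) 1 := by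
  -- The factor `2` counts the two terms `(f - g) ∗ f` and `g ∗ (f - g)` of the difference.
  refine ⟨2 * 2 ^ (|s| + 1), by positivity, fun R f g hf hg hfR hgR δ hR hδ hfg ξ hξ => ?_⟩
  set J := 2 ^ (|s| + 1) * jap (-s + max (-s) 0) ξ with hJ
  have hJ0 : 0 ≤ J := mul_nonneg (by positivity) (jap_pos _ _).le
  have key : ∀ {u v : ℝ → ℂ} {a b : ℝ}, StronglyMeasurable u → StronglyMeasurable v → 0 ≤ a →
      0 ≤ b → eLpNorm u 2 halfLine ≤ ENNReal.ofReal a → eLpNorm v 2 halfLine ≤ ENNReal.ofReal b →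
      lconv (weighted s u) (weighted s v) ξ ≤ ENNReal.ofReal (J * (a * b)) := by
    intro u v a b hu hv ha hb hua hvb
    refine (lconv_weighted_le hu hv ξ).trans ?_
    rw [ENNReal.ofReal_mul hJ0, ENNReal.ofReal_mul ha]
    gcongr
  have hint : ∀ {u v : ℝ → ℂ} {a b : ℝ}, StronglyMeasurable u → StronglyMeasurable v → 0 ≤ a →
      0 ≤ b → eLpNorm u 2 halfLine ≤ ENNReal.ofReal a → eLpNorm v 2 halfLine ≤ ENNReal.ofReal b →
      IntegrableOn (fun η => weighted s u η * weighted s v (ξ - η)) (Ioo 0 ξ) :=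
    fun hu hv ha hb hua hvb => integrableOn_of_lconv_le (stronglyMeasurable_weighted s hu)
      (stronglyMeasurable_weighted s hv) ((key hu hv ha hb hua hvb).trans_lt ENNReal.ofReal_lt_top).ne
  constructor
  · refine (norm_halfConv_le_of_lconv_le (by positivity) (key hf hf hR hR hfR hfR)).trans ?_
    have : 0 ≤ J * (R * R) := by positivity
    calc J * (R * R) ≤ 2 * (J * (R * R)) := by linarith
      _ = _ := by rw [hJ]; ring
  · change ‖halfConv (weighted s f) (weighted s f) ξ - halfConv (weighted s g) (weighted s g) ξ‖ ≤ _
    rw [halfConv_sub_halfConv (hint hf hf hR hR hfR hfR) (hint hg hf hR hR hgR hfR)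
      (hint hg hg hR hR hgR hgR), weighted_sub]
    refine (norm_add_le _ _).trans ((add_le_add
      (norm_halfConv_le_of_lconv_le (by positivity) (key (hf.sub hg) hf hδ hR hfg hfR))
      (norm_halfConv_le_of_lconv_le (by positivity) (key hg (hf.sub hg) hR hδ hgR hfg))).trans ?_)
    rw [hJ]
    exact le_of_eq (by ring)

/-- Apply `lconv_le_of_bound` with the previous power as the pointwise bounded factor. In the
difference, either the previous powers differ, which is the inductive Lipschitz bound, or the last
factors do, which is the bound `δ` in `L²`. -/
theorem ConvPowBound.succ {s σ γ : ℝ} {k : ℕ} (hσ : 0 ≤ σ) (hσ' : σ < 1 / 2) (hs : σ ≤ s)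
    (hγ : 0 ≤ γ) (h : ConvPowBound s γ k) : ConvPowBound s (γ + (1 / 2 - σ)) (k + 1) := by
  obtain ⟨C, hC, h⟩ := h
  set D := 2 ^ (s + 1) * (1 - 2 * σ)⁻¹ ^ (1 / 2 : ℝ) with hD
  have hD0 : 0 ≤ D := by
    have : 0 ≤ (1 - 2 * σ)⁻¹ := by rw [inv_nonneg]; linarith
    positivity
  refine ⟨2 * (D * C), by positivity, fun R f g hf hg hfR hgR δ hR hδ hfg ξ hξ => ?_⟩
  set J := jap (-s + (γ + (1 / 2 - σ))) ξ with hJ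
  have hJ0 : 0 ≤ J := (jap_pos _ _).le
  have hgf : eLpNorm (g - f) 2 halfLine ≤ ENNReal.ofReal δ := by rwa [eLpNorm_sub_comm]
  have b1 := fun η hη => (h R f g hf hg hfR hgR δ hR hδ hfg η hη).1
  have b2 := fun η hη => (h R g f hg hf hgR hfR δ hR hδ hgf η hη).1
  have b3 := fun η hη => (h R f g hf hg hfR hgR δ hR hδ hfg η hη).2
  have key : ∀ {u v : ℝ → ℂ} {A b : ℝ}, StronglyMeasurable v → 0 ≤ A → 0 ≤ b →
      (∀ η, 0 < η → ‖u η‖ ≤ A * jap (-s + γ) η) → eLpNorm v 2 halfLine ≤ ENNReal.ofReal b →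
      lconv u (weighted s v) ξ ≤ ENNReal.ofReal (D * A * J * b) := by
    intro u v A b hv hA hb hu hvb
    refine (lconv_le_of_bound hσ hσ' hs hγ hA hu hv hξ).trans ?_
    rw [ENNReal.ofReal_mul (p := D * A * J) (by positivity)]
    gcongr
  have hint : ∀ {u v : ℝ → ℂ} {A b : ℝ}, StronglyMeasurable u → StronglyMeasurable v → 0 ≤ A →
      0 ≤ b → (∀ η, 0 < η → ‖u η‖ ≤ A * jap (-s + γ) η) → eLpNorm v 2 halfLine ≤ ENNReal.ofReal b →
      IntegrableOn (fun η => u η * weighted s v (ξ - η)) (Ioo 0 ξ) :=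
    fun hu hv hA hb hua hvb => integrableOn_of_lconv_le hu (stronglyMeasurable_weighted s hv)
      ((key hv hA hb hua hvb).trans_lt ENNReal.ofReal_lt_top).ne
  have m1 := stronglyMeasurable_convPow (stronglyMeasurable_weighted s hf) k
  have m2 := stronglyMeasurable_convPow (stronglyMeasurable_weighted s hg) k
  have hA : 0 ≤ C * R ^ (k + 1) := by positivity
  have hA' : 0 ≤ C * R ^ k * δ := by positivity
  constructor
  · refine (norm_halfConv_le_of_lconv_le (by positivity) (key hf hA hR b1 hfR)).trans ?_
    have : 0 ≤ D * (C * R ^ (k + 1)) * J * R := by positivity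
    calc D * (C * R ^ (k + 1)) * J * R ≤ 2 * (D * (C * R ^ (k + 1)) * J * R) := by linarith
      _ = _ := by ring
  · change ‖halfConv _ (weighted s f) ξ - halfConv _ (weighted s g) ξ‖ ≤ _
    rw [halfConv_sub_halfConv (hint m1 hf hA hR b1 hfR) (hint m2 hf hA hR b2 hfR)
      (hint m2 hg hA hR b2 hgR), weighted_sub]
    refine (norm_add_le _ _).trans ((add_le_add
      (norm_halfConv_le_of_lconv_le (by positivity) (key hf hA' hR b3 hfR))
      (norm_halfConv_le_of_lconv_le (by positivity) (key (hf.sub hg) hA hδ b2 hfg))).trans ?_)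
    exact le_of_eq (by ring)

theorem convPowBound_add_one {s σ : ℝ} (hσ : 0 ≤ σ) (hσ' : σ < 1 / 2) (hs : σ ≤ s) (k : ℕ) :
    ConvPowBound s (k * (1 / 2 - σ)) (k + 1) := by
  induction k with
  | zero =>
    simpa [max_eq_right (by linarith : -s ≤ 0)] using convPowBound_one s
  | succ k ih =>
    have := ih.succ hσ hσ' hs (mul_nonneg k.cast_nonneg (by linarith))
    convert this using 1
    push_cast; ring

theorem exists_convPowBound {s : ℝ} {k : ℕ} (hk : 1 ≤ k) (h : k = 1 ∨ 0 < s) :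
    ∃ γ, ConvPowBound s γ k := by
  rcases h with rfl | h
  · exact ⟨_, convPowBound_one s⟩
  · obtain ⟨k, rfl⟩ := Nat.exists_eq_add_of_le' hk
    -- Any `σ` in `(0, 1/2)` with `σ ≤ s` will do: the intermediate powers need some polynomial
    -- bound, not a sharp one.
    refine ⟨_, convPowBound_add_one (σ := min s (1 / 4)) (by positivity) ?_ (min_le_left _ _) k⟩
    exact (min_le_right _ _).trans_lt (by norm_num)

/-- This is where the threshold for `s` arises. For `p = 2`, `max(-s, 0) < 1/2` means `s > -1/2`.
For `p ≥ 3`, `(p - 2)(1/2 - σ) < 1/2` means `σ > 1/2 - 1/(2p - 4)`. This threshold is nonnegative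
and lies below both `s` and `1/2`, so there is room for `σ`. -/
theorem exists_convPowBound_lt {p : ℕ} {s : ℝ}
    (hps : (p = 2 ∧ -(1 / 2 : ℝ) < s) ∨ (3 ≤ p ∧ (1 / 2 : ℝ) - 1 / (2 * (p : ℝ) - 4) < s)) :
    ∃ γ < 1 / 2, ConvPowBound s γ (p - 1) := by
  rcases hps with ⟨rfl, hs⟩ | ⟨hp, hs⟩
  · exact ⟨max (-s) 0, max_lt (by linarith) (by norm_num), convPowBound_one s⟩
  · obtain ⟨k, rfl⟩ := Nat.exists_eq_add_of_le' hp
    push_cast at hs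
    have hk : (0 : ℝ) < 2 * k + 2 := by positivity
    have e : 2 * ((k : ℝ) + 3) - 4 = 2 * k + 2 := by ring
    rw [e] at hs
    have h1 : 1 / (2 * (k : ℝ) + 2) ≤ 1 / 2 := by
      apply one_div_le_one_div_of_le (by norm_num); linarith [k.cast_nonneg (α := ℝ)]
    have h2 : 0 < 1 / (2 * (k : ℝ) + 2) := by positivity
    obtain ⟨σ, h3, h4⟩ := exists_between (lt_min hs (by linarith : 1 / 2 - 1 / (2 * (k : ℝ) + 2) < 1 / 2))
    have h5 := h4.trans_le (min_le_left _ _)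
    have h6 := h4.trans_le (min_le_right _ _)
    refine ⟨((k + 1 : ℕ) : ℝ) * (1 / 2 - σ), ?_, convPowBound_add_one (by linarith) h6 h5.le (k + 1)⟩
    have h7 : 1 / 2 - σ < 1 / (2 * (k : ℝ) + 2) := by linarith
    rw [lt_div_iff₀ hk] at h7
    push_cast
    linarith

/-! ### Identification of the Fourier powers with convolution powers -/

theorem polyIntegrable_of_bound {f : ℝ → ℂ} (hf : StronglyMeasurable f) {C r : ℝ}
    (h : ∀ ξ, 0 < ξ → ‖f ξ‖ ≤ C * jap r ξ) : PolyIntegrable f := by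
  -- Against `⟨ξ⟩^r` this weight leaves at most `⟨ξ⟩^{-2}`, which is integrable.
  refine ⟨|r| + 2, by positivity, ?_⟩
  have hm : AEStronglyMeasurable (fun ξ => (jap (-(|r| + 2)) ξ : ℂ) * f ξ) halfLine :=
    ((Complex.continuous_ofReal.comp (continuous_jap _)).stronglyMeasurable.mul
      hf).aestronglyMeasurable
  have hi : Integrable (fun ξ => C * jap (-2) ξ) halfLine := by
    have := integrable_rpow_neg_one_add_norm_sq (E := ℝ) (μ := volume) (r := 2)
      (by rw [Module.finrank_self]; norm_num)
    exact (this.const_mul C).restrict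
  refine hi.mono' hm ?_
  filter_upwards [self_mem_ae_restrict measurableSet_Ioi] with ξ hξ
  have h0 := h ξ hξ
  have hC : 0 ≤ C := by
    by_contra hC
    exact absurd ((norm_nonneg _).trans h0) (not_le.2 (mul_neg_of_neg_of_pos (not_le.1 hC) (jap_pos _ _)))
  rw [norm_mul, Complex.norm_real, Real.norm_of_nonneg (jap_pos _ _).le]
  calc _ ≤ jap (-(|r| + 2)) ξ * (C * jap r ξ) := by
        have := jap_pos (-(|r| + 2)) ξ
        gcongr
    _ = C * jap (-(|r| + 2) + r) ξ := by rw [jap_add]; ring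
    _ ≤ _ := by
        refine mul_le_mul_of_nonneg_left (jap_mono ?_ ξ) hC
        linarith [le_abs_self r]

theorem polyIntegrable_weighted (s : ℝ) (f : HalfL2) : PolyIntegrable (weighted s f) := by
  -- The `|s|` absorbs `⟨ξ⟩^{-s}` for either sign of `s`; what is left, `⟨ξ⟩^{-1}`, is square
  -- integrable and can be paired with `f`.
  refine ⟨|s| + 1, by positivity, ?_⟩
  have hm : AEStronglyMeasurable (fun ξ => (jap (-(|s| + 1)) ξ : ℂ) * weighted s f ξ) halfLine :=
    ((Complex.continuous_ofReal.comp (continuous_jap _)).stronglyMeasurable.mul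
      (stronglyMeasurable_weighted s (Lp.stronglyMeasurable f))).aestronglyMeasurable
  have hi : Integrable (fun ξ => (jap (-1) ξ : ℂ) * f ξ) halfLine :=
    (memLp_jap (by norm_num)).integrable_mul (Lp.memLp f)
  refine hi.norm.mono' hm (.of_forall fun ξ => ?_)
  rw [weighted, norm_mul, norm_mul, norm_mul, Complex.norm_real, Complex.norm_real,
    Complex.norm_real, Real.norm_of_nonneg (jap_pos _ _).le, Real.norm_of_nonneg (jap_pos _ _).le,
    Real.norm_of_nonneg (jap_pos _ _).le, ← mul_assoc, ← jap_add]
  refine mul_le_mul_of_nonneg_right (jap_mono ?_ ξ) (norm_nonneg _)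
  linarith [neg_abs_le s]

theorem PolyIntegrable.exists_hasDensity {f : ℝ → ℂ} (hf : PolyIntegrable f) :
    ∃ S : 𝓢'(ℝ, ℂ), HasDensity S f := by
  obtain ⟨k, -, hi⟩ := hf
  have hi' := memLp_one_iff_integrable.2 hi
  refine ⟨TemperedDistribution.smulLeftCLM ℂ (fun ξ => (jap k ξ : ℂ))
    (Lp.toTemperedDistribution (hi'.toLp _)), fun ψ => ?_⟩
  rw [TemperedDistribution.smulLeftCLM_apply_apply, Lp.toTemperedDistribution_apply]
  refine integral_congr_ae ?_
  filter_upwards [hi'.coeFn_toLp] with ξ hξ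
  rw [hξ, SchwartzMap.smulLeftCLM_apply_apply (jap_hasTemperateGrowth _), smul_eq_mul, smul_eq_mul]
  have : (jap (-k) ξ : ℂ) * jap k ξ = 1 := by rw [← Complex.ofReal_mul, jap_neg_mul]; simp
  linear_combination f ξ * ψ ξ * this

theorem eLpNorm_coe_le_ofReal {f : HalfL2} {R : ℝ} (h : ‖f‖ ≤ R) :
    eLpNorm f 2 halfLine ≤ ENNReal.ofReal R := by
  rw [← Lp.enorm_def, ← ofReal_norm]
  exact ENNReal.ofReal_le_ofReal h

theorem eLpNorm_coe_sub_le_ofReal {f g : HalfL2} {R : ℝ} (h : ‖f - g‖ ≤ R) :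
    eLpNorm ((f : ℝ → ℂ) - (g : ℝ → ℂ)) 2 halfLine ≤ ENNReal.ofReal R := by
  rw [← eLpNorm_congr_ae (Lp.coeFn_sub f g)]
  exact eLpNorm_coe_le_ofReal h

theorem polyIntegrable_convPow {s : ℝ} {k : ℕ} (h : k ≤ 1 ∨ 0 < s) (f : HalfL2) :
    PolyIntegrable (convPow (weighted s f) k) := by
  rcases Nat.eq_zero_or_pos k with rfl | hk
  · exact polyIntegrable_weighted s f
  · obtain ⟨γ, C, -, hC⟩ := exists_convPowBound hk (h.imp_left (le_antisymm · hk))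
    have hf := Lp.stronglyMeasurable f
    exact polyIntegrable_of_bound
      (stronglyMeasurable_convPow (stronglyMeasurable_weighted s hf) k) fun ξ hξ =>
      (hC ‖f‖ f f hf hf (eLpNorm_coe_le_ofReal le_rfl) (eLpNorm_coe_le_ofReal le_rfl) 0
        (norm_nonneg _) le_rfl (by simp) ξ hξ).1

theorem HasDensity.unique {S T : 𝓢'(ℝ, ℂ)} {f : ℝ → ℂ} (hS : HasDensity S f)
    (hT : HasDensity T f) : S = T := by
  ext ψ; rw [hS, hT]

theorem hasDensity_fromL2 (s : ℝ) (f : HalfL2) :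
    HasDensity (𝓕 (HGamma.toDist (fromL2 s f))) (weighted s f) :=
  fourier_toDist_fromL2_apply s f

/-- The recursions for Fourier powers and for `convPow` agree as long as every intermediate power
has a polynomially integrable density. Up to the square this holds for all `s`; for higher powers
the available bounds require `s > 0`. -/
theorem isFourierPower_of_hasDensity {s : ℝ} (f : HalfL2) {k : ℕ} (h : k ≤ 1 ∨ 0 < s)
    {w : 𝓢'(ℝ, ℂ)} (hw : HasDensity (𝓕 w) (convPow (weighted s f) k)) :
    IsFourierPower (HGamma.toDist (fromL2 s f)) (k + 1) w := by
  induction k generalizing w with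
  | zero =>
    have := hw.unique (hasDensity_fromL2 s f)
    have := congrArg (fun S : 𝓢'(ℝ, ℂ) => 𝓕⁻ S) this
    simpa [IsFourierPower] using this
  | succ k ih =>
    have h' : k ≤ 1 ∨ 0 < s := h.imp_left fun h => by omega
    obtain ⟨v, hv⟩ := (polyIntegrable_convPow h' f).exists_hasDensity
    have hv' : HasDensity (𝓕 (𝓕⁻ v)) (convPow (weighted s f) k) := by
      rwa [FourierTransform.fourier_fourierInv_eq]
    exact ⟨𝓕⁻ v, ih h' hv', isSConvolution_of_hasDensity (polyIntegrable_convPow h' f)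
      (polyIntegrable_weighted s f) hv' (hasDensity_fromL2 s f) hw⟩

/-- Identifies the power that occurs in an arbitrary solution with the one constructed by
convolution. -/
theorem IsFourierPower.unique {u w w' : 𝓢'(ℝ, ℂ)} {k : ℕ} (h : IsFourierPower u (k + 1) w)
    (h' : IsFourierPower u (k + 1) w') : w = w' := by
  induction k generalizing w w' with
  | zero => exact Eq.trans h (Eq.symm h')
  | succ k ih =>
    obtain ⟨v, hv, hw⟩ := h
    obtain ⟨v', hv', hw'⟩ := h'
    obtain rfl := ih hv hv'
    have := congrArg (fun S : 𝓢'(ℝ, ℂ) => 𝓕⁻ S) (IsSConvolution.unique hw hw')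
    simpa using this

/-- The map `u ↦ u^p`, from `H^s_Γ(ℝ)` to `H^{s-1}_Γ(ℝ)`, in the Fourier picture. -/
theorem exists_power_map {p : ℕ} {s : ℝ}
    (hps : (p = 2 ∧ -(1 / 2 : ℝ) < s) ∨ (3 ≤ p ∧ (1 / 2 : ℝ) - 1 / (2 * (p : ℝ) - 4) < s)) :
    ∃ M : HalfL2 → HalfL2,
      (∀ R : ℝ, ∃ K : NNReal, LipschitzOnWith K M (Metric.closedBall 0 R)) ∧
      ∀ f, IsFourierPower (HGamma.toDist (fromL2 s f)) p (HGamma.toDist (fromL2 (s - 1) (M f))) := by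
  obtain ⟨γ, hγ, C, hC, h⟩ := exists_convPowBound_lt hps
  -- The function `⟨ξ⟩^{s-1} ⟨ξ⟩^{-s+γ} = ⟨ξ⟩^{-1+γ}` is square integrable because `γ < 1/2`; it
  -- dominates the weighted power and the differences of two such powers.
  have hJ := memLp_jap (r := -1 + γ) (by linarith)
  have hpk : p = p - 1 + 1 := by rcases hps with h | h <;> omega
  have hmeas : ∀ f : HalfL2, StronglyMeasurable fun ξ =>
      (jap (s - 1) ξ : ℂ) * convPow (weighted s f) (p - 1) ξ := fun f =>
    (Complex.continuous_ofReal.comp (continuous_jap _)).stronglyMeasurable.mul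
      (stronglyMeasurable_convPow (stronglyMeasurable_weighted s (Lp.stronglyMeasurable f)) _)
  have hjap : ∀ (ξ a : ℝ), jap (s - 1) ξ * (a * jap (-s + γ) ξ) = a * jap (-1 + γ) ξ := by
    intro ξ a
    rw [mul_left_comm, ← jap_add]; congr 2; ring
  have hmem : ∀ f : HalfL2, MemLp (fun ξ =>
      (jap (s - 1) ξ : ℂ) * convPow (weighted s f) (p - 1) ξ) 2 halfLine := by
    intro f
    refine (hJ.const_mul ((C * ‖f‖ ^ (p - 1 + 1) : ℝ) : ℂ)).mono (hmeas f).aestronglyMeasurable ?_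
    filter_upwards [self_mem_ae_restrict measurableSet_Ioi] with ξ hξ
    have hf := Lp.stronglyMeasurable f
    have := (h ‖f‖ f f hf hf (eLpNorm_coe_le_ofReal le_rfl) (eLpNorm_coe_le_ofReal le_rfl) 0
        (norm_nonneg _) le_rfl (by simp) ξ hξ).1
    rw [norm_mul, norm_mul, Complex.norm_real, Complex.norm_real, Complex.norm_real,
      Real.norm_of_nonneg (jap_pos _ _).le, Real.norm_of_nonneg (jap_pos _ _).le,
      Real.norm_of_nonneg (by positivity), ← hjap]
    have := jap_pos (s - 1) ξ
    gcongr
  refine ⟨fun f => (hmem f).toLp _, fun R => ?_, fun f => ?_⟩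
  · refine ⟨⟨C * |R| ^ (p - 1) * ‖hJ.toLp _‖, by positivity⟩, LipschitzOnWith.of_dist_le_mul
      fun f hf g hg => ?_⟩
    rw [mem_closedBall_zero_iff] at hf hg
    rw [dist_eq_norm, dist_eq_norm]
    change _ ≤ C * |R| ^ (p - 1) * ‖hJ.toLp _‖ * ‖f - g‖
    rw [mul_right_comm]
    refine Lp.norm_le_mul_norm_of_ae_le_mul ?_
    filter_upwards [self_mem_ae_restrict measurableSet_Ioi, Lp.coeFn_sub ((hmem f).toLp _)
      ((hmem g).toLp _), (hmem f).coeFn_toLp, (hmem g).coeFn_toLp, hJ.coeFn_toLp]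
      with ξ hξ h1 h2 h3 h4
    have := (h |R| f g (Lp.stronglyMeasurable f) (Lp.stronglyMeasurable g)
      (eLpNorm_coe_le_ofReal (hf.trans (le_abs_self R)))
      (eLpNorm_coe_le_ofReal (hg.trans (le_abs_self R))) ‖f - g‖
        (abs_nonneg _) (norm_nonneg _) (eLpNorm_coe_sub_le_ofReal le_rfl) ξ hξ).2
    rw [h1, Pi.sub_apply, h2, h3, h4, ← mul_sub, norm_mul, Complex.norm_real, Complex.norm_real,
      Real.norm_of_nonneg (jap_pos _ _).le, Real.norm_of_nonneg (jap_pos _ _).le, ← hjap]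
    have := jap_pos (s - 1) ξ
    gcongr
  -- The exponent is a variable here so that `p` can be replaced by `p - 1 + 1` in a recursive
  -- predicate only where it is the exponent.
  · have main : ∀ q, q = p - 1 + 1 → ∀ w, HasDensity (𝓕 w) (convPow (weighted s f) (p - 1)) →
        (p - 1 ≤ 1 ∨ 0 < s) → IsFourierPower (HGamma.toDist (fromL2 s f)) q w := by
      rintro _ rfl w hw h
      exact isFourierPower_of_hasDensity f h hw
    refine main p hpk _ (fun ψ => ?_) ?_
    swap
    · rcases hps with h | ⟨h, h'⟩
      · left; omega
      · right
        have h3 : (3 : ℝ) ≤ p := by exact_mod_cast h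
        have : 1 / (2 * (p : ℝ) - 4) ≤ 1 / 2 := by
          apply one_div_le_one_div_of_le (by norm_num); linarith
        linarith
    · rw [fourier_toDist_fromL2_apply]
      refine integral_congr_ae ?_
      filter_upwards [(hmem f).coeFn_toLp] with ξ h1
      rw [h1]
      have : (jap (-(s - 1)) ξ : ℂ) * jap (s - 1) ξ = 1 := by
        rw [← Complex.ofReal_mul, jap_neg_mul]; simp
      linear_combination convPow (weighted s f) (p - 1) ξ * ψ ξ * this

/-! ### Multiplication operators on `L²(0, ∞)` and the propagators of the wave equation -/

open scoped BoundedContinuousFunction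

theorem memLp_top_bcf (m : ℝ →ᵇ ℂ) : MemLp m ⊤ halfLine :=
  memLp_top_of_bound m.continuous.aestronglyMeasurable ‖m‖ (.of_forall m.norm_coe_le_norm)

/-- Multiplication by a bounded continuous function. -/
def mulOp (m : ℝ →ᵇ ℂ) : HalfL2 →L[ℂ] HalfL2 :=
  (ContinuousLinearMap.mul ℂ ℂ).holderL halfLine ⊤ 2 2 ((memLp_top_bcf m).toLp m)

theorem coeFn_mulOp (m : ℝ →ᵇ ℂ) (f : HalfL2) : mulOp m f =ᵐ[halfLine] fun ξ => m ξ * f ξ := by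
  have h := (ContinuousLinearMap.mul ℂ ℂ).coeFn_holder (r := 2) ((memLp_top_bcf m).toLp m) f
  filter_upwards [h, (memLp_top_bcf m).coeFn_toLp] with ξ h1 h2
  rw [← h2]
  exact h1

theorem mulOp_congr {m n : ℝ →ᵇ ℂ} (h : ∀ ξ, 0 < ξ → m ξ = n ξ) : mulOp m = mulOp n := by
  ext1 f
  refine Lp.ext ?_
  filter_upwards [coeFn_mulOp m f, coeFn_mulOp n f, self_mem_ae_restrict measurableSet_Ioi]
    with ξ h1 h2 hξ
  rw [h1, h2, h ξ hξ]

theorem mulOp_mul (m n : ℝ →ᵇ ℂ) (f : HalfL2) : mulOp (m * n) f = mulOp m (mulOp n f) := by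
  refine Lp.ext ?_
  filter_upwards [coeFn_mulOp (m * n) f, coeFn_mulOp m (mulOp n f), coeFn_mulOp n f] with ξ h1 h2 h3
  rw [h1, h2, h3, BoundedContinuousFunction.mul_apply, mul_assoc]

theorem mulOp_comm (m n : ℝ →ᵇ ℂ) (f : HalfL2) : mulOp m (mulOp n f) = mulOp n (mulOp m f) := by
  rw [← mulOp_mul, mul_comm, mulOp_mul]

theorem mulOp_add (m n : ℝ →ᵇ ℂ) (f : HalfL2) : mulOp (m + n) f = mulOp m f + mulOp n f := by
  refine Lp.ext ?_
  filter_upwards [coeFn_mulOp (m + n) f, coeFn_mulOp m f, coeFn_mulOp n f,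
    Lp.coeFn_add (mulOp m f) (mulOp n f)] with ξ h1 h2 h3 h4
  rw [h1, h4, Pi.add_apply, h2, h3, BoundedContinuousFunction.add_apply, add_mul]

theorem mulOp_smul (c : ℂ) (m : ℝ →ᵇ ℂ) (f : HalfL2) : mulOp (c • m) f = c • mulOp m f := by
  refine Lp.ext ?_
  filter_upwards [coeFn_mulOp (c • m) f, coeFn_mulOp m f, Lp.coeFn_smul c (mulOp m f)]
    with ξ h1 h2 h4
  rw [h1, h4, Pi.smul_apply, h2, BoundedContinuousFunction.smul_apply, smul_mul_assoc]

theorem mulOp_one (f : HalfL2) : mulOp 1 f = f := by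
  refine Lp.ext ?_
  filter_upwards [coeFn_mulOp 1 f] with ξ h1
  simp [h1]

theorem mulOp_neg (m : ℝ →ᵇ ℂ) (f : HalfL2) : mulOp (-m) f = -mulOp m f := by
  rw [← neg_one_smul ℂ m, mulOp_smul, neg_one_smul]

theorem mulOp_sub (m n : ℝ →ᵇ ℂ) (f : HalfL2) : mulOp (m - n) f = mulOp m f - mulOp n f := by
  rw [sub_eq_add_neg, mulOp_add, mulOp_neg, ← sub_eq_add_neg]

theorem norm_mulOp_apply_le {m : ℝ →ᵇ ℂ} {C : ℝ} (h : ∀ ξ, 0 < ξ → ‖m ξ‖ ≤ C) (f : HalfL2) :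
    ‖mulOp m f‖ ≤ C * ‖f‖ := by
  refine Lp.norm_le_mul_norm_of_ae_le_mul ?_
  filter_upwards [coeFn_mulOp m f, self_mem_ae_restrict measurableSet_Ioi] with ξ h1 hξ
  rw [h1, norm_mul]
  gcongr
  exact h ξ hξ

/-- Dominated convergence, with `((C + ‖m₀‖) |f|)²` as the dominating function. Pointwise
convergence of uniformly bounded symbols gives strong convergence of the operators. -/
theorem tendsto_mulOp {ι : Type*} {l : Filter ι} [l.IsCountablyGenerated] {m : ι → ℝ →ᵇ ℂ}
    {m₀ : ℝ →ᵇ ℂ} {C : ℝ} (hC : ∀ᶠ i in l, ∀ ξ, 0 < ξ → ‖m i ξ‖ ≤ C)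
    (h : ∀ ξ, 0 < ξ → Tendsto (fun i => m i ξ) l (𝓝 (m₀ ξ))) (f : HalfL2) :
    Tendsto (fun i => mulOp (m i) f) l (𝓝 (mulOp m₀ f)) := by
  rw [Lp.tendsto_Lp_iff_tendsto_eLpNorm']
  have e : ∀ i, eLpNorm (⇑(mulOp (m i) f) - ⇑(mulOp m₀ f)) 2 halfLine =
      (∫⁻ ξ in Ioi (0 : ℝ), ‖(m i ξ - m₀ ξ) * f ξ‖ₑ ^ (2 : ℝ)) ^ (1 / 2 : ℝ) := by
    intro i
    rw [eLpNorm_eq_lintegral_rpow_enorm_toReal (by norm_num) (by norm_num)]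
    simp only [ENNReal.toReal_ofNat]
    congr 1
    refine lintegral_congr_ae ?_
    filter_upwards [coeFn_mulOp (m i) f, coeFn_mulOp m₀ f] with ξ h1 h2
    rw [Pi.sub_apply, h1, h2, sub_mul]
  simp only [e]
  have h0 : (0 : ENNReal) = (∫⁻ ξ in Ioi (0 : ℝ), 0) ^ (1 / 2 : ℝ) := by simp
  rw [h0]
  refine (ENNReal.continuous_rpow_const.tendsto _).comp ?_
  have hmf : Measurable (f : ℝ → ℂ) := (Lp.stronglyMeasurable f).measurable
  refine tendsto_lintegral_filter_of_dominated_convergence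
    (fun ξ => (ENNReal.ofReal (C + ‖m₀‖) * ‖f ξ‖ₑ) ^ (2 : ℝ)) (.of_forall fun i => ?_) ?_ ?_ ?_
  · exact ((((m i).continuous.measurable.sub m₀.continuous.measurable).mul hmf).enorm).pow_const _
  · filter_upwards [hC] with i hi
    filter_upwards [self_mem_ae_restrict measurableSet_Ioi] with ξ hξ
    rw [enorm_mul]
    gcongr
    rw [← ofReal_norm]
    exact ENNReal.ofReal_le_ofReal ((norm_sub_le _ _).trans
      (add_le_add (hi ξ hξ) (m₀.norm_coe_le_norm ξ)))
  · simp_rw [ENNReal.mul_rpow_of_nonneg _ _ (zero_le_two : (0 : ℝ) ≤ 2)]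
    rw [lintegral_const_mul' _ _ (by simp)]
    refine ENNReal.mul_ne_top (by simp) ?_
    have := (Lp.memLp f).2
    rw [eLpNorm_lt_top_iff_lintegral_rpow_enorm_lt_top (by norm_num) (by norm_num)] at this
    simpa using this.ne
  · filter_upwards [self_mem_ae_restrict measurableSet_Ioi] with ξ hξ
    have h1 : Tendsto (fun i => (m i ξ - m₀ ξ) * f ξ) l (𝓝 0) := by
      simpa using ((h ξ hξ).sub_const (m₀ ξ)).mul_const (f ξ)
    have h2 := (ENNReal.continuous_rpow_const (y := 2)).tendsto _ |>.comp
      ((continuous_enorm.tendsto _).comp h1)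
    simpa [Function.comp_def] using h2

/-- By the mean value inequality the difference quotients of the symbols are bounded by `C`, so
their pointwise convergence passes to the operators. -/
theorem hasDerivAt_mulOp {κ δ : ℝ → ℝ →ᵇ ℂ} {C : ℝ}
    (h : ∀ ξ, 0 < ξ → ∀ t, HasDerivAt (fun τ => κ τ ξ) (δ t ξ) t)
    (hδ : ∀ t ξ, 0 < ξ → ‖δ t ξ‖ ≤ C) (f : HalfL2) (t : ℝ) :
    HasDerivAt (fun τ => mulOp (κ τ) f) (mulOp (δ t) f) t := by
  rw [hasDerivAt_iff_tendsto_slope]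
  have e : ∀ τ, slope (fun τ => mulOp (κ τ) f) t τ =
      mulOp (((τ - t)⁻¹ : ℂ) • (κ τ - κ t)) f := by
    intro τ
    rw [mulOp_smul, mulOp_sub, slope_def_module, ← Complex.ofReal_sub, ← Complex.ofReal_inv,
      Complex.coe_smul]
    rfl
  simp only [funext e]
  refine tendsto_mulOp (C := C) (.of_forall fun τ ξ hξ => ?_) (fun ξ hξ => ?_) f
  · have := Convex.norm_image_sub_le_of_norm_hasDerivWithin_le
      (fun τ _ => (h ξ hξ τ).hasDerivWithinAt) (fun τ _ => hδ τ ξ hξ) convex_univ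
      (mem_univ t) (mem_univ τ)
    rw [BoundedContinuousFunction.smul_apply, BoundedContinuousFunction.sub_apply, norm_smul,
      norm_inv, ← Complex.ofReal_sub, Complex.norm_real]
    rcases eq_or_ne τ t with rfl | hne
    · simpa using (norm_nonneg _).trans (hδ τ ξ hξ)
    · rw [inv_mul_le_iff₀ (norm_pos_iff.2 (sub_ne_zero.2 hne)), mul_comm]
      exact this
  · have := hasDerivAt_iff_tendsto_slope.1 (h ξ hξ t)
    refine this.congr fun τ => ?_
    rw [slope_def_module, BoundedContinuousFunction.smul_apply,
      BoundedContinuousFunction.sub_apply, ← Complex.ofReal_sub, ← Complex.ofReal_inv,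
      Complex.coe_smul]

/-- A product rule for a strongly differentiable, Lipschitz continuous family of operators. -/
theorem hasDerivWithinAt_clm_apply_of_lipschitz {E F : Type*} [NormedAddCommGroup E]
    [NormedSpace ℂ E] [NormedAddCommGroup F] [NormedSpace ℂ F] {T : ℝ → E →L[ℂ] F} {C : ℝ}
    (hT : ∀ t τ x, ‖T τ x - T t x‖ ≤ C * |τ - t| * ‖x‖) {a : ℝ → E} {a' : E} {v : F} {A : Set ℝ}
    {t : ℝ} (hv : HasDerivAt (fun τ => T τ (a t)) v t) (ha : HasDerivWithinAt a a' A t) :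
    HasDerivWithinAt (fun τ => T τ (a τ)) (v + T t a') A t := by
  have h1 : HasDerivWithinAt (fun τ => T t (a τ)) (T t a') A t :=
    ((T t).restrictScalars ℝ).hasFDerivAt.comp_hasDerivWithinAt t ha
  -- The Lipschitz bound supplies a factor `|τ - t|` and continuity of `a` a factor tending to zero,
  -- so this mixed increment is `o(τ - t)`.
  have h2 : HasDerivWithinAt (fun τ => T τ (a τ - a t) - T t (a τ - a t)) 0 A t := by
    rw [hasDerivWithinAt_iff_isLittleO]
    have h3 : (fun τ => a τ - a t) =o[𝓝[A] t] (fun _ => (1 : ℝ)) := by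
      rw [Asymptotics.isLittleO_one_iff]
      simpa using ha.continuousWithinAt.tendsto.sub_const (a t)
    have h4 : (fun τ => T τ (a τ - a t) - T t (a τ - a t)) =O[𝓝[A] t]
        fun τ => (τ - t) * ‖a τ - a t‖ := by
      refine .of_bound C (.of_forall fun τ => (hT t τ _).trans_eq ?_)
      rw [norm_mul, norm_norm, Real.norm_eq_abs, mul_assoc]
    have h5 : (fun τ => (τ - t) * ‖a τ - a t‖) =o[𝓝[A] t] fun τ => (τ - t) * (1 : ℝ) :=
      (Asymptotics.isBigO_refl _ _).mul_isLittleO h3.norm_left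
    simpa using h4.trans_isLittleO h5
  have h6 := (hv.hasDerivWithinAt (s := A)).add ((h1.sub_const (T t (a t))).add h2)
  rw [add_zero] at h6
  refine h6.congr (fun τ _ => ?_) ?_ <;>
  · simp only [Pi.add_apply, map_sub]
    abel

/-! ### The multipliers of the wave equation, normalized by powers of `⟨ξ⟩` -/

/-- The bounded continuous function given by a bounded continuous real function. -/
def realBcf (f : ℝ → ℝ) (hf : Continuous f) (C : ℝ) (hC : ∀ x, |f x| ≤ C) : ℝ →ᵇ ℂ :=
  BoundedContinuousFunction.ofNormedAddCommGroup (fun x => (f x : ℂ))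
    (Complex.continuous_ofReal.comp hf) C (fun x => by simpa using hC x)

@[simp] theorem realBcf_apply (f : ℝ → ℝ) (hf : Continuous f) (C : ℝ) (hC : ∀ x, |f x| ≤ C)
    (x : ℝ) : realBcf f hf C hC x = (f x : ℂ) := rfl

/-- The multiplier `⟨ξ⟩⁻¹`. -/
def japInv : ℝ →ᵇ ℂ := realBcf (jap (-1)) (continuous_jap _) 1 fun x => by
  rw [abs_of_pos (jap_pos _ _)]; exact jap_neg_le_one zero_le_one x

theorem jap_neg_two (ξ : ℝ) : jap (-2) ξ = (1 + ξ ^ 2)⁻¹ := by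
  rw [jap, Real.norm_eq_abs, sq_abs, neg_div, div_self two_ne_zero, Real.rpow_neg_one]

theorem abs_lap_le (ξ : ℝ) : |(2 * Real.pi * ξ) ^ 2 * jap (-2) ξ| ≤ (2 * Real.pi) ^ 2 := by
  rw [jap_neg_two, abs_of_nonneg (by positivity), mul_pow, mul_assoc]
  refine mul_le_of_le_one_right (by positivity) ?_
  rw [mul_inv_le_iff₀ (by positivity)]
  linarith

/-- The multiplier `(2πξ)² ⟨ξ⟩⁻²`. -/
def lapM : ℝ →ᵇ ℂ := realBcf (fun ξ => (2 * Real.pi * ξ) ^ 2 * jap (-2) ξ)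
  (by have := continuous_jap (-2); fun_prop) ((2 * Real.pi) ^ 2) abs_lap_le

/-- The multiplier `cos (2πtξ)`. -/
def cosM (t : ℝ) : ℝ →ᵇ ℂ := realBcf (fun ξ => Real.cos (2 * Real.pi * t * ξ)) (by fun_prop) 1
  fun _ => Real.abs_cos_le_one _

theorem jap_one_le (ξ : ℝ) : jap 1 ξ ≤ 1 + |ξ| := by
  rw [jap, ← Real.sqrt_eq_rpow, Real.norm_eq_abs]
  refine Real.sqrt_le_iff.2 ⟨by positivity, ?_⟩
  nlinarith [abs_nonneg ξ]

/-- Split `⟨ξ⟩ ≤ 1 + |ξ|`. The first part is at most `|t|` since `|sinc| ≤ 1`, the second is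
`|sin(2πtξ)|/(2π)`. The boundedness of this multiplier is the gain of one derivative in the wave
equation. -/
theorem abs_mul_sinc_le (t ξ : ℝ) : |jap 1 ξ * (t * Real.sinc (2 * Real.pi * t * ξ))| ≤ |t| + 1 := by
  rw [abs_mul, abs_of_pos (jap_pos _ _)]
  have h1 : |t * Real.sinc (2 * Real.pi * t * ξ)| ≤ |t| := by
    rw [abs_mul]
    exact mul_le_of_le_one_right (abs_nonneg _) (Real.abs_sinc_le_one _)
  have h2 : |ξ| * |t * Real.sinc (2 * Real.pi * t * ξ)| ≤ 1 := by
    have e : 2 * Real.pi * (ξ * (t * Real.sinc (2 * Real.pi * t * ξ))) =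
        Real.sin (2 * Real.pi * t * ξ) := by
      rcases eq_or_ne (2 * Real.pi * t * ξ) 0 with h | h
      · rw [h, Real.sin_zero, Real.sinc_zero]; linarith
      · have h5 : ξ ≠ 0 := right_ne_zero_of_mul h
        have h6 : t ≠ 0 := right_ne_zero_of_mul (left_ne_zero_of_mul h)
        rw [Real.sinc_of_ne_zero h]; field_simp
    have h3 := Real.abs_sin_le_one (2 * Real.pi * t * ξ)
    rw [← e, abs_mul (2 * Real.pi), abs_mul ξ, abs_of_pos (by positivity : 0 < 2 * Real.pi)] at h3
    have h4 : 0 ≤ |ξ| * |t * Real.sinc (2 * Real.pi * t * ξ)| := by positivity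
    nlinarith [Real.pi_gt_three]
  calc _ ≤ (1 + |ξ|) * |t * Real.sinc (2 * Real.pi * t * ξ)| := by
        gcongr; exact jap_one_le ξ
    _ ≤ _ := by rw [add_mul, one_mul]; linarith

/-- The multiplier `⟨ξ⟩ sin (2πtξ) / (2πξ)`. -/
def sinM (t : ℝ) : ℝ →ᵇ ℂ :=
  realBcf (fun ξ => jap 1 ξ * (t * Real.sinc (2 * Real.pi * t * ξ)))
    (by have := continuous_jap 1; have := Real.continuous_sinc; fun_prop) (|t| + 1)
    (abs_mul_sinc_le t)

theorem mul_sinc_eq (t : ℝ) {ξ : ℝ} (hξ : 0 < ξ) :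
    t * Real.sinc (2 * Real.pi * t * ξ) = Real.sin (2 * Real.pi * t * ξ) / (2 * Real.pi * ξ) := by
  rcases eq_or_ne t 0 with rfl | h
  · simp
  · have h' : 2 * Real.pi * t * ξ ≠ 0 := by positivity
    rw [Real.sinc_of_ne_zero h']; field_simp

theorem sinM_apply (t : ℝ) {ξ : ℝ} (hξ : 0 < ξ) :
    sinM t ξ = ((jap 1 ξ * (Real.sin (2 * Real.pi * t * ξ) / (2 * Real.pi * ξ)) : ℝ) : ℂ) := by
  rw [← mul_sinc_eq t hξ]; rfl

theorem cosM_apply (t ξ : ℝ) : cosM t ξ = (Real.cos (2 * Real.pi * t * ξ) : ℝ) := rfl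
theorem lapM_apply (ξ : ℝ) : lapM ξ = ((2 * Real.pi * ξ) ^ 2 * jap (-2) ξ : ℝ) := rfl
theorem japInv_apply (ξ : ℝ) : japInv ξ = (jap (-1) ξ : ℝ) := rfl

theorem jap_neg_one_mul_self (ξ : ℝ) : jap (-1) ξ * jap (-1) ξ = jap (-2) ξ := by
  rw [← jap_add]; norm_num

theorem lapM_mul_sinM_apply (t : ℝ) {ξ : ℝ} (hξ : 0 < ξ) : (lapM * sinM t) ξ =
    ((2 * Real.pi * ξ * Real.sin (2 * Real.pi * t * ξ) * jap (-1) ξ : ℝ) : ℂ) := by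
  rw [BoundedContinuousFunction.mul_apply, sinM_apply t hξ, lapM_apply, ← Complex.ofReal_mul]
  congr 1
  have h1 := jap_neg_mul 1 ξ
  rw [← jap_neg_one_mul_self]
  have h2 : 2 * Real.pi * ξ ≠ 0 := by positivity
  generalize Real.sin (2 * Real.pi * t * ξ) = σ
  field_simp
  linear_combination σ * jap (-1) ξ * h1

/-- The identity `cos² + sin² = 1`: in the second term the weights `⟨ξ⟩^{-2}` and `⟨ξ⟩^2`, and the
factors `2πξ`, cancel. -/
theorem cosM_sq_add (t : ℝ) (f : HalfL2) :
    mulOp (cosM t) (mulOp (cosM t) f) + mulOp lapM (mulOp (sinM t) (mulOp (sinM t) f)) = f := by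
  rw [← mulOp_mul, ← mulOp_mul, ← mulOp_mul, ← mulOp_add]
  conv_rhs => rw [← mulOp_one f]
  congr 1
  refine mulOp_congr fun ξ hξ => ?_
  rw [BoundedContinuousFunction.add_apply, BoundedContinuousFunction.mul_apply,
    BoundedContinuousFunction.mul_apply (lapM * sinM t), lapM_mul_sinM_apply t hξ, sinM_apply t hξ, cosM_apply,
    BoundedContinuousFunction.coe_one, Pi.one_apply]
  rw [← Complex.ofReal_mul, ← Complex.ofReal_mul, ← Complex.ofReal_add, ← Complex.ofReal_one]
  congr 1
  have h1 := jap_neg_mul 1 ξ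
  have h2 : 2 * Real.pi * ξ ≠ 0 := by positivity
  have h3 := Real.sin_sq_add_cos_sq (2 * Real.pi * t * ξ)
  have e : 2 * Real.pi * ξ * Real.sin (2 * Real.pi * t * ξ) * jap (-1) ξ *
      (jap 1 ξ * (Real.sin (2 * Real.pi * t * ξ) / (2 * Real.pi * ξ))) =
      Real.sin (2 * Real.pi * t * ξ) ^ 2 * (jap (-1) ξ * jap 1 ξ) := by field_simp
  rw [e, h1]
  linarith

theorem norm_cosM_le (t ξ : ℝ) : ‖cosM t ξ‖ ≤ 1 := by
  rw [cosM_apply, Complex.norm_real]; exact Real.abs_cos_le_one _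

theorem norm_sinM_le (t ξ : ℝ) : ‖sinM t ξ‖ ≤ |t| + 1 := by
  rw [sinM, realBcf_apply, Complex.norm_real]; exact abs_mul_sinc_le t ξ

theorem norm_lapM_mul_sinM_le (t : ℝ) {ξ : ℝ} (hξ : 0 < ξ) :
    ‖(lapM * sinM t) ξ‖ ≤ 2 * Real.pi := by
  rw [lapM_mul_sinM_apply t hξ, Complex.norm_real, Real.norm_eq_abs, mul_right_comm, abs_mul]
  have h1 : |2 * Real.pi * ξ * jap (-1) ξ| ≤ 2 * Real.pi := by
    rw [abs_of_pos (mul_pos (by positivity) (jap_pos _ _)), mul_assoc]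
    refine mul_le_of_le_one_right (by positivity) ?_
    have h2 : ξ ≤ jap 1 ξ := by
      rw [jap, ← Real.sqrt_eq_rpow, Real.norm_eq_abs, sq_abs]
      exact Real.le_sqrt_of_sq_le (by linarith)
    have := mul_le_mul_of_nonneg_left h2 (jap_pos (-1) ξ).le
    rw [jap_neg_mul] at this
    linarith
  exact (mul_le_of_le_one_right (abs_nonneg _) (Real.abs_sin_le_one _)).trans h1

/-- The time derivative of `cos(2πtξ)` has size `ξ`. Only after multiplication by `⟨ξ⟩⁻¹`, that is,
in `H^{s-1}`, is the propagator differentiable on all of `L²`. -/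
theorem hasDerivAt_japInv_cosM (f : HalfL2) (t : ℝ) :
    HasDerivAt (fun τ => mulOp (japInv * cosM τ) f) (mulOp (-(lapM * sinM t)) f) t := by
  refine hasDerivAt_mulOp (κ := fun τ => japInv * cosM τ) (δ := fun τ => -(lapM * sinM τ))
    (C := 2 * Real.pi) (fun ξ hξ t => ?_) (fun t ξ hξ => ?_) f t
  · simp only [BoundedContinuousFunction.neg_apply, lapM_mul_sinM_apply t hξ]
    simp only [BoundedContinuousFunction.mul_apply, japInv_apply, cosM_apply, ← Complex.ofReal_mul,
      ← Complex.ofReal_neg]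
    refine HasDerivAt.ofReal_comp ?_
    have h : HasDerivAt (fun τ : ℝ => 2 * Real.pi * τ * ξ) (2 * Real.pi * ξ) t := by
      simpa using ((hasDerivAt_id t).const_mul (2 * Real.pi)).mul_const ξ
    exact (h.cos.const_mul (jap (-1) ξ)).congr_deriv (by ring)
  · rw [BoundedContinuousFunction.neg_apply, norm_neg]
    exact norm_lapM_mul_sinM_le t hξ

theorem hasDerivAt_japInv_sinM_apply {ξ : ℝ} (hξ : 0 < ξ) (t : ℝ) :
    HasDerivAt (fun τ => (japInv * sinM τ) ξ) (cosM t ξ) t := by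
  simp only [BoundedContinuousFunction.mul_apply, sinM_apply _ hξ, cosM_apply, japInv_apply,
    ← Complex.ofReal_mul]
  refine HasDerivAt.ofReal_comp ?_
  have h : HasDerivAt (fun τ : ℝ => 2 * Real.pi * τ * ξ) (2 * Real.pi * ξ) t := by
    simpa using ((hasDerivAt_id t).const_mul (2 * Real.pi)).mul_const ξ
  refine (((h.sin.div_const (2 * Real.pi * ξ)).const_mul (jap 1 ξ)).const_mul
    (jap (-1) ξ)).congr_deriv ?_
  have h2 : 2 * Real.pi * ξ ≠ 0 := by positivity
  rw [← mul_assoc, jap_neg_mul, one_mul, mul_div_assoc, div_self h2, mul_one]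

theorem hasDerivAt_japInv_sinM (f : HalfL2) (t : ℝ) :
    HasDerivAt (fun τ => mulOp (japInv * sinM τ) f) (mulOp (cosM t) f) t :=
  hasDerivAt_mulOp (κ := fun τ => japInv * sinM τ) (fun _ hξ t => hasDerivAt_japInv_sinM_apply hξ t)
    (fun t ξ _ => norm_cosM_le t ξ) f t

theorem norm_sub_le_of_hasDerivAt {E : Type*} [NormedAddCommGroup E] [NormedSpace ℝ E] {f f' : ℝ → E}
    {C : ℝ} (h : ∀ t, HasDerivAt f (f' t) t) (hC : ∀ t, ‖f' t‖ ≤ C) (t τ : ℝ) :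
    ‖f τ - f t‖ ≤ C * |τ - t| :=
  Convex.norm_image_sub_le_of_norm_hasDerivWithin_le (fun τ _ => (h τ).hasDerivWithinAt)
    (fun τ _ => hC τ) convex_univ (mem_univ t) (mem_univ τ)

theorem HasDerivWithinAt.japInv_cosM {a : ℝ → HalfL2} {a' : HalfL2} {A : Set ℝ} {t : ℝ}
    (ha : HasDerivWithinAt a a' A t) :
    HasDerivWithinAt (fun τ => mulOp japInv (mulOp (cosM τ) (a τ)))
      (-mulOp lapM (mulOp (sinM t) (a t)) + mulOp japInv (mulOp (cosM t) a')) A t := by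
  simp only [← mulOp_mul, ← mulOp_neg]
  refine hasDerivWithinAt_clm_apply_of_lipschitz (T := fun τ => mulOp (japInv * cosM τ))
    (C := 2 * Real.pi) (fun t τ x => ?_) (hasDerivAt_japInv_cosM (a t) t) ha
  rw [mul_right_comm]
  refine norm_sub_le_of_hasDerivAt (hasDerivAt_japInv_cosM x) (fun t => ?_) t τ
  refine norm_mulOp_apply_le (fun ξ hξ => ?_) x
  rw [BoundedContinuousFunction.neg_apply, norm_neg]
  exact norm_lapM_mul_sinM_le t hξ

theorem HasDerivWithinAt.japInv_sinM {a : ℝ → HalfL2} {a' : HalfL2} {A : Set ℝ} {t : ℝ}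
    (ha : HasDerivWithinAt a a' A t) :
    HasDerivWithinAt (fun τ => mulOp japInv (mulOp (sinM τ) (a τ)))
      (mulOp (cosM t) (a t) + mulOp japInv (mulOp (sinM t) a')) A t := by
  simp only [← mulOp_mul]
  refine hasDerivWithinAt_clm_apply_of_lipschitz (T := fun τ => mulOp (japInv * sinM τ))
    (C := 1) (fun t τ x => ?_) (hasDerivAt_japInv_sinM (a t) t) ha
  rw [mul_right_comm]
  exact norm_sub_le_of_hasDerivAt (hasDerivAt_japInv_sinM x)
    (fun t => norm_mulOp_apply_le (fun ξ _ => norm_cosM_le t ξ) x) t τ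

theorem mulOp_japInv_injective : Function.Injective (mulOp japInv) := by
  intro f g h
  refine Lp.ext ?_
  filter_upwards [coeFn_mulOp japInv f, coeFn_mulOp japInv g] with ξ h1 h2
  rw [h, h2, japInv_apply] at h1
  exact (mul_left_cancel₀ (jap_ne_zero _ _) h1).symm

theorem continuous_mulOp_cosM (f : HalfL2) : Continuous fun t => mulOp (cosM t) f := by
  refine continuous_iff_continuousAt.2 fun t => ?_
  refine tendsto_mulOp (C := 1) (.of_forall fun τ ξ _ => norm_cosM_le τ ξ) (fun ξ _ => ?_) f
  have : Continuous fun τ => cosM τ ξ := by simp only [cosM_apply]; fun_prop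
  exact this.tendsto t

theorem continuous_mulOp_sinM (f : HalfL2) : Continuous fun t => mulOp (sinM t) f := by
  refine continuous_iff_continuousAt.2 fun t => ?_
  refine tendsto_mulOp (C := |t| + 1 + 1) ?_ (fun ξ hξ => ?_) f
  · have : ∀ᶠ τ in 𝓝 t, |τ| < |t| + 1 := continuous_abs.continuousAt.eventually_lt
      continuousAt_const (by linarith)
    filter_upwards [this] with τ hτ ξ _
    exact (norm_sinM_le τ ξ).trans (by linarith)
  · have : Continuous fun τ => sinM τ ξ := by simp only [sinM_apply _ hξ]; fun_prop
    exact this.tendsto t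

/-! ### The equation in the interaction picture -/

/-- Local well-posedness of an ordinary differential equation with a locally Lipschitz right-hand
side. -/
theorem exists_local_flow {E : Type*} [NormedAddCommGroup E] [NormedSpace ℝ E] [CompleteSpace E]
    {F : ℝ → E → E}
    (hF : ∀ R : ℝ, ∃ K : NNReal, ∀ t ∈ Icc (-1 : ℝ) 1, LipschitzOnWith K (F t) (Metric.closedBall 0 R))
    (hc : ∀ x, Continuous fun t => F t x) (x₀ : E) :
    ∃ T : ℝ, 0 < T ∧ T ≤ 1 ∧ ∃ r : ℝ, 0 < r ∧ ∃ α : E → ℝ → E,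
      (∀ x ∈ Metric.closedBall x₀ r, α x 0 = x ∧
        ∀ t ∈ Icc (-T) T, HasDerivWithinAt (α x) (F t (α x t)) (Icc (-T) T) t) ∧
      ∃ L : NNReal, ∀ t ∈ Icc (-T) T, LipschitzOnWith L (α · t) (Metric.closedBall x₀ r) := by
  obtain ⟨K, hK⟩ := hF (‖x₀‖ + 1)
  have hsub : Metric.closedBall x₀ 1 ⊆ Metric.closedBall 0 (‖x₀‖ + 1) := fun x hx => by
    rw [mem_closedBall_zero_iff]
    rw [mem_closedBall_iff_norm] at hx
    linarith [norm_le_norm_add_norm_sub' x x₀]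
  obtain ⟨B, hB⟩ := isCompact_Icc.exists_bound_of_continuousOn (hc x₀).continuousOn
    (s := Icc (-1 : ℝ) 1)
  have hB0 : 0 ≤ B := (norm_nonneg _).trans (hB 0 (by simp))
  -- On the unit ball around `x₀` the field is bounded by `K + B`. Curves starting in the ball of
  -- radius `1/2` stay in the unit ball because `(K + B) T ≤ 1/2`.
  set T : ℝ := min 1 (1 / (2 * (K + B + 1))) with hT
  have hK0 : (0 : ℝ) ≤ K := K.2
  have hT0 : 0 < T := by positivity
  have hT1 : Icc (-T) T ⊆ Icc (-1) 1 := Icc_subset_Icc (by linarith [min_le_left 1 (1 / (2 * (K + B + 1)))])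
    (min_le_left _ _)
  have hPL : IsPicardLindelof F (⟨0, by constructor <;> linarith⟩ : Icc (-T) T) x₀ 1 (1 / 2)
      (K + ⟨B, hB0⟩) K := by
    refine ⟨fun t ht => (hK t (hT1 ht)).mono hsub, fun x _ => (hc x).continuousOn, fun t ht x hx => ?_,
      ?_⟩
    · have h1 := (hK t (hT1 ht)).dist_le_mul x (hsub hx) x₀ (hsub (by simp))
      rw [dist_eq_norm, dist_eq_norm] at h1
      rw [NNReal.coe_one, mem_closedBall_iff_norm] at hx
      have h2 := hB t (hT1 ht)
      have h3 := norm_le_norm_add_norm_sub' (F t x) (F t x₀)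
      have h4 : (K : ℝ) * ‖x - x₀‖ ≤ K := mul_le_of_le_one_right hK0 hx
      change _ ≤ (K : ℝ) + B
      linarith
    · change ((K : ℝ) + B) * max (T - 0) (0 - -T) ≤ 1 - ((1 / 2 : NNReal) : ℝ)
      have : T ≤ 1 / (2 * (K + B + 1)) := min_le_right _ _
      rw [le_div_iff₀ (by positivity)] at this
      rw [sub_zero, zero_sub, neg_neg, max_self]
      push_cast
      nlinarith
  obtain ⟨α, h1, L, h2⟩ := hPL.exists_forall_mem_closedBall_eq_hasDerivWithinAt_lipschitzOnWith
  exact ⟨T, hT0, min_le_left _ _, (1 / 2 : NNReal), by positivity, α, h1, L, h2⟩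

/-- Two given solutions are bounded on the compact interval, so a Lipschitz constant on one
sufficiently large ball is enough for the standard uniqueness theorem. -/
theorem eqOn_of_hasDerivWithinAt {E : Type*} [NormedAddCommGroup E] [NormedSpace ℝ E]
    {F : ℝ → E → E} {T : ℝ} (hT : 0 < T) (hT1 : T ≤ 1)
    (hF : ∀ R : ℝ, ∃ K : NNReal, ∀ t ∈ Icc (-1 : ℝ) 1, LipschitzOnWith K (F t) (Metric.closedBall 0 R))
    {x y : ℝ → E} (hx : ∀ t ∈ Icc (-T) T, HasDerivWithinAt x (F t (x t)) (Icc (-T) T) t)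
    (hy : ∀ t ∈ Icc (-T) T, HasDerivWithinAt y (F t (y t)) (Icc (-T) T) t) (h0 : x 0 = y 0) :
    EqOn x y (Icc (-T) T) := by
  have hxc : ContinuousOn x (Icc (-T) T) := fun t ht => (hx t ht).continuousWithinAt
  have hyc : ContinuousOn y (Icc (-T) T) := fun t ht => (hy t ht).continuousWithinAt
  obtain ⟨A, hA⟩ := isCompact_Icc.exists_bound_of_continuousOn hxc
  obtain ⟨B, hB⟩ := isCompact_Icc.exists_bound_of_continuousOn hyc
  obtain ⟨K, hK⟩ := hF (max A B)
  refine ODE_solution_unique_of_mem_Icc (s := fun _ => Metric.closedBall 0 (max A B)) (K := K) (v := F)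
    (t₀ := 0) (fun t ht => hK t ⟨by linarith [ht.1], by linarith [ht.2]⟩) ⟨by linarith, hT⟩
    hxc (fun t ht => (hx t (Ioo_subset_Icc_self ht)).hasDerivAt (Icc_mem_nhds ht.1 ht.2))
    (fun t ht => ?_)
    hyc (fun t ht => (hy t (Ioo_subset_Icc_self ht)).hasDerivAt (Icc_mem_nhds ht.1 ht.2))
    (fun t ht => ?_) h0
  · rw [mem_closedBall_zero_iff]
    exact (hA t (Ioo_subset_Icc_self ht)).trans (le_max_left _ _)
  · rw [mem_closedBall_zero_iff]
    exact (hB t (Ioo_subset_Icc_self ht)).trans (le_max_right _ _)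

/-! ### Free waves and the differential equation of the profile -/

/-- The position of the free wave with profile `x`. -/
def position (t : ℝ) : HalfL2 × HalfL2 →L[ℂ] HalfL2 := (mulOp (cosM t)).coprod (mulOp (sinM t))

/-- The velocity of the free wave with profile `x`. -/
def speed (t : ℝ) : HalfL2 × HalfL2 →L[ℂ] HalfL2 :=
  (-mulOp (lapM * sinM t)).coprod (mulOp (cosM t))

theorem position_apply (t : ℝ) (x : HalfL2 × HalfL2) :
    position t x = mulOp (cosM t) x.1 + mulOp (sinM t) x.2 := rfl

theorem speed_apply (t : ℝ) (x : HalfL2 × HalfL2) :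
    speed t x = -mulOp lapM (mulOp (sinM t) x.1) + mulOp (cosM t) x.2 := by
  rw [← mulOp_mul]; rfl

theorem norm_mulOp_cosM_le (t : ℝ) (f : HalfL2) : ‖mulOp (cosM t) f‖ ≤ ‖f‖ := by
  simpa using norm_mulOp_apply_le (fun ξ _ => norm_cosM_le t ξ) f

theorem norm_mulOp_sinM_le {t : ℝ} (ht : t ∈ Icc (-1 : ℝ) 1) (f : HalfL2) :
    ‖mulOp (sinM t) f‖ ≤ 2 * ‖f‖ :=
  norm_mulOp_apply_le (fun ξ _ => (norm_sinM_le t ξ).trans (by linarith [abs_le.2 ht])) f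

theorem norm_position_le {t : ℝ} (ht : t ∈ Icc (-1 : ℝ) 1) (x : HalfL2 × HalfL2) :
    ‖position t x‖ ≤ 3 * ‖x‖ := by
  rw [position_apply]
  have h1 := norm_add_le (mulOp (cosM t) x.1) (mulOp (sinM t) x.2)
  linarith [norm_mulOp_cosM_le t x.1, norm_mulOp_sinM_le ht x.2, norm_fst_le x, norm_snd_le x]

theorem norm_speed_le (t : ℝ) (x : HalfL2 × HalfL2) :
    ‖speed t x‖ ≤ (2 * Real.pi + 1) * ‖x‖ := by
  rw [speed_apply, ← mulOp_mul]
  have h1 := norm_add_le (-mulOp (lapM * sinM t) x.1) (mulOp (cosM t) x.2)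
  have h2 : ‖mulOp (lapM * sinM t) x.1‖ ≤ 2 * Real.pi * ‖x.1‖ :=
    norm_mulOp_apply_le (fun ξ hξ => norm_lapM_mul_sinM_le t hξ) x.1
  have h3 := mul_le_mul_of_nonneg_left (norm_fst_le x) Real.two_pi_pos.le
  rw [norm_neg] at h1
  linarith [norm_mulOp_cosM_le t x.2, norm_snd_le x]

/-- The nonlinearity in the interaction picture. -/
def profileField (ε : ℝ) (M : HalfL2 → HalfL2) (t : ℝ) (x : HalfL2 × HalfL2) : HalfL2 × HalfL2 :=
  (-(ε : ℂ) • mulOp (sinM t) (M (position t x)), (ε : ℂ) • mulOp (cosM t) (M (position t x)))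

/-- The target of `M` represents `H^{s-1}`, and both propagators are bounded from there into the
space of profiles, uniformly for `|t| ≤ 1`. Hence the field inherits the local Lipschitz bound of
`M`. -/
theorem exists_lipschitzOnWith_profileField {ε : ℝ} (hε : |ε| ≤ 1) {M : HalfL2 → HalfL2}
    (hM : ∀ R : ℝ, ∃ K : NNReal, LipschitzOnWith K M (Metric.closedBall 0 R)) (R : ℝ) :
    ∃ K : NNReal, ∀ t ∈ Icc (-1 : ℝ) 1,
      LipschitzOnWith K (profileField ε M t) (Metric.closedBall 0 R) := by
  obtain ⟨K, hK⟩ := hM (3 * R)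
  refine ⟨2 * (K * 3), fun t ht => LipschitzOnWith.of_dist_le_mul fun x hx y hy => ?_⟩
  rw [mem_closedBall_zero_iff] at hx hy
  have hx' := norm_position_le ht x
  have hy' := norm_position_le ht y
  have h1 := hK.dist_le_mul (position t x) (mem_closedBall_zero_iff.2 (by linarith)) (position t y)
    (mem_closedBall_zero_iff.2 (by linarith))
  rw [dist_eq_norm, dist_eq_norm, ← map_sub] at h1
  have h2 : ‖M (position t x) - M (position t y)‖ ≤ K * (3 * ‖x - y‖) :=
    h1.trans (mul_le_mul_of_nonneg_left (norm_position_le ht _) K.2)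
  have hε' : ‖(ε : ℂ)‖ ≤ 1 := by simpa using hε
  rw [dist_eq_norm, dist_eq_norm]
  push_cast
  refine norm_prod_le_iff.2 ⟨?_, ?_⟩
  · change ‖-(ε : ℂ) • mulOp (sinM t) (M (position t x)) -
      -(ε : ℂ) • mulOp (sinM t) (M (position t y))‖ ≤ _
    rw [← smul_sub, ← map_sub, norm_smul, norm_neg]
    refine (mul_le_of_le_one_left (norm_nonneg _) hε').trans ((norm_mulOp_sinM_le ht _).trans ?_)
    linarith
  · change ‖(ε : ℂ) • mulOp (cosM t) (M (position t x)) -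
      (ε : ℂ) • mulOp (cosM t) (M (position t y))‖ ≤ _
    rw [← smul_sub, ← map_sub, norm_smul]
    refine (mul_le_of_le_one_left (norm_nonneg _) hε').trans ((norm_mulOp_cosM_le t _).trans ?_)
    linarith [norm_nonneg (M (position t x) - M (position t y))]

/-- Strong continuity in time of a family of operators gives joint continuity along curves. -/
theorem continuousWithinAt_mulOp_apply {κ : ℝ → BoundedContinuousFunction ℝ ℂ} {C : ℝ} {A : Set ℝ}
    {t : ℝ} (hC : ∀ τ ∈ A, ∀ f, ‖mulOp (κ τ) f‖ ≤ C * ‖f‖)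
    (hκ : ∀ f, Continuous fun τ => mulOp (κ τ) f) {a : ℝ → HalfL2}
    (ha : ContinuousWithinAt a A t) : ContinuousWithinAt (fun τ => mulOp (κ τ) (a τ)) A t := by
  have h1 : Tendsto (fun τ => mulOp (κ τ) (a τ - a t)) (𝓝[A] t) (𝓝 0) := by
    have h2 : Tendsto (fun τ => C * ‖a τ - a t‖) (𝓝[A] t) (𝓝 0) := by
      simpa using ((ha.tendsto.sub_const (a t)).norm).const_mul C
    refine squeeze_zero_norm' ?_ h2
    filter_upwards [self_mem_nhdsWithin] with τ hτ using hC τ hτ _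
  have h3 := h1.add ((hκ (a t)).continuousWithinAt (s := A) (x := t)).tendsto
  rw [zero_add] at h3
  refine h3.congr fun τ => ?_
  rw [← map_add, sub_add_cancel]

theorem continuousOn_position {T : ℝ} (hT : T ≤ 1) {x : ℝ → HalfL2 × HalfL2}
    (hx : ContinuousOn x (Icc (-T) T)) : ContinuousOn (fun t => position t (x t)) (Icc (-T) T) := by
  have hT' : Icc (-T) T ⊆ Icc (-1) 1 := Icc_subset_Icc (by linarith) hT
  simp only [position_apply]
  refine ContinuousOn.add (fun t ht => ?_) (fun t ht => ?_)
  · exact continuousWithinAt_mulOp_apply (C := 1) (fun τ _ f => by simpa using norm_mulOp_cosM_le τ f)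
      continuous_mulOp_cosM (hx.fst t ht)
  · exact continuousWithinAt_mulOp_apply (C := 2) (fun τ hτ f => norm_mulOp_sinM_le (hT' hτ) f)
      continuous_mulOp_sinM (hx.snd t ht)

theorem continuousOn_speed {T : ℝ} (hT : T ≤ 1) {x : ℝ → HalfL2 × HalfL2}
    (hx : ContinuousOn x (Icc (-T) T)) : ContinuousOn (fun t => speed t (x t)) (Icc (-T) T) := by
  have hT' : Icc (-T) T ⊆ Icc (-1) 1 := Icc_subset_Icc (by linarith) hT
  simp only [speed_apply]
  refine ContinuousOn.add (ContinuousOn.neg ((mulOp lapM).continuous.comp_continuousOn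
    fun t ht => ?_)) (fun t ht => ?_)
  · exact continuousWithinAt_mulOp_apply (C := 2) (fun τ hτ f => norm_mulOp_sinM_le (hT' hτ) f)
      continuous_mulOp_sinM (hx.fst t ht)
  · exact continuousWithinAt_mulOp_apply (C := 1) (fun τ _ f => by simpa using norm_mulOp_cosM_le τ f)
      continuous_mulOp_cosM (hx.snd t ht)

theorem continuous_of_forall_lipschitzOnWith {E F : Type*} [NormedAddCommGroup E]
    [NormedAddCommGroup F] {M : E → F}
    (hM : ∀ R : ℝ, ∃ K : NNReal, LipschitzOnWith K M (Metric.closedBall 0 R)) : Continuous M := by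
  refine continuous_iff_continuousAt.2 fun x => ?_
  obtain ⟨K, hK⟩ := hM (‖x‖ + 1)
  refine hK.continuousOn.continuousAt (Filter.mem_of_superset (Metric.ball_mem_nhds x one_pos) ?_)
  intro y hy
  rw [mem_ball_iff_norm] at hy
  rw [mem_closedBall_zero_iff]
  linarith [norm_le_norm_add_norm_sub' y x]

theorem continuous_profileField (ε : ℝ) {M : HalfL2 → HalfL2} (hM : Continuous M)
    (x : HalfL2 × HalfL2) : Continuous fun t => profileField ε M t x := by
  have h1 : Continuous fun t => M (position t x) :=
    hM.comp ((continuous_mulOp_cosM x.1).add (continuous_mulOp_sinM x.2))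
  suffices h : (Continuous fun t => mulOp (sinM t) (M (position t x))) ∧
      Continuous fun t => mulOp (cosM t) (M (position t x)) from
    (h.1.const_smul (-(ε : ℂ))).prodMk (h.2.const_smul (ε : ℂ))
  constructor
  · refine continuous_iff_continuousAt.2 fun t => ?_
    have hA : Icc (t - 1) (t + 1) ∈ 𝓝 t := Icc_mem_nhds (by linarith) (by linarith)
    refine (continuousWithinAt_mulOp_apply (A := Icc (t - 1) (t + 1)) (C := |t| + 1 + 1)
      (fun τ hτ f => norm_mulOp_apply_le (fun ξ _ => (norm_sinM_le τ ξ).trans ?_) f)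
      continuous_mulOp_sinM h1.continuousWithinAt).continuousAt hA
    have : |τ - t| ≤ 1 := abs_le.2 ⟨by linarith [hτ.1], by linarith [hτ.2]⟩
    linarith [abs_sub_abs_le_abs_sub τ t]
  · refine continuous_iff_continuousAt.2 fun t => continuousWithinAt_univ _ _ |>.1 ?_
    exact continuousWithinAt_mulOp_apply (C := 1) (fun τ _ f => by simpa using norm_mulOp_cosM_le τ f)
      continuous_mulOp_cosM h1.continuousWithinAt

theorem hasDerivWithinAt_fst {E F : Type*} [NormedAddCommGroup E] [NormedSpace ℝ E]
    [NormedAddCommGroup F] [NormedSpace ℝ F] {x : ℝ → E × F} {x' : E × F} {A : Set ℝ} {t : ℝ}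
    (h : HasDerivWithinAt x x' A t) : HasDerivWithinAt (fun τ => (x τ).1) x'.1 A t :=
  (ContinuousLinearMap.fst ℝ E F).hasFDerivAt.comp_hasDerivWithinAt t h

theorem hasDerivWithinAt_snd {E F : Type*} [NormedAddCommGroup E] [NormedSpace ℝ E]
    [NormedAddCommGroup F] [NormedSpace ℝ F] {x : ℝ → E × F} {x' : E × F} {A : Set ℝ} {t : ℝ}
    (h : HasDerivWithinAt x x' A t) : HasDerivWithinAt (fun τ => (x τ).2) x'.2 A t :=
  (ContinuousLinearMap.snd ℝ E F).hasFDerivAt.comp_hasDerivWithinAt t h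

section
variable {ε : ℝ} {M : HalfL2 → HalfL2} {A : Set ℝ} {t : ℝ} {x : ℝ → HalfL2 × HalfL2}

/-- Variation of constants: the contributions of `x'` are `-ε cos · sin` and `ε sin · cos` applied
to the same function, and cancel. The multiplier `⟨ξ⟩⁻¹` represents the inclusion of `H^s` in
`H^{s-1}`. -/
theorem hasDerivWithinAt_position (hx : HasDerivWithinAt x (profileField ε M t (x t)) A t) :
    HasDerivWithinAt (fun τ => mulOp japInv (position τ (x τ))) (speed t (x t)) A t := by
  have h1 := HasDerivWithinAt.japInv_cosM (hasDerivWithinAt_fst hx)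
  have h2 := HasDerivWithinAt.japInv_sinM (hasDerivWithinAt_snd hx)
  simp only [position_apply, map_add]
  refine (h1.add h2).congr_deriv ?_
  rw [speed_apply, profileField]
  simp only [neg_smul, map_neg, map_smul]
  rw [mulOp_comm (cosM t) (sinM t)]
  abel

/-- Here the contributions of `x'` add up to `ε (cos² + sin²) M`, while the free part yields
`-(2πξ)² ⟨ξ⟩^{-2}` times the position. -/
theorem hasDerivWithinAt_speed (hx : HasDerivWithinAt x (profileField ε M t (x t)) A t) :
    HasDerivWithinAt (fun τ => mulOp japInv (speed τ (x τ)))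
      (-mulOp lapM (position t (x t)) + (ε : ℂ) • mulOp japInv (M (position t (x t)))) A t := by
  have h1 := HasDerivWithinAt.japInv_sinM (hasDerivWithinAt_fst hx)
  have h2 := HasDerivWithinAt.japInv_cosM (hasDerivWithinAt_snd hx)
  have h3 := (((mulOp lapM).restrictScalars ℝ).hasFDerivAt.comp_hasDerivWithinAt t h1).neg.add h2
  refine (h3.congr_deriv ?_).congr (fun τ _ => ?_) ?_
  · conv_rhs => rw [← cosM_sq_add t (M (position t (x t)))]
    simp only [profileField, neg_smul, map_neg, map_smul, map_add, position_apply,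
      ContinuousLinearMap.coe_restrictScalars', smul_add]
    rw [mulOp_comm lapM japInv]
    abel
  all_goals
    simp only [speed_apply, map_add, map_neg, Pi.add_apply, Pi.neg_apply, Function.comp_apply,
      ContinuousLinearMap.coe_restrictScalars']
    rw [mulOp_comm lapM japInv]

end

/-! ### Recovering the profile of a solution -/

theorem exists_primitive {E : Type*} [NormedAddCommGroup E] [NormedSpace ℝ E] [CompleteSpace E]
    {T : ℝ} (hT : 0 < T) {v : ℝ → E} (hv : ContinuousOn v (Icc (-T) T)) :
    ∃ V : ℝ → E, ∀ t ∈ Icc (-T) T, HasDerivWithinAt V (v t) (Icc (-T) T) t := by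
  have hle : -T ≤ T := by linarith
  -- The curve is continued by its end values, so that one-sided derivatives at `±T` need no
  -- separate argument.
  have hc : Continuous (IccExtend hle ((Icc (-T) T).domRestrict v)) :=
    (continuousOn_iff_continuous_domRestrict.1 hv).Icc_extend'
  refine ⟨fun t => ∫ τ in 0..t, IccExtend hle ((Icc (-T) T).domRestrict v) τ, fun t ht => ?_⟩
  have := (intervalIntegral.integral_hasDerivAt_right (hc.intervalIntegrable 0 t)
    (hc.stronglyMeasurableAtFilter _ _) hc.continuousAt).hasDerivWithinAt (s := Icc (-T) T)
  rwa [IccExtend_of_mem hle _ ht] at this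

theorem eq_of_hasDerivWithinAt_zero {E : Type*} [NormedAddCommGroup E] [NormedSpace ℝ E]
    {A : Set ℝ} (hA : Convex ℝ A) {f : ℝ → E} (hf : ∀ t ∈ A, HasDerivWithinAt f 0 A t) {t τ : ℝ}
    (ht : t ∈ A) (hτ : τ ∈ A) : f t = f τ := by
  have := hA.norm_image_sub_le_of_norm_hasDerivWithin_le (C := 0) hf (by simp) hτ ht
  rw [zero_mul] at this
  exact sub_eq_zero.1 (norm_le_zero_iff.1 this)

theorem hasDerivWithinAt_clm_comp {E F : Type*} [NormedAddCommGroup E] [NormedSpace ℂ E]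
    [NormedAddCommGroup F] [NormedSpace ℂ F] (S : E →L[ℂ] F) {a : ℝ → E} {a' : E} {A : Set ℝ}
    {t : ℝ} (h : HasDerivWithinAt a a' A t) : HasDerivWithinAt (fun τ => S (a τ)) (S a') A t :=
  (S.restrictScalars ℝ).hasFDerivAt.comp_hasDerivWithinAt t h

/-- If an injective operator maps a curve to a curve whose derivative is the image of a continuous
curve, then the former is differentiable. -/
theorem hasDerivWithinAt_of_injective {E F : Type*} [NormedAddCommGroup E] [NormedSpace ℂ E]
    [CompleteSpace E] [NormedAddCommGroup F] [NormedSpace ℂ F] {S : E →L[ℂ] F}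
    (hS : Function.Injective S) {T : ℝ} (hT : 0 < T) {a v : ℝ → E}
    (hv : ContinuousOn v (Icc (-T) T))
    (ha : ∀ t ∈ Icc (-T) T, HasDerivWithinAt (fun τ => S (a τ)) (S (v t)) (Icc (-T) T) t) :
    ∀ t ∈ Icc (-T) T, HasDerivWithinAt a (v t) (Icc (-T) T) t := by
  obtain ⟨V, hV⟩ := exists_primitive hT hv
  have h0 : (0 : ℝ) ∈ Icc (-T) T := ⟨by linarith, hT.le⟩
  have h1 : ∀ t ∈ Icc (-T) T, a t = V t + (a 0 - V 0) := by
    intro t ht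
    -- `S (a - V)` has derivative zero, hence is constant; injectivity of `S` makes `a - V`
    -- constant.
    have h2 := eq_of_hasDerivWithinAt_zero (convex_Icc (-T) T)
      (f := fun τ => S (a τ) - S (V τ))
      (fun t ht => ((ha t ht).sub (hasDerivWithinAt_clm_comp S (hV t ht))).congr_deriv
        (sub_self _)) ht h0
    simp only [← map_sub] at h2
    rw [← hS h2]
    abel
  intro t ht
  exact ((hV t ht).add_const _).congr h1 (h1 t ht)

/-- The profile at time `t` of the free wave with position `f` and velocity `g` at time `t`. -/
def profile (t : ℝ) (f g : HalfL2) : HalfL2 × HalfL2 :=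
  (mulOp (cosM t) f - mulOp (sinM t) g, mulOp lapM (mulOp (sinM t) f) + mulOp (cosM t) g)

/-- The propagator is a two by two matrix of commuting multipliers with determinant `1` by
`cosM_sq_add`; `profile` is its adjugate. -/
theorem position_profile (t : ℝ) (f g : HalfL2) : position t (profile t f g) = f := by
  conv_rhs => rw [← cosM_sq_add t f]
  simp only [position_apply, profile, map_sub, map_add]
  rw [mulOp_comm (sinM t) lapM, mulOp_comm (sinM t) (cosM t)]
  abel

theorem speed_profile (t : ℝ) (f g : HalfL2) : speed t (profile t f g) = g := by
  conv_rhs => rw [← cosM_sq_add t g]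
  simp only [speed_apply, profile, map_sub, map_add]
  rw [mulOp_comm (cosM t) lapM, mulOp_comm (cosM t) (sinM t)]
  abel

theorem position_zero (x : HalfL2 × HalfL2) : position 0 x = x.1 := by
  have h1 : mulOp (cosM 0) x.1 = x.1 := by
    rw [mulOp_congr (n := 1) fun ξ _ => by simp [cosM_apply], mulOp_one]
  have h2 : mulOp (sinM 0) x.2 = 0 := by
    rw [mulOp_congr (n := 1 - 1) fun ξ hξ => by simp [sinM_apply 0 hξ], mulOp_sub, sub_self]
  rw [position_apply, h1, h2, add_zero]

theorem speed_zero (x : HalfL2 × HalfL2) : speed 0 x = x.2 := by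
  have h1 : mulOp (cosM 0) x.2 = x.2 := by
    rw [mulOp_congr (n := 1) fun ξ _ => by simp [cosM_apply], mulOp_one]
  have h2 : mulOp (sinM 0) x.1 = 0 := by
    rw [mulOp_congr (n := 1 - 1) fun ξ hξ => by simp [sinM_apply 0 hξ], mulOp_sub, sub_self]
  rw [speed_apply, h1, h2, map_zero, neg_zero, zero_add]

theorem profile_zero (f g : HalfL2) : profile 0 f g = (f, g) := by
  have h1 := position_profile 0 f g
  have h2 := speed_profile 0 f g
  rw [position_zero] at h1
  rw [speed_zero] at h2
  exact Prod.ext h1 h2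

/-- The first order system is known for `⟨ξ⟩⁻¹ f` and `⟨ξ⟩⁻¹ g` only. After undoing the free
evolution its linear terms cancel and the nonlinearity remains. -/
theorem hasDerivWithinAt_profile {ε T : ℝ} (hT : 0 < T) (hT1 : T ≤ 1) {M : HalfL2 → HalfL2}
    (hM : Continuous M) {f g : ℝ → HalfL2} (hf : ContinuousOn f (Icc (-T) T))
    (h1 : ∀ t ∈ Icc (-T) T,
      HasDerivWithinAt (fun τ => mulOp japInv (f τ)) (g t) (Icc (-T) T) t)
    (h2 : ∀ t ∈ Icc (-T) T, HasDerivWithinAt (fun τ => mulOp japInv (g τ))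
      (-mulOp lapM (f t) + (ε : ℂ) • mulOp japInv (M (f t))) (Icc (-T) T) t) :
    ∀ t ∈ Icc (-T) T, HasDerivWithinAt (fun τ => profile τ (f τ) (g τ))
      (profileField ε M t (profile t (f t) (g t))) (Icc (-T) T) t := by
  have hT' : Icc (-T) T ⊆ Icc (-1) 1 := Icc_subset_Icc (by linarith) hT1
  have hMf := hM.comp_continuousOn hf
  -- One factor `⟨ξ⟩⁻¹` makes `f` and `g` differentiable, the other makes the propagators
  -- differentiable.
  have hS : Function.Injective (mulOp japInv ∘L mulOp japInv) :=
    mulOp_japInv_injective.comp mulOp_japInv_injective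
  have hsin : ContinuousOn (fun t => mulOp (sinM t) (M (f t))) (Icc (-T) T) := fun t ht =>
    continuousWithinAt_mulOp_apply (C := 2) (fun τ hτ f => norm_mulOp_sinM_le (hT' hτ) f)
      continuous_mulOp_sinM (hMf t ht)
  have hcos : ContinuousOn (fun t => mulOp (cosM t) (M (f t))) (Icc (-T) T) := fun t ht =>
    continuousWithinAt_mulOp_apply (C := 1) (fun τ _ f => by simpa using norm_mulOp_cosM_le τ f)
      continuous_mulOp_cosM (hMf t ht)
  have ha := hasDerivWithinAt_of_injective hS hT
    (a := fun t => mulOp (cosM t) (f t) - mulOp (sinM t) (g t))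
    (v := fun t => -(ε : ℂ) • mulOp (sinM t) (M (f t))) (hsin.const_smul (-(ε : ℂ))) (fun t ht => by
      have := (HasDerivWithinAt.japInv_cosM (h1 t ht)).sub
        (HasDerivWithinAt.japInv_sinM (h2 t ht))
      refine (this.congr_deriv ?_).congr (fun τ _ => ?_) ?_
      · simp only [map_add, map_neg, map_smul, neg_smul, ContinuousLinearMap.comp_apply]
        rw [mulOp_comm (sinM t) japInv, mulOp_comm (cosM t) japInv, mulOp_comm (sinM t) lapM,
          mulOp_comm lapM japInv, mulOp_comm (sinM t) japInv]
        abel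
      all_goals
        simp only [map_sub, ContinuousLinearMap.comp_apply, Pi.sub_apply]
        rw [mulOp_comm (cosM _) japInv, mulOp_comm (sinM _) japInv])
  have hb := hasDerivWithinAt_of_injective hS hT
    (a := fun t => mulOp lapM (mulOp (sinM t) (f t)) + mulOp (cosM t) (g t))
    (v := fun t => (ε : ℂ) • mulOp (cosM t) (M (f t))) (hcos.const_smul (ε : ℂ)) (fun t ht => by
      have := (hasDerivWithinAt_clm_comp (mulOp lapM) (HasDerivWithinAt.japInv_sinM (h1 t ht))).add
        (HasDerivWithinAt.japInv_cosM (h2 t ht))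
      refine (this.congr_deriv ?_).congr (fun τ _ => ?_) ?_
      · simp only [map_add, map_neg, map_smul, ContinuousLinearMap.comp_apply]
        rw [mulOp_comm (sinM t) japInv, mulOp_comm (cosM t) japInv, mulOp_comm (cosM t) lapM,
          mulOp_comm lapM japInv, mulOp_comm lapM japInv, mulOp_comm (cosM t) japInv]
        abel
      all_goals
        simp only [map_add, ContinuousLinearMap.comp_apply, Pi.add_apply]
        rw [mulOp_comm (sinM _) japInv, mulOp_comm (cosM _) japInv, mulOp_comm lapM japInv,
          mulOp_comm lapM japInv])
  intro t ht
  have h3 := (ha t ht).prodMk (hb t ht)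
  refine h3.congr_deriv ?_
  rw [profileField, position_profile]

/-! ### Slices of test functions -/

theorem lineDerivOp_testFunction_apply {T : ℝ} (φ : 𝓓(slab T, ℂ)) (v x : ℝ × ℝ) :
    (∂_{v} φ) x = fderiv ℝ φ x v := by
  rw [TestFunction.lineDerivOp_eq_lineDerivCLM ℝ, TestFunction.lineDerivCLM_apply_of_le le_top]
  exact ((φ.contDiff.differentiable (by simp)) x).lineDeriv_eq_fderiv

theorem lineDerivOp_testFunction_comm {T : ℝ} (φ : 𝓓(slab T, ℂ)) (v w : ℝ × ℝ) :
    ∂_{v} (∂_{w} φ) = ∂_{w} (∂_{v} φ) := by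
  have key : ∀ v w x, (∂_{v} (∂_{w} φ)) x = fderiv ℝ (fderiv ℝ φ) x v w := by
    intro v w x
    have hd : DifferentiableAt ℝ (fderiv ℝ φ) x :=
      ((φ.contDiff.fderiv_right (m := 1) (by norm_cast)).differentiable (by simp)) x
    rw [lineDerivOp_testFunction_apply,
      funext fun y => lineDerivOp_testFunction_apply φ w y, fderiv_clm_apply hd (by simp)]
    simp
  ext x
  rw [key, key]
  refine (ContDiffAt.isSymmSndFDerivAt (n := ∞) φ.contDiff.contDiffAt ?_).eq v w
  rw [minSmoothness_of_isRCLikeNormedField]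
  exact WithTop.coe_le_coe.2 le_top

theorem hasDerivAt_testFunction_fst {T : ℝ} (φ : 𝓓(slab T, ℂ)) (t x : ℝ) :
    HasDerivAt (fun τ => φ (τ, x)) ((∂_{((1, 0) : ℝ × ℝ)} φ) (t, x)) t := by
  rw [lineDerivOp_testFunction_apply]
  exact ((φ.contDiff.differentiable (by simp)) (t, x)).hasFDerivAt.comp_hasDerivAt t
    ((hasDerivAt_id t).prodMk (hasDerivAt_const t x))

theorem hasDerivAt_testFunction_snd {T : ℝ} (φ : 𝓓(slab T, ℂ)) (t x : ℝ) :
    HasDerivAt (fun y => φ (t, y)) ((∂_{((0, 1) : ℝ × ℝ)} φ) (t, x)) x := by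
  rw [lineDerivOp_testFunction_apply]
  exact ((φ.contDiff.differentiable (by simp)) (t, x)).hasFDerivAt.comp_hasDerivAt x
    ((hasDerivAt_const x t).prodMk (hasDerivAt_id x))

theorem slice_lineDerivOp_snd {T : ℝ} (φ : 𝓓(slab T, ℂ)) (t : ℝ) :
    slice (∂_{((0, 1) : ℝ × ℝ)} φ) t = ∂_{(1 : ℝ)} (slice φ t) := by
  ext x
  rw [SchwartzMap.lineDerivOp_apply_eq_fderiv, fderiv_apply_one_eq_deriv, slice_apply]
  exact (hasDerivAt_testFunction_snd φ t x).deriv.symm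

theorem iteratedDeriv_slice {T : ℝ} (n : ℕ) (φ : 𝓓(slab T, ℂ)) (t : ℝ) :
    iteratedDeriv n (slice φ t) = slice ((fun χ => ∂_{((0, 1) : ℝ × ℝ)} χ)^[n] φ) t := by
  induction n generalizing φ with
  | zero => rfl
  | succ n ih =>
    rw [iteratedDeriv_succ', Function.iterate_succ_apply, ← ih]
    congr 1
    ext x
    exact (hasDerivAt_testFunction_snd φ t x).deriv

theorem iterate_lineDerivOp_comm {T : ℝ} (n : ℕ) (φ : 𝓓(slab T, ℂ)) (v w : ℝ × ℝ) :
    (fun χ : 𝓓(slab T, ℂ) => ∂_{w} χ)^[n] (∂_{v} φ) = ∂_{v} ((fun χ => ∂_{w} χ)^[n] φ) := by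
  induction n generalizing φ with
  | zero => rfl
  | succ n ih =>
    rw [Function.iterate_succ_apply, Function.iterate_succ_apply, ← ih,
      lineDerivOp_testFunction_comm]

theorem exists_pow_mul_norm_testFunction_le {T : ℝ} (k : ℕ) (φ : 𝓓(slab T, ℂ)) :
    ∃ C : ℝ, ∀ t x : ℝ, |x| ^ k * ‖φ (t, x)‖ ≤ C := by
  have h1 : HasCompactSupport fun y : ℝ × ℝ => |y.2| ^ k * ‖φ y‖ := φ.hasCompactSupport.norm.mul_left
  have h2 : Continuous fun y : ℝ × ℝ => |y.2| ^ k * ‖φ y‖ := by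
    have := φ.continuous
    fun_prop
  obtain ⟨C, hC⟩ := h1.exists_bound_of_continuous h2
  exact ⟨C, fun t x => (le_abs_self _).trans (hC (t, x))⟩

/-- The mean value inequality on the segment between `t` and `τ`, applied to `f σ - (σ - t) f' t`.
-/
theorem norm_taylor_one_le {E : Type*} [NormedAddCommGroup E] [NormedSpace ℝ E] {f f' f'' : ℝ → E}
    {C : ℝ} (h : ∀ t, HasDerivAt f (f' t) t) (h' : ∀ t, HasDerivAt f' (f'' t) t)
    (hC : ∀ t, ‖f'' t‖ ≤ C) (t τ : ℝ) : ‖f τ - f t - (τ - t) • f' t‖ ≤ C * |τ - t| ^ 2 := by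
  have h1 : ∀ σ ∈ uIcc t τ, ‖f' σ - f' t‖ ≤ C * |τ - t| := fun σ hσ => by
    refine (norm_sub_le_of_hasDerivAt h' hC t σ).trans ?_
    have : 0 ≤ C := (norm_nonneg _).trans (hC 0)
    exact mul_le_mul_of_nonneg_left (abs_sub_left_of_mem_uIcc hσ) this
  have h2 : ∀ σ ∈ uIcc t τ,
      HasDerivWithinAt (fun σ => f σ - (σ - t) • f' t) (f' σ - f' t) (uIcc t τ) σ := fun σ _ => by
    have := ((hasDerivAt_id σ).sub_const t).smul_const (f' t)
    exact ((h σ).sub this).hasDerivWithinAt.congr_deriv (by simp)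
  have h3 := (convex_uIcc t τ).norm_image_sub_le_of_norm_hasDerivWithin_le h2 h1 left_mem_uIcc
    right_mem_uIcc
  rw [Real.norm_eq_abs, mul_assoc, ← sq] at h3
  simpa [sub_right_comm] using h3

theorem iteratedDeriv_schwartz_sub (n : ℕ) (a b : 𝓢(ℝ, ℂ)) (x : ℝ) :
    iteratedDeriv n (a - b : 𝓢(ℝ, ℂ)) x = iteratedDeriv n a x - iteratedDeriv n b x :=
  iteratedDeriv_sub (a.contDiffAt n) (b.contDiffAt n)

theorem iteratedDeriv_schwartz_smul (n : ℕ) (c : ℂ) (a : 𝓢(ℝ, ℂ)) (x : ℝ) :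
    iteratedDeriv n (c • a : 𝓢(ℝ, ℂ)) x = c • iteratedDeriv n a x :=
  iteratedDeriv_const_smul (a.contDiffAt n) c

/-- Time derivatives commute with `∂_x^n`. Taylor's formula in `t`, multiplied by `|x|^k`, has an
error of order `|τ - t|²` uniformly in `x`, since `∂_t² ∂_x^n φ` has compact support. Division by `τ
- t` leaves `C |τ - t|` in each Schwartz seminorm. -/
theorem tendsto_slope_slice {T : ℝ} (φ : 𝓓(slab T, ℂ)) (t : ℝ) :
    Tendsto (fun τ : ℝ => ((τ - t)⁻¹ : ℂ) • (slice φ τ - slice φ t)) (𝓝[≠] t)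
      (𝓝 (slice (∂_{((1, 0) : ℝ × ℝ)} φ) t)) := by
  rw [(schwartz_withSeminorms ℂ ℝ ℂ).tendsto_nhds]
  rintro ⟨k, n⟩ δ hδ
  set D := fun χ : 𝓓(slab T, ℂ) => ∂_{((0, 1) : ℝ × ℝ)} χ
  set D' := fun χ : 𝓓(slab T, ℂ) => ∂_{((1, 0) : ℝ × ℝ)} χ
  obtain ⟨C, hC⟩ := exists_pow_mul_norm_testFunction_le k (D' (D' (D^[n] φ)))
  have hC0 : 0 ≤ C := (mul_nonneg (by positivity) (norm_nonneg _)).trans (hC 0 0)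
  have key : ∀ τ ≠ t, SchwartzMap.seminorm ℂ k n
      (((τ - t)⁻¹ : ℂ) • (slice φ τ - slice φ t) - slice (D' φ) t) ≤ C * |τ - t| := by
    intro τ hτ
    have hτ' : τ - t ≠ 0 := sub_ne_zero.2 hτ
    have e : ((τ - t)⁻¹ : ℂ) • (slice φ τ - slice φ t) - slice (D' φ) t =
        ((τ - t)⁻¹ : ℂ) • (slice φ τ - slice φ t - ((τ - t : ℝ) : ℂ) • slice (D' φ) t) := by
      rw [smul_sub _ _ (((τ - t : ℝ) : ℂ) • slice (D' φ) t), smul_smul]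
      rw [← Complex.ofReal_sub, inv_mul_cancel₀ (by exact_mod_cast hτ'), one_smul]
    rw [e, map_smul_eq_mul, norm_inv, ← Complex.ofReal_sub, Complex.norm_real, Real.norm_eq_abs,
      inv_mul_le_iff₀ (abs_pos.2 hτ')]
    refine SchwartzMap.seminorm_le_bound' ℂ k n _ (by positivity) fun x => ?_
    rw [iteratedDeriv_schwartz_sub, iteratedDeriv_schwartz_sub, iteratedDeriv_schwartz_smul,
      iteratedDeriv_slice, iteratedDeriv_slice, iteratedDeriv_slice, iterate_lineDerivOp_comm]
    have h1 := norm_taylor_one_le (f := fun τ => (|x| ^ k) • (D^[n] φ) (τ, x))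
      (fun t => (hasDerivAt_testFunction_fst (D^[n] φ) t x).const_smul (|x| ^ k))
      (fun t => (hasDerivAt_testFunction_fst (D' (D^[n] φ)) t x).const_smul (|x| ^ k))
      (C := C) (fun t => by
        rw [norm_smul, Real.norm_of_nonneg (by positivity)]; exact hC t x) t τ
    rw [smul_comm (τ - t), ← smul_sub, ← smul_sub, norm_smul, Real.norm_of_nonneg (by positivity),
      ← Complex.coe_smul] at h1
    refine h1.trans_eq (by ring)
  have h2 : Tendsto (fun τ => C * |τ - t|) (𝓝[≠] t) (𝓝 0) := by
    have : Continuous fun τ => C * |τ - t| := by fun_prop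
    simpa using (this.tendsto t).mono_left nhdsWithin_le_nhds
  filter_upwards [h2.eventually_lt_const hδ, self_mem_nhdsWithin] with τ h3 h4
  exact (key τ h4).trans_lt h3

/-- A test function is differentiable as a curve of Schwartz functions. -/
theorem hasDerivAt_clm_slice {E : Type*} [NormedAddCommGroup E] [NormedSpace ℂ E] {T : ℝ}
    (S : 𝓢(ℝ, ℂ) →L[ℂ] E) (φ : 𝓓(slab T, ℂ)) (t : ℝ) :
    HasDerivAt (fun τ => S (slice φ τ)) (S (slice (∂_{((1, 0) : ℝ × ℝ)} φ) t)) t := by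
  rw [hasDerivAt_iff_tendsto_slope]
  refine ((S.continuous.tendsto _).comp (tendsto_slope_slice φ t)).congr fun τ => ?_
  rw [Function.comp_apply, map_smul, map_sub, slope_def_module, ← Complex.ofReal_sub,
    ← Complex.ofReal_inv, Complex.coe_smul]

theorem slice_eq_zero {T : ℝ} (φ : 𝓓(slab T, ℂ)) {t : ℝ} (ht : t ∉ Ioo (-T) T) : slice φ t = 0 := by
  ext x
  rw [slice_apply]
  exact image_eq_zero_of_notMem_tsupport fun h => ht (φ.tsupport_subset h).1

/-! ### The pairing of `H^s_Γ` with test functions, in `L²(0, ∞)` -/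

/-- The bilinear pairing `∫ z w` on `L²(0, ∞)`. -/
def pairing : HalfL2 →L[ℂ] HalfL2 →L[ℂ] ℂ := (ContinuousLinearMap.mul ℂ ℂ).lpPairing halfLine 2 2

theorem pairing_apply (z w : HalfL2) : pairing z w = ∫ ξ in Ioi 0, z ξ * w ξ :=
  (ContinuousLinearMap.mul ℂ ℂ).lpPairing_eq_integral z w

/-- The restriction of `⟨ξ⟩^r 𝓕⁻¹ ψ` to the half line. -/
def testToL2 (r : ℝ) : 𝓢(ℝ, ℂ) →L[ℂ] HalfL2 :=
  SchwartzMap.toLpCLM ℂ ℂ 2 halfLine ∘L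
    SchwartzMap.smulLeftCLM ℂ (fun ξ => (jap r ξ : ℂ)) ∘L FourierTransform.fourierInvCLM ℂ 𝓢(ℝ, ℂ)

theorem coeFn_testToL2 (r : ℝ) (ψ : 𝓢(ℝ, ℂ)) :
    testToL2 r ψ =ᵐ[halfLine] fun ξ => jap r ξ * (𝓕⁻ ψ : 𝓢(ℝ, ℂ)) ξ := by
  have h := SchwartzMap.coeFn_toLp (SchwartzMap.smulLeftCLM ℂ (fun ξ => (jap r ξ : ℂ))
    (𝓕⁻ ψ : 𝓢(ℝ, ℂ))) 2 halfLine
  filter_upwards [h] with ξ hξ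
  rw [← smul_eq_mul, ← SchwartzMap.smulLeftCLM_apply_apply (jap_hasTemperateGrowth r)]
  exact hξ

theorem pairing_testToL2 (z : HalfL2) (r : ℝ) (ψ : 𝓢(ℝ, ℂ)) :
    pairing z (testToL2 r ψ) = ∫ ξ in Ioi 0, z ξ * (jap r ξ * (𝓕⁻ ψ : 𝓢(ℝ, ℂ)) ξ) := by
  rw [pairing_apply]
  refine integral_congr_ae ?_
  filter_upwards [coeFn_testToL2 r ψ] with ξ h
  rw [h]

/-- All terms of the equation are read in `H^{s-2}`, where `∂_x² u` lives, hence the weight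
`⟨ξ⟩^{2-s}` on the test function. Elements of `H^{s-1}` and `H^s` acquire one and two factors
`⟨ξ⟩⁻¹`. -/
theorem toDist_fromL2_sub_one (s : ℝ) (z : HalfL2) (ψ : 𝓢(ℝ, ℂ)) :
    HGamma.toDist (fromL2 (s - 1) z) ψ = pairing (mulOp japInv z) (testToL2 (2 - s) ψ) := by
  rw [toDist_fromL2_apply, pairing_testToL2]
  refine integral_congr_ae ?_
  filter_upwards [coeFn_mulOp japInv z] with ξ h
  rw [h, japInv_apply, show -(s - 1) = -1 + (2 - s) by ring, jap_add]
  push_cast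
  ring

theorem toDist_fromL2_eq_pairing (s : ℝ) (z : HalfL2) (ψ : 𝓢(ℝ, ℂ)) :
    HGamma.toDist (fromL2 s z) ψ =
      pairing (mulOp japInv (mulOp japInv z)) (testToL2 (2 - s) ψ) := by
  rw [toDist_fromL2_apply, pairing_testToL2]
  refine integral_congr_ae ?_
  filter_upwards [coeFn_mulOp japInv (mulOp japInv z), coeFn_mulOp japInv z] with ξ h h'
  rw [h, h', japInv_apply, show -s = -1 + -1 + (2 - s) by ring, jap_add, jap_add]
  push_cast
  ring

theorem incl_fromL2 (s : ℝ) (z : HalfL2) :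
    HGamma.incl (fromL2 s z) = fromL2 (s - 1) (mulOp japInv z) := by
  apply HGamma.toDist_injective
  ext ψ
  rw [HGamma.toDist_incl, toDist_fromL2_eq_pairing, toDist_fromL2_sub_one]

theorem fourierInv_lineDerivOp_apply (ψ : 𝓢(ℝ, ℂ)) (ξ : ℝ) :
    (𝓕⁻ (∂_{(1 : ℝ)} ψ) : 𝓢(ℝ, ℂ)) ξ = -(2 * Real.pi * Complex.I * ξ) * (𝓕⁻ ψ : 𝓢(ℝ, ℂ)) ξ := by
  rw [SchwartzMap.fourierInv_lineDerivOp_eq, smul_apply,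
    SchwartzMap.smulLeftCLM_apply_apply (by fun_prop)]
  simp
  ring

theorem pairing_laplacian (s : ℝ) (z : HalfL2) (ψ : 𝓢(ℝ, ℂ)) :
    pairing (mulOp japInv (mulOp japInv z)) (testToL2 (2 - s) (∂_{(1 : ℝ)} (∂_{(1 : ℝ)} ψ))) =
      -pairing (mulOp lapM z) (testToL2 (2 - s) ψ) := by
  rw [pairing_testToL2, pairing_testToL2, ← integral_neg]
  refine integral_congr_ae ?_
  filter_upwards [coeFn_mulOp japInv (mulOp japInv z), coeFn_mulOp japInv z, coeFn_mulOp lapM z]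
    with ξ h h' h''
  rw [h, h', h'', japInv_apply, lapM_apply, fourierInv_lineDerivOp_apply,
    fourierInv_lineDerivOp_apply, ← jap_neg_one_mul_self]
  push_cast
  linear_combination (jap (-1) ξ) ^ 2 * z ξ * jap (2 - s) ξ * (2 * Real.pi * ξ) ^ 2 *
    (𝓕⁻ ψ : 𝓢(ℝ, ℂ)) ξ * Complex.I_sq

theorem slice_waveOp {T : ℝ} (φ : 𝓓(slab T, ℂ)) (t : ℝ) : slice (waveOp φ) t =
    slice (∂_{((1, 0) : ℝ × ℝ)} (∂_{((1, 0) : ℝ × ℝ)} φ)) t - ∂_{(1 : ℝ)} (∂_{(1 : ℝ)} (slice φ t)) := by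
  rw [← slice_lineDerivOp_snd, ← slice_lineDerivOp_snd]
  rfl

/-- Puts the integrand of the weak equation into the form `⟨h, ∂_t² φ⟩ - ⟨r, φ⟩`, with `h = ⟨ξ⟩^{-2}
f` and `r` the acceleration: the equation says `h'' = r` weakly. -/
theorem toDist_slice_waveOp_sub (s ε : ℝ) (f n : HalfL2) {T : ℝ} (φ : 𝓓(slab T, ℂ)) (t : ℝ) :
    HGamma.toDist (fromL2 s f) (slice (waveOp φ) t) -
        (ε : ℂ) * HGamma.toDist (fromL2 (s - 1) n) (slice φ t) =
      pairing (mulOp japInv (mulOp japInv f))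
        (testToL2 (2 - s) (slice (∂_{((1, 0) : ℝ × ℝ)} (∂_{((1, 0) : ℝ × ℝ)} φ)) t)) -
      pairing (-mulOp lapM f + (ε : ℂ) • mulOp japInv n) (testToL2 (2 - s) (slice φ t)) := by
  rw [slice_waveOp, map_sub, toDist_fromL2_eq_pairing, toDist_fromL2_eq_pairing, pairing_laplacian,
    toDist_fromL2_sub_one]
  simp only [map_add, map_neg, map_smul, add_apply,
    neg_apply, smul_apply, smul_eq_mul]
  ring

/-! ### The weak form of the equation -/

theorem hasDerivWithinAt_pairing {z w : ℝ → HalfL2} {z' w' : HalfL2} {A : Set ℝ} {t : ℝ}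
    (hz : HasDerivWithinAt z z' A t) (hw : HasDerivWithinAt w w' A t) :
    HasDerivWithinAt (fun τ => pairing (z τ) (w τ)) (pairing (z t) w' + pairing z' (w t)) A t :=
  (pairing.bilinearRestrictScalars ℝ).hasDerivWithinAt_of_bilinear hz hw

theorem continuousOn_pairing {z w : ℝ → HalfL2} {A : Set ℝ} (hz : ContinuousOn z A)
    (hw : ContinuousOn w A) : ContinuousOn (fun t => pairing (z t) (w t)) A :=
  (pairing.continuous.comp_continuousOn hz).clm_apply hw

theorem continuous_clm_slice {E : Type*} [NormedAddCommGroup E] [NormedSpace ℂ E] {T : ℝ}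
    (S : 𝓢(ℝ, ℂ) →L[ℂ] E) (φ : 𝓓(slab T, ℂ)) : Continuous fun t => S (slice φ t) :=
  continuous_iff_continuousAt.2 fun t => (hasDerivAt_clm_slice S φ t).continuousAt

theorem integral_Ioo_eq_sub {E : Type*} [NormedAddCommGroup E] [NormedSpace ℝ E] [CompleteSpace E]
    {T : ℝ} (hT : 0 < T) {B B' : ℝ → E}
    (h : ∀ t ∈ Icc (-T) T, HasDerivWithinAt B (B' t) (Icc (-T) T) t)
    (hc : ContinuousOn B' (Icc (-T) T)) : ∫ t in Ioo (-T) T, B' t = B T - B (-T) := by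
  have hle : -T ≤ T := by linarith
  rw [← integral_Ioc_eq_integral_Ioo, ← intervalIntegral.integral_of_le hle]
  exact intervalIntegral.integral_eq_sub_of_hasDerivAt_of_le hle
    (fun t ht => (h t ht).continuousWithinAt)
    (fun t ht => (h t (Ioo_subset_Icc_self ht)).hasDerivAt (Icc_mem_nhds ht.1 ht.2))
    (hc.intervalIntegrable_of_Icc hle)

/-- Two integrations by parts at once: the integrand is the derivative of `⟨h, ∂_t φ⟩ - ⟨k, φ⟩`,
which vanishes at `±T`. -/
theorem integral_pairing_slice_eq_zero {T : ℝ} (hT : 0 < T) {h k r : ℝ → HalfL2}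
    (hh : ∀ t ∈ Icc (-T) T, HasDerivWithinAt h (k t) (Icc (-T) T) t)
    (hk : ∀ t ∈ Icc (-T) T, HasDerivWithinAt k (r t) (Icc (-T) T) t)
    (hr : ContinuousOn r (Icc (-T) T)) (S : 𝓢(ℝ, ℂ) →L[ℂ] HalfL2) (φ : 𝓓(slab T, ℂ)) :
    ∫ t in Ioo (-T) T, (pairing (h t)
      (S (slice (∂_{((1, 0) : ℝ × ℝ)} (∂_{((1, 0) : ℝ × ℝ)} φ)) t)) - pairing (r t) (S (slice φ t))) =
      0 := by
  set φ' := ∂_{((1, 0) : ℝ × ℝ)} φ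
  have hq := fun t => (hasDerivAt_clm_slice S φ t).hasDerivWithinAt (s := Icc (-T) T)
  have hq' := fun t => (hasDerivAt_clm_slice S φ' t).hasDerivWithinAt (s := Icc (-T) T)
  have hhc : ContinuousOn h (Icc (-T) T) := fun t ht => (hh t ht).continuousWithinAt
  rw [integral_Ioo_eq_sub hT (B := fun t => pairing (h t) (S (slice φ' t)) -
    pairing (k t) (S (slice φ t)))]
  · have h1 : ∀ χ : 𝓓(slab T, ℂ), slice χ T = 0 ∧ slice χ (-T) = 0 := fun χ =>
      ⟨slice_eq_zero χ (by simp), slice_eq_zero χ (by simp)⟩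
    simp [h1]
  · intro t ht
    refine ((hasDerivWithinAt_pairing (hh t ht) (hq' t)).sub
      (hasDerivWithinAt_pairing (hk t ht) (hq t))).congr_deriv ?_
    abel
  · exact (continuousOn_pairing hhc (continuous_clm_slice S _).continuousOn).sub
      (continuousOn_pairing hr (continuous_clm_slice S _).continuousOn)

/-! ### Density of the compactly supported functions -/

/-- The derivatives of `1 - χ` are bounded and vanish where `|y| < 1`; elsewhere the factor `|y|` is
at least `1`. At `y = c x` this factor produces the small parameter `c`. -/
theorem exists_norm_iteratedDeriv_one_sub_le (χ : 𝓢(ℝ, ℂ)) (h : ∀ y, |y| ≤ 1 → χ y = 1) (i : ℕ) :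
    ∃ B : ℝ, ∀ y, ‖iteratedDeriv i (fun y => 1 - χ y) y‖ ≤ B * |y| := by
  have hc : ContDiff ℝ i fun y => 1 - χ y := contDiff_const.sub (χ.smooth i)
  have h1 : ∀ y, ‖iteratedDeriv i (fun y => 1 - χ y) y‖ ≤ 1 + SchwartzMap.seminorm ℂ 0 i χ := by
    intro y
    have e : iteratedDeriv i (fun y => 1 - χ y) y =
        iteratedDeriv i (fun _ => (1 : ℂ)) y - iteratedDeriv i χ y :=
      iteratedDeriv_sub contDiffAt_const (χ.contDiffAt i)
    rw [e, iteratedDeriv_const]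
    refine (norm_sub_le _ _).trans (add_le_add ?_ ?_)
    · split_ifs <;> simp
    · simpa using SchwartzMap.le_seminorm' ℂ 0 i χ y
  refine ⟨1 + SchwartzMap.seminorm ℂ 0 i χ, fun y => ?_⟩
  rcases lt_or_ge |y| 1 with hy | hy
  · have h2 : (fun y => 1 - χ y) =ᶠ[𝓝 y] fun _ => 0 := by
      filter_upwards [continuous_abs.continuousAt.eventually_lt continuousAt_const hy] with x hx
      rw [h x hx.le, sub_self]
    rw [h2.iteratedDeriv_eq, iteratedDeriv_const]
    have : 0 ≤ SchwartzMap.seminorm ℂ 0 i χ := apply_nonneg _ _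
    simp only [ite_self, norm_zero]
    positivity
  · refine (h1 y).trans (le_mul_of_one_le_right ?_ hy)
    have : 0 ≤ SchwartzMap.seminorm ℂ 0 i χ := apply_nonneg _ _
    positivity

/-- Leibniz' rule for `(1 - χ(c x)) ψ(x)`: every term carries a factor `c |x|`, and the extra `|x|`
is absorbed by the seminorms of order `k + 1` of `ψ`. -/
theorem exists_seminorm_sub_cutoff_le (χ : 𝓢(ℝ, ℂ)) (h : ∀ y, |y| ≤ 1 → χ y = 1) (ψ : 𝓢(ℝ, ℂ))
    (k n : ℕ) : ∃ C : ℝ, ∀ c : ℝ, 0 ≤ c → c ≤ 1 → ∀ ψ' : 𝓢(ℝ, ℂ), (∀ x, ψ' x = χ (c * x) * ψ x) →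
      SchwartzMap.seminorm ℂ k n (ψ' - ψ) ≤ C * c := by
  choose B hB using exists_norm_iteratedDeriv_one_sub_le χ h
  have hB0 : ∀ i, 0 ≤ B i := fun i => by simpa using (norm_nonneg _).trans (hB i 1)
  refine ⟨∑ i ∈ Finset.range (n + 1), n.choose i * B i * SchwartzMap.seminorm ℂ (k + 1) (n - i) ψ,
    fun c hc hc1 ψ' hψ' => ?_⟩
  have hS : ∀ i, 0 ≤ SchwartzMap.seminorm ℂ (k + 1) (n - i) ψ := fun i => apply_nonneg _ _
  refine SchwartzMap.seminorm_le_bound ℂ k n _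
    (mul_nonneg (Finset.sum_nonneg fun i _ => by have := hB0 i; have := hS i; positivity) hc)
    fun x => ?_
  have e : ⇑(ψ' - ψ) = -fun x => (1 - χ (c * x)) * ψ x := by
    ext x
    rw [sub_apply, hψ', Pi.neg_apply]
    ring
  have hω : ContDiff ℝ ∞ fun x => 1 - χ x := contDiff_const.sub (χ.smooth ⊤)
  have hω' : ContDiff ℝ ∞ fun x => 1 - χ (c * x) := by
    have := hω.comp (contDiff_const.mul contDiff_id : ContDiff ℝ ∞ fun x : ℝ => c * x)
    exact this
  rw [e, iteratedFDeriv_neg_apply, norm_neg]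
  have h1 := norm_iteratedFDeriv_mul_le (n := n) hω' (ψ.smooth ⊤) x (by exact_mod_cast le_top)
  refine (mul_le_mul_of_nonneg_left h1 (by positivity)).trans ?_
  rw [Finset.mul_sum, Finset.sum_mul]
  refine Finset.sum_le_sum fun i _ => ?_
  have h2 : ‖iteratedFDeriv ℝ i (fun x => 1 - χ (c * x)) x‖ ≤ B i * c * ‖x‖ := by
    rw [norm_iteratedFDeriv_eq_norm_iteratedDeriv,
      iteratedDeriv_comp_const_smul (f := fun y => 1 - χ y) (hω.of_le (by exact_mod_cast le_top)) c,
      norm_smul, norm_pow,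
      Real.norm_of_nonneg hc]
    refine (mul_le_of_le_one_left (norm_nonneg _) (pow_le_one₀ hc hc1)).trans ?_
    refine (hB i (c * x)).trans_eq ?_
    rw [abs_mul, abs_of_nonneg hc, Real.norm_eq_abs]
    ring
  have h3 := SchwartzMap.le_seminorm ℂ (k + 1) (n - i) ψ x
  calc ‖x‖ ^ k * (n.choose i * ‖iteratedFDeriv ℝ i (fun x => 1 - χ (c * x)) x‖ *
        ‖iteratedFDeriv ℝ (n - i) ψ x‖) ≤
      ‖x‖ ^ k * (n.choose i * (B i * c * ‖x‖) * ‖iteratedFDeriv ℝ (n - i) ψ x‖) := by gcongr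
    _ = n.choose i * B i * c * (‖x‖ ^ (k + 1) * ‖iteratedFDeriv ℝ (n - i) ψ x‖) := by ring
    _ ≤ n.choose i * B i * c * SchwartzMap.seminorm ℂ (k + 1) (n - i) ψ := by
        have := hB0 i
        gcongr
    _ = _ := by ring

theorem exists_schwartz_cutoff :
    ∃ χ : 𝓢(ℝ, ℂ), HasCompactSupport χ ∧ ∀ y, |y| ≤ 1 → χ y = 1 := by
  let b : ContDiffBump (0 : ℝ) := ⟨1, 2, one_pos, one_lt_two⟩
  have hbc : HasCompactSupport fun x => (b x : ℂ) := b.hasCompactSupport.comp_left Complex.ofReal_zero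
  have hbs : ContDiff ℝ ∞ fun x => (b x : ℂ) := Complex.ofRealCLM.contDiff.comp b.contDiff
  refine ⟨hbc.toSchwartzMap hbs, hbc, fun y hy => ?_⟩
  rw [HasCompactSupport.toSchwartzMap_toFun, b.one_of_mem_closedBall (by simpa using hy),
    Complex.ofReal_one]

/-- A continuous linear map on the Schwartz space which vanishes on the compactly supported
functions is zero. -/
theorem clm_eq_zero_of_hasCompactSupport {E : Type*} [NormedAddCommGroup E] [NormedSpace ℂ E]
    (S : 𝓢(ℝ, ℂ) →L[ℂ] E) (hS : ∀ ψ : 𝓢(ℝ, ℂ), HasCompactSupport ψ → S ψ = 0) (ψ : 𝓢(ℝ, ℂ)) :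
    S ψ = 0 := by
  obtain ⟨χ, hχc, hχ⟩ := exists_schwartz_cutoff
  have hex : ∀ N : ℕ, ∃ ψ' : 𝓢(ℝ, ℂ), HasCompactSupport ψ' ∧
      ∀ x, ψ' x = χ ((N + 1 : ℝ)⁻¹ * x) * ψ x := by
    intro N
    have hcs : HasCompactSupport fun x => χ ((N + 1 : ℝ)⁻¹ * x) * ψ x :=
      (hχc.comp_homeomorph (Homeomorph.mulLeft₀ (N + 1 : ℝ)⁻¹ (by positivity))).mul_right
    have hsm : ContDiff ℝ ∞ fun x => χ ((N + 1 : ℝ)⁻¹ * x) * ψ x :=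
      ((χ.smooth ⊤).comp
        (contDiff_const.mul contDiff_id : ContDiff ℝ ∞ fun x : ℝ => (N + 1 : ℝ)⁻¹ * x)).mul
        (ψ.smooth ⊤)
    exact ⟨hcs.toSchwartzMap hsm, hcs, fun x => rfl⟩
  choose ψ' h1 h2 using hex
  have hlim : Tendsto ψ' atTop (𝓝 ψ) := by
    rw [(schwartz_withSeminorms ℂ ℝ ℂ).tendsto_nhds]
    rintro ⟨k, n⟩ δ hδ
    obtain ⟨C, hC⟩ := exists_seminorm_sub_cutoff_le χ hχ ψ k n
    have h3 : Tendsto (fun N : ℕ => C * (N + 1 : ℝ)⁻¹) atTop (𝓝 0) := by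
      simpa [one_div] using (tendsto_one_div_add_atTop_nhds_zero_nat (𝕜 := ℝ)).const_mul C
    filter_upwards [h3.eventually_lt_const hδ] with N hN
    exact (hC (N + 1 : ℝ)⁻¹ (by positivity) (inv_le_one_of_one_le₀ (by simp)) _ (h2 N)).trans_lt hN
  refine tendsto_nhds_unique ((S.continuous.tendsto ψ).comp hlim) ?_
  exact tendsto_const_nhds.congr fun N => (hS _ (h1 N)).symm

/-! ### From the weak form to the strong form of the equation -/

/-- The primitive from `a` vanishes before the support of `ζ`, and after it because the total
integral is zero. -/
theorem exists_contDiff_primitive_of_integral_eq_zero {a b : ℝ} {ζ : ℝ → ℝ} (hζ : ContDiff ℝ ∞ ζ)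
    (hc : HasCompactSupport ζ) (hs : tsupport ζ ⊆ Ioo a b) (h0 : ∫ t, ζ t = 0) :
    ∃ η : ℝ → ℝ, ContDiff ℝ ∞ η ∧ HasCompactSupport η ∧ tsupport η ⊆ Ioo a b ∧ deriv η = ζ := by
  rcases (tsupport ζ).eq_empty_or_nonempty with he | hne
  · have : ζ = 0 := by
      rw [tsupport_eq_empty_iff] at he
      exact he
    refine ⟨0, contDiff_const, HasCompactSupport.zero, ?_, ?_⟩
    · rw [tsupport_eq_empty_iff.2 rfl]; exact empty_subset _
    · rw [this]; ext x; simp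
  obtain ⟨c, hcm, hcl⟩ := hc.isCompact.exists_isLeast hne
  obtain ⟨d, hdm, hdl⟩ := hc.isCompact.exists_isGreatest hne
  have hz1 : ∀ t < c, ζ t = 0 := fun t ht =>
    image_eq_zero_of_notMem_tsupport fun h => (hcl h).not_gt ht
  have hz2 : ∀ t, d < t → ζ t = 0 := fun t ht =>
    image_eq_zero_of_notMem_tsupport fun h => (hdl h).not_gt ht
  have hca := (hs hcm).1
  have hdb := (hs hdm).2
  have hη : ∀ t, HasDerivAt (fun t => ∫ τ in a..t, ζ τ) (ζ t) t := fun t =>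
    intervalIntegral.integral_hasDerivAt_right (hζ.continuous.intervalIntegrable _ _)
      (hζ.continuous.stronglyMeasurableAtFilter _ _) hζ.continuous.continuousAt
  have hd : deriv (fun t => ∫ τ in a..t, ζ τ) = ζ := funext fun t => (hη t).deriv
  have hsupp : tsupport (fun t => ∫ τ in a..t, ζ τ) ⊆ Icc c d := by
    refine closure_minimal (fun t ht => ?_) isClosed_Icc
    by_contra hn
    refine ht ?_
    rcases lt_or_ge t c with h | h
    · refine (intervalIntegral.integral_congr (g := fun _ => 0) fun τ hτ => ?_).trans (by simp)
      exact hz1 τ (hτ.2.trans_lt (max_lt hca h))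
    · have h' : d < t := not_le.1 fun h' => hn ⟨h, h'⟩
      change ∫ τ in a..t, ζ τ = 0
      rw [intervalIntegral.integral_eq_integral_of_support_subset, h0]
      intro τ hτ
      have h3 := subset_tsupport ζ hτ
      exact ⟨hca.trans_le (hcl h3), (hdl h3).trans h'.le⟩
  refine ⟨_, ?_, isCompact_Icc.of_isClosed_subset isClosed_closure hsupp,
    hsupp.trans fun t ht => ⟨hca.trans_le ht.1, ht.2.trans_lt hdb⟩, hd⟩
  rw [contDiff_infty_iff_deriv, hd]
  exact ⟨fun t => (hη t).differentiableAt, hζ⟩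

/-- The lemma of du Bois-Reymond. -/
theorem eqOn_const_of_integral_deriv_smul_eq_zero {T : ℝ} (hT : 0 < T) {Y : ℝ → ℂ}
    (hY : ContinuousOn Y (Icc (-T) T))
    (h : ∀ θ : ℝ → ℝ, ContDiff ℝ ∞ θ → HasCompactSupport θ → tsupport θ ⊆ Ioo (-T) T →
      ∫ t in Ioo (-T) T, deriv θ t • Y t = 0) : ∃ c, EqOn Y (fun _ => c) (Icc (-T) T) := by
  let b : ContDiffBump (0 : ℝ) := ⟨T / 4, T / 2, by linarith, by linarith⟩
  set θ₀ := b.normed volume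
  have hθ₀ : ContDiff ℝ ∞ θ₀ := b.contDiff_normed
  have hθ₀c : HasCompactSupport θ₀ := b.hasCompactSupport_normed
  have hθ₀s : tsupport θ₀ ⊆ Ioo (-T) T := by
    rw [b.tsupport_normed_eq, Real.closedBall_eq_Icc]
    intro t ht
    have h1 : -(T / 2) ≤ t := by simpa using ht.1
    have h2 : t ≤ T / 2 := by simpa using ht.2
    constructor <;> linarith
  have hint : ∀ θ : ℝ → ℝ, Continuous θ → IntegrableOn (fun t => θ t • Y t) (Ioo (-T) T) :=
    fun θ hθ => ((hθ.continuousOn.smul hY).integrableOn_Icc).mono_set Ioo_subset_Icc_self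
  set c := ∫ t in Ioo (-T) T, θ₀ t • Y t
  have key : ∀ θ : ℝ → ℝ, ContDiff ℝ ∞ θ → HasCompactSupport θ → tsupport θ ⊆ Ioo (-T) T →
      ∫ t, θ t • (Ioo (-T) T).indicator (fun t => Y t - c) t = 0 := by
    intro θ hθ hθc hθs
    set m := ∫ t, θ t
    have hm : ∫ t in Ioo (-T) T, θ t = m :=
      setIntegral_eq_integral_of_forall_compl_eq_zero fun t ht =>
        image_eq_zero_of_notMem_tsupport fun h => ht (hθs h)
    -- With `m = ∫ θ` and `∫ θ₀ = 1`, the function `θ - m θ₀` has integral zero and is the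
    -- derivative of a test function. The hypothesis then reads `∫ θ (Y - c) = 0`.
    obtain ⟨η, h1, h2, h3, h4⟩ := exists_contDiff_primitive_of_integral_eq_zero
      (ζ := fun t => θ t - m * θ₀ t) (a := -T) (b := T) (hθ.sub (contDiff_const.mul hθ₀))
      (hθc.sub hθ₀c.mul_left)
      (closure_minimal (fun t ht => by
        by_contra hn
        simp only [mem_union, not_or] at hn
        refine ht ?_
        simp only
        rw [image_eq_zero_of_notMem_tsupport hn.1, image_eq_zero_of_notMem_tsupport hn.2]
        simp) ((isClosed_tsupport θ).union (isClosed_tsupport θ₀)) |>.trans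
          (union_subset hθs hθ₀s))
      (by
        rw [integral_sub (hθ.continuous.integrable_of_hasCompactSupport hθc)
          ((hθ₀.continuous.integrable_of_hasCompactSupport hθ₀c).const_mul m),
          integral_const_mul, b.integral_normed, mul_one, sub_self])
    have h5 := h η h1 h2 h3
    rw [h4] at h5
    have e1 : ∀ t, (θ t - m * θ₀ t) • Y t = θ t • Y t - m • (θ₀ t • Y t) := fun t => by
      rw [sub_smul, mul_smul]
    simp only [e1] at h5
    have i1 : IntegrableOn (fun t => m • (θ₀ t • Y t)) (Ioo (-T) T) :=
      (hint θ₀ hθ₀.continuous).smul m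
    rw [integral_sub (hint θ hθ.continuous) i1, integral_smul] at h5
    have e2 : ∀ t, θ t • (Ioo (-T) T).indicator (fun t => Y t - c) t =
        (Ioo (-T) T).indicator (fun t => θ t • Y t - θ t • c) t := fun t => by
      by_cases ht : t ∈ Ioo (-T) T <;> simp [ht, smul_sub]
    simp only [e2]
    rw [integral_indicator measurableSet_Ioo, integral_sub (hint θ hθ.continuous)
      ((hθ.continuous.integrable_of_hasCompactSupport hθc).integrableOn.smul_const c),
      integral_smul_const, hm]
    exact h5
  have hYc : ContinuousOn (fun t => Y t - c) (Icc (-T) T) := hY.sub continuousOn_const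
  have hloc : LocallyIntegrable ((Ioo (-T) T).indicator fun t => Y t - c) :=
    ((integrable_indicator_iff measurableSet_Ioo).2
      (hYc.integrableOn_Icc.mono_set Ioo_subset_Icc_self)).locallyIntegrable
  have hae := isOpen_Ioo.ae_eq_zero_of_integral_contDiff_smul_eq_zero
    (hloc.locallyIntegrableOn (Ioo (-T) T)) key
  refine ⟨c, Measure.eqOn_Icc_of_ae_eq volume (by linarith) ?_ hY continuousOn_const⟩
  rw [← restrict_Ioo_eq_restrict_Icc, Filter.EventuallyEq, ae_restrict_iff' measurableSet_Ioo]
  filter_upwards [hae] with t ht htm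
  have := ht htm
  rw [indicator_of_mem htm] at this
  exact sub_eq_zero.1 this

/-- The test function `θ(t) ψ(x)`. -/
def tensorTest {T : ℝ} (θ : ℝ → ℝ) (hθ : ContDiff ℝ ∞ θ) (hc : HasCompactSupport θ)
    (hs : tsupport θ ⊆ Ioo (-T) T) (ψ : 𝓢(ℝ, ℂ)) (hψ : HasCompactSupport ψ) : 𝓓(slab T, ℂ) :=
  have h : tsupport (fun y : ℝ × ℝ => (θ y.1 : ℂ) * ψ y.2) ⊆ tsupport θ ×ˢ tsupport ψ :=
    closure_minimal (fun y hy => by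
      refine ⟨subset_tsupport _ fun h => hy ?_, subset_tsupport _ fun h => hy ?_⟩ <;> simp [h])
      ((isClosed_tsupport θ).prod (isClosed_tsupport ψ))
  { toFun := fun y => (θ y.1 : ℂ) * ψ y.2
    contDiff' := (Complex.ofRealCLM.contDiff.comp (hθ.comp contDiff_fst)).mul
      ((ψ.smooth ⊤).comp contDiff_snd)
    hasCompactSupport' := (hc.isCompact.prod hψ.isCompact).of_isClosed_subset isClosed_closure h
    tsupport_subset' := h.trans fun y hy => ⟨hs hy.1, mem_univ _⟩ }

theorem slice_tensorTest {T : ℝ} (θ : ℝ → ℝ) (hθ : ContDiff ℝ ∞ θ) (hc : HasCompactSupport θ)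
    (hs : tsupport θ ⊆ Ioo (-T) T) (ψ : 𝓢(ℝ, ℂ)) (hψ : HasCompactSupport ψ) (t : ℝ) :
    slice (tensorTest θ hθ hc hs ψ hψ) t = (θ t : ℂ) • ψ := by
  ext x
  rfl

theorem lineDerivOp_tensorTest {T : ℝ} (θ : ℝ → ℝ) (hθ : ContDiff ℝ ∞ θ) (hc : HasCompactSupport θ)
    (hs : tsupport θ ⊆ Ioo (-T) T) (ψ : 𝓢(ℝ, ℂ)) (hψ : HasCompactSupport ψ) :
    ∂_{((1, 0) : ℝ × ℝ)} (tensorTest θ hθ hc hs ψ hψ) =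
      tensorTest (deriv θ) (contDiff_infty_iff_deriv.1 hθ).2 hc.deriv
        ((tsupport_deriv_subset).trans hs) ψ hψ := by
  ext ⟨t, x⟩
  refine (hasDerivAt_testFunction_fst _ t x).unique ?_
  exact (((contDiff_infty_iff_deriv.1 hθ).1 t).hasDerivAt.ofReal_comp).mul_const (ψ x)

/-- By density the pairing vanishes against all Schwartz functions. It is the action of the
distribution in `H^{-r}_Γ` represented by `z`, and this representation is isometric. -/
theorem pairing_testToL2_injective (r : ℝ) {z : HalfL2}
    (h : ∀ ψ : 𝓢(ℝ, ℂ), HasCompactSupport ψ → pairing z (testToL2 r ψ) = 0) : z = 0 := by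
  have h1 := clm_eq_zero_of_hasCompactSupport (pairing z ∘L testToL2 r) h
  have h2 : HGamma.toDist (fromL2 (-r) z) = 0 := by
    ext ψ
    rw [toDist_fromL2_apply, neg_neg]
    refine Eq.trans ?_ (h1 ψ)
    rw [ContinuousLinearMap.comp_apply, pairing_testToL2]
    exact integral_congr_ae (.of_forall fun ξ => by ring)
  have h3 : fromL2 (-r) z = 0 := HGamma.toDist_injective (h2.trans (map_zero _).symm)
  rw [← norm_eq_zero, ← norm_fromL2 (-r), h3, norm_zero]

/-- A curve satisfying the equation in the weak sense satisfies it in the strong sense. -/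
theorem hasDerivWithinAt_of_integral_pairing_eq_zero {T : ℝ} (hT : 0 < T) {h k r : ℝ → HalfL2}
    (hh : ∀ t ∈ Icc (-T) T, HasDerivWithinAt h (k t) (Icc (-T) T) t)
    (hk : ContinuousOn k (Icc (-T) T)) (hr : ContinuousOn r (Icc (-T) T)) (q : ℝ)
    (heq : ∀ φ : 𝓓(slab T, ℂ), ∫ t in Ioo (-T) T, (pairing (h t)
      (testToL2 q (slice (∂_{((1, 0) : ℝ × ℝ)} (∂_{((1, 0) : ℝ × ℝ)} φ)) t)) -
        pairing (r t) (testToL2 q (slice φ t))) = 0) :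
    ∀ t ∈ Icc (-T) T, HasDerivWithinAt k (r t) (Icc (-T) T) t := by
  obtain ⟨V, hV⟩ := exists_primitive hT hr
  have hVc : ContinuousOn V (Icc (-T) T) := fun t ht => (hV t ht).continuousWithinAt
  have h0 : (0 : ℝ) ∈ Icc (-T) T := ⟨by linarith, hT.le⟩
  -- With `V` a primitive of `r`, it suffices that `⟨k - V, w⟩` is constant in time for each test
  -- vector `w`; this is the lemma of du Bois-Reymond.
  have main : ∀ t ∈ Icc (-T) T, k t = V t + (k 0 - V 0) := by
    intro t ht
    have h1 : k t - V t - (k 0 - V 0) = 0 := by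
      refine pairing_testToL2_injective q fun ψ hψ => ?_
      set w := testToL2 q ψ
      have hw : ∀ t, HasDerivWithinAt (fun _ : ℝ => w) 0 (Icc (-T) T) t := fun t =>
        hasDerivWithinAt_const t _ w
      obtain ⟨c, hcY⟩ := eqOn_const_of_integral_deriv_smul_eq_zero hT
        (Y := fun t => pairing (k t - V t) w)
        (continuousOn_pairing (hk.sub hVc) continuousOn_const) fun θ hθ hc hs => by
          have e1 := heq (tensorTest θ hθ hc hs ψ hψ)
          simp only [lineDerivOp_tensorTest, slice_tensorTest, map_smul, smul_eq_mul] at e1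
          have hθ1 : ContDiff ℝ ∞ (deriv θ) := (contDiff_infty_iff_deriv.1 hθ).2
          have hθ2 : ContDiff ℝ ∞ (deriv (deriv θ)) := (contDiff_infty_iff_deriv.1 hθ1).2
          have d0 : ∀ t, HasDerivWithinAt (fun t => (θ t : ℂ)) (deriv θ t : ℝ) (Icc (-T) T) t :=
            fun t => (((contDiff_infty_iff_deriv.1 hθ).1 t).hasDerivAt.ofReal_comp).hasDerivWithinAt
          have d1 : ∀ t, HasDerivWithinAt (fun t => ((deriv θ t : ℝ) : ℂ)) (deriv (deriv θ) t : ℝ)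
              (Icc (-T) T) t := fun t =>
            (((contDiff_infty_iff_deriv.1 hθ1).1 t).hasDerivAt.ofReal_comp).hasDerivWithinAt
          have hhc : ContinuousOn h (Icc (-T) T) := fun t ht => (hh t ht).continuousWithinAt
          have c0 : Continuous fun t => (θ t : ℂ) := Complex.continuous_ofReal.comp hθ.continuous
          have c1 : Continuous fun t => ((deriv θ t : ℝ) : ℂ) :=
            Complex.continuous_ofReal.comp hθ1.continuous
          have c2 : Continuous fun t => ((deriv (deriv θ) t : ℝ) : ℂ) :=
            Complex.continuous_ofReal.comp hθ2.continuous
          have cw : ∀ {z : ℝ → HalfL2}, ContinuousOn z (Icc (-T) T) →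
              ContinuousOn (fun t => pairing (z t) w) (Icc (-T) T) := fun hz =>
            continuousOn_pairing hz continuousOn_const
          have hcont : ContinuousOn (fun t => ((deriv (deriv θ) t : ℝ) : ℂ) * pairing (h t) w -
              θ t * pairing (r t) w) (Icc (-T) T) :=
            (c2.continuousOn.mul (cw hhc)).sub (c0.continuousOn.mul (cw hr))
          have hcont' : ContinuousOn (fun t => ((deriv θ t : ℝ) : ℂ) * pairing (k t - V t) w)
              (Icc (-T) T) := c1.continuousOn.mul (cw (hk.sub hVc))
          -- Integrating the derivative of `θ' ⟨h, w⟩ - θ ⟨V, w⟩` produces the weak equation for `θ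
          -- ⊗ ψ` plus `∫ θ' ⟨k - V, w⟩`; the boundary terms vanish.
          have e2 := integral_Ioo_eq_sub hT (B := fun t => ((deriv θ t : ℝ) : ℂ) * pairing (h t) w -
            θ t * pairing (V t) w)
            (B' := fun t => (((deriv (deriv θ) t : ℝ) : ℂ) * pairing (h t) w -
              θ t * pairing (r t) w) + ((deriv θ t : ℝ) : ℂ) * pairing (k t - V t) w)
            (fun t ht => by
              refine (((d1 t).mul (hasDerivWithinAt_pairing (hh t ht) (hw t))).sub
                ((d0 t).mul (hasDerivWithinAt_pairing (hV t ht) (hw t)))).congr_deriv ?_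
              simp only [map_zero, zero_add, map_sub, sub_apply]
              ring)
            (hcont.add hcont')
          have z0 : ∀ t, t ∉ Ioo (-T) T → θ t = 0 := fun t ht =>
            image_eq_zero_of_notMem_tsupport fun h => ht (hs h)
          have z1 : ∀ t, t ∉ Ioo (-T) T → deriv θ t = 0 := fun t ht =>
            image_eq_zero_of_notMem_tsupport fun h => ht (hs (tsupport_deriv_subset h))
          rw [integral_add (hcont.integrableOn_Icc.mono_set Ioo_subset_Icc_self)
            (hcont'.integrableOn_Icc.mono_set Ioo_subset_Icc_self), e1, zero_add,
            z0 T (by simp), z0 (-T) (by simp), z1 T (by simp), z1 (-T) (by simp)] at e2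
          simp only [Complex.ofReal_zero, zero_mul, sub_self] at e2
          simpa only [Complex.real_smul] using e2
      rw [map_sub, sub_apply, sub_eq_zero]
      exact (hcY ht).trans (hcY h0).symm
    rw [← sub_eq_zero, ← h1]
    abel
  intro t ht
  exact ((hV t ht).add_const _).congr main (main t ht)

/-! ### Solutions of the Cauchy problem and their profiles -/

theorem continuousOn_acceleration (ε : ℝ) {M : HalfL2 → HalfL2} (hM : Continuous M) {A : Set ℝ}
    {f : ℝ → HalfL2} (hf : ContinuousOn f A) :
    ContinuousOn (fun t => -mulOp lapM (f t) + (ε : ℂ) • mulOp japInv (M (f t))) A :=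
  ((mulOp lapM).continuous.comp_continuousOn hf).neg.add
    (((mulOp japInv).continuous.comp_continuousOn (hM.comp_continuousOn hf)).const_smul (ε : ℂ))

theorem continuousOn_toDist_slice (s : ℝ) {A : Set ℝ} {f : ℝ → HalfL2} (hf : ContinuousOn f A)
    {T : ℝ} (φ : 𝓓(slab T, ℂ)) :
    ContinuousOn (fun t => HGamma.toDist (fromL2 s (f t)) (slice φ t)) A := by
  simp only [toDist_fromL2_eq_pairing]
  exact continuousOn_pairing ((mulOp japInv).continuous.comp_continuousOn
    ((mulOp japInv).continuous.comp_continuousOn hf)) (continuous_clm_slice _ φ).continuousOn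

theorem hasDerivWithinAt_fromL2 (s : ℝ) {f : ℝ → HalfL2} {f' : HalfL2} {A : Set ℝ} {t : ℝ}
    (h : HasDerivWithinAt f f' A t) :
    HasDerivWithinAt (fun τ => fromL2 s (f τ)) (fromL2 s f') A t :=
  hasDerivWithinAt_clm_comp (fromL2Equiv s).toContinuousLinearEquiv.toContinuousLinearMap h

theorem hasDerivWithinAt_incl {s : ℝ} {f : ℝ → HalfL2} {g : HalfL2} {A : Set ℝ} {t : ℝ}
    (h : HasDerivWithinAt (fun τ => mulOp japInv (f τ)) g A t) :
    HasDerivWithinAt (fun τ => HGamma.incl (fromL2 s (f τ))) (fromL2 (s - 1) g) A t := by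
  simp only [incl_fromL2]
  exact hasDerivWithinAt_fromL2 (s - 1) h

section

variable {p : ℕ} {s ε T : ℝ} {M : HalfL2 → HalfL2}

theorem velocity_fromL2_position {x : ℝ → HalfL2 × HalfL2} (hT : 0 < T)
    (hx : ∀ t ∈ Icc (-T) T, HasDerivWithinAt x (profileField ε M t (x t)) (Icc (-T) T) t) {t : ℝ}
    (ht : t ∈ Icc (-T) T) :
    velocity T (fun t => fromL2 s (position t (x t))) t = fromL2 (s - 1) (speed t (x t)) :=
  (hasDerivWithinAt_incl (hasDerivWithinAt_position (hx t ht))).derivWithin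
    (uniqueDiffOn_Icc (by linarith) t ht)

theorem isSolution_fromL2_position (hT : 0 < T) (hT1 : T ≤ 1) (hM : Continuous M)
    (hpow : ∀ f, IsFourierPower (HGamma.toDist (fromL2 s f)) p (HGamma.toDist (fromL2 (s - 1) (M f))))
    {x : ℝ → HalfL2 × HalfL2}
    (hx : ∀ t ∈ Icc (-T) T, HasDerivWithinAt x (profileField ε M t (x t)) (Icc (-T) T) t) :
    IsSolution p ε T (fromL2 s (x 0).1) (fromL2 (s - 1) (x 0).2)
      (fun t => fromL2 s (position t (x t))) := by
  have hxc : ContinuousOn x (Icc (-T) T) := fun t ht => (hx t ht).continuousWithinAt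
  have hf := continuousOn_position hT1 hxc
  have hg := continuousOn_speed hT1 hxc
  have hud : UniqueDiffOn ℝ (Icc (-T) T) := uniqueDiffOn_Icc (by linarith)
  have h0 : (0 : ℝ) ∈ Icc (-T) T := ⟨by linarith, hT.le⟩
  refine ⟨(fromL2Equiv s).continuous.comp_continuousOn hf, ?_, ?_, ?_, ?_⟩
  · refine (contDiffOn_one_iff_derivWithin hud).2 ⟨fun t ht =>
      (hasDerivWithinAt_incl (hasDerivWithinAt_position (hx t ht))).differentiableWithinAt, ?_⟩
    exact ((fromL2Equiv (s - 1)).continuous.comp_continuousOn hg).congr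
      fun t ht => velocity_fromL2_position hT hx ht
  · simp only [position_zero]
  · rw [velocity_fromL2_position hT hx h0, speed_zero]
  · refine ⟨fun t => HGamma.toDist (fromL2 (s - 1) (M (position t (x t)))), fun t _ => hpow _,
      fun φ => ?_⟩
    have i1 : IntegrableOn (fun t => HGamma.toDist (fromL2 s (position t (x t)))
        (slice (waveOp φ) t)) (Ioo (-T) T) :=
      (continuousOn_toDist_slice s hf (waveOp φ)).integrableOn_Icc.mono_set Ioo_subset_Icc_self
    have i2 : IntegrableOn (fun t => HGamma.toDist (fromL2 (s - 1) (M (position t (x t))))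
        (slice φ t)) (Ioo (-T) T) :=
      (continuousOn_toDist_slice (s - 1) (hM.comp_continuousOn hf) φ).integrableOn_Icc.mono_set
        Ioo_subset_Icc_self
    refine ⟨i1, i2, ?_⟩
    rw [← sub_eq_zero, ← integral_const_mul, ← integral_sub i1 (i2.const_mul _)]
    simp only [toDist_slice_waveOp_sub]
    exact integral_pairing_slice_eq_zero hT
      (fun t ht => hasDerivWithinAt_clm_comp (mulOp japInv) (hasDerivWithinAt_position (hx t ht)))
      (fun t ht => hasDerivWithinAt_speed (hx t ht)) (continuousOn_acceleration ε hM hf) _ φ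

/-- The converse of `isSolution_fromL2_position`: every distributional solution arises from a
solution of the profile equation. This reduces uniqueness to that of the differential equation. -/
theorem IsSolution.exists_profile (hT : 0 < T) (hT1 : T ≤ 1) (hM : Continuous M) (hp : 1 ≤ p)
    (hpow : ∀ f, IsFourierPower (HGamma.toDist (fromL2 s f)) p (HGamma.toDist (fromL2 (s - 1) (M f))))
    {v₀ : HGamma s} {v₁ : HGamma (s - 1)} {v : ℝ → HGamma s} (hv : IsSolution p ε T v₀ v₁ v) :
    ∃ x : ℝ → HalfL2 × HalfL2, v₀ = fromL2 s (x 0).1 ∧ v₁ = fromL2 (s - 1) (x 0).2 ∧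
      (∀ t, v t = fromL2 s (position t (x t))) ∧
      ∀ t ∈ Icc (-T) T, HasDerivWithinAt x (profileField ε M t (x t)) (Icc (-T) T) t := by
  have hud : UniqueDiffOn ℝ (Icc (-T) T) := uniqueDiffOn_Icc (by linarith)
  set f : ℝ → HalfL2 := fun t => (fromL2Equiv s).symm (v t)
  set g : ℝ → HalfL2 := fun t => (fromL2Equiv (s - 1)).symm (velocity T v t)
  have hvf : ∀ t, v t = fromL2 s (f t) := fun t => ((fromL2Equiv s).apply_symm_apply (v t)).symm
  have hvg : ∀ t, velocity T v t = fromL2 (s - 1) (g t) := fun t =>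
    ((fromL2Equiv (s - 1)).apply_symm_apply _).symm
  obtain ⟨hd, hdc⟩ := (contDiffOn_one_iff_derivWithin hud).1 hv.contDiffOn
  have hf : ContinuousOn f (Icc (-T) T) :=
    (fromL2Equiv s).symm.continuous.comp_continuousOn hv.continuousOn
  have hg : ContinuousOn g (Icc (-T) T) :=
    (fromL2Equiv (s - 1)).symm.continuous.comp_continuousOn hdc
  have h1 : ∀ t ∈ Icc (-T) T,
      HasDerivWithinAt (fun τ => mulOp japInv (f τ)) (g t) (Icc (-T) T) t := fun t ht => by
    have := hasDerivWithinAt_clm_comp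
      (fromL2Equiv (s - 1)).symm.toContinuousLinearEquiv.toContinuousLinearMap
      (hd t ht).hasDerivWithinAt
    refine this.congr_of_mem (fun τ _ => ?_) ht
    change _ = (fromL2Equiv (s - 1)).symm (HGamma.incl (v τ))
    rw [hvf, incl_fromL2, ← fromL2Equiv_apply, LinearIsometryEquiv.symm_apply_apply]
  have h2 := hasDerivWithinAt_of_integral_pairing_eq_zero hT
    (fun t ht => hasDerivWithinAt_clm_comp (mulOp japInv) (h1 t ht))
    ((mulOp japInv).continuous.comp_continuousOn hg) (continuousOn_acceleration ε hM hf) (2 - s)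
    (fun φ => by
      obtain ⟨N, hN, hφ⟩ := hv.equation
      obtain ⟨i1, i2, e⟩ := hφ φ
      obtain ⟨m, rfl⟩ : ∃ m, p = m + 1 := ⟨p - 1, by omega⟩
      rw [← sub_eq_zero, ← integral_const_mul, ← integral_sub i1 (i2.const_mul _)] at e
      rw [← e]
      refine setIntegral_congr_fun measurableSet_Ioo fun t ht => ?_
      -- The equation only provides some distribution that is a Fourier power; uniqueness of the
      -- power determines it.
      have hNt : N t = HGamma.toDist (fromL2 (s - 1) (M (f t))) :=
        (hN t (Ioo_subset_Icc_self ht)).unique (by rw [hvf]; exact hpow (f t))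
      simp only [hNt, hvf t]
      exact (toDist_slice_waveOp_sub s ε (f t) (M (f t)) φ t).symm)
  have h3 : profile 0 (f 0) (g 0) = (f 0, g 0) := profile_zero _ _
  refine ⟨fun t => profile t (f t) (g t), ?_, ?_, fun t => ?_,
    hasDerivWithinAt_profile hT hT1 hM hf h1 h2⟩
  · simp only [h3, ← hvf, hv.initial_position]
  · simp only [h3, ← hvg, hv.initial_velocity]
  · simp only [position_profile, hvf]

end

end HalfLineNLW

end

/-! ### Local well-posedness -/

theorem theorem6p1 (p : ℕ) (s : ℝ)
    (hps : (p = 2 ∧ -(1 / 2 : ℝ) < s) ∨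
      (3 ≤ p ∧ (1 / 2 : ℝ) - 1 / (2 * (p : ℝ) - 4) < s))
    (ε : ℝ) (hε : ε = 1 ∨ ε = -1)
    (u₀ : HGamma s) (u₁ : HGamma (s - 1)) :
    ∃ T : ℝ, 0 < T ∧
      ∃ U ∈ 𝓝 (u₀, u₁), ∃ Φ : HGamma s × HGamma (s - 1) → ℝ → HGamma s,
        (∀ d ∈ U, IsSolution p ε T d.1 d.2 (Φ d) ∧
          ∀ v : ℝ → HGamma s, IsSolution p ε T d.1 d.2 v → EqOn v (Φ d) (Icc (-T) T)) ∧
        ∃ L : ℝ, ∀ d ∈ U, ∀ d' ∈ U, ∀ t ∈ Icc (-T) T,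
          ‖Φ d t - Φ d' t‖ ≤ L * ‖d - d'‖ ∧
          ‖velocity T (Φ d) t - velocity T (Φ d') t‖ ≤ L * ‖d - d'‖ := by
  obtain ⟨M, hMlip, hpow⟩ := exists_power_map hps
  have hM := continuous_of_forall_lipschitzOnWith hMlip
  have hp : 1 ≤ p := by rcases hps with h | h <;> omega
  have hF := exists_lipschitzOnWith_profileField (ε := ε)
    (by rcases hε with rfl | rfl <;> simp) hMlip
  let e : HGamma s × HGamma (s - 1) → HalfL2 × HalfL2 := fun d =>
    ((fromL2Equiv s).symm d.1, (fromL2Equiv (s - 1)).symm d.2)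
  have he : Continuous e := ((fromL2Equiv s).symm.continuous.comp continuous_fst).prodMk
    ((fromL2Equiv (s - 1)).symm.continuous.comp continuous_snd)
  have he1 : ∀ d, fromL2 s (e d).1 = d.1 := fun d => (fromL2Equiv s).apply_symm_apply d.1
  have he2 : ∀ d, fromL2 (s - 1) (e d).2 = d.2 := fun d =>
    (fromL2Equiv (s - 1)).apply_symm_apply d.2
  have hed : ∀ d d', ‖e d - e d'‖ = ‖d - d'‖ := fun d d' => by
    simp only [e, Prod.norm_def, Prod.fst_sub, Prod.snd_sub, ← map_sub,
      LinearIsometryEquiv.norm_map]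
  obtain ⟨T, hT, hT1, r, hr, α, hα, L, hL⟩ :=
    exists_local_flow hF (continuous_profileField ε hM) (e (u₀, u₁))
  -- The map `e` identifies data with profiles at time `0`, isometrically for the maximum norms, so
  -- the ball of the flow pulls back to a neighbourhood of the data. The constant `2π + 4` exceeds
  -- both bounds on the propagators, `3` for the position and `2π + 1` for the velocity.
  refine ⟨T, hT, e ⁻¹' Metric.closedBall (e (u₀, u₁)) r,
    he.continuousAt.preimage_mem_nhds (Metric.closedBall_mem_nhds _ hr),
    fun d t => fromL2 s (position t (α (e d) t)), fun d hd => ?_,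
    (2 * Real.pi + 4) * L, fun d hd d' hd' t ht => ?_⟩
  · obtain ⟨h0, hx⟩ := hα (e d) hd
    have hsol := isSolution_fromL2_position hT hT1 hM hpow hx
    rw [h0, he1, he2] at hsol
    refine ⟨hsol, fun v hv t ht => ?_⟩
    obtain ⟨x, hx1, hx2, hxv, hxd⟩ := hv.exists_profile hT hT1 hM hp hpow
    have hx0 : x 0 = α (e d) 0 := by
      rw [h0]
      refine Prod.ext ((fromL2Equiv s).injective ?_) ((fromL2Equiv (s - 1)).injective ?_)
      · rw [fromL2Equiv_apply, fromL2Equiv_apply, ← hx1, he1]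
      · rw [fromL2Equiv_apply, fromL2Equiv_apply, ← hx2, he2]
    simp only [hxv t, eqOn_of_hasDerivWithinAt hT hT1 hF hxd hx hx0 ht]
  · have hx := (hα (e d) hd).2
    have hx' := (hα (e d') hd').2
    have h1 : ‖α (e d) t - α (e d') t‖ ≤ L * ‖d - d'‖ := by
      rw [← hed, ← dist_eq_norm, ← dist_eq_norm]
      exact (hL t ht).dist_le_mul _ hd _ hd'
    have ht1 : t ∈ Icc (-1 : ℝ) 1 := ⟨by linarith [ht.1], ht.2.trans hT1⟩
    have hLd : 0 ≤ L * ‖d - d'‖ := by positivity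
    have hpi := Real.pi_pos
    rw [velocity_fromL2_position hT hx ht, velocity_fromL2_position hT hx' ht]
    simp only [← fromL2Equiv_apply, ← map_sub, LinearIsometryEquiv.norm_map]
    constructor
    · refine (norm_position_le ht1 _).trans ?_
      nlinarith
    · refine (norm_speed_le t _).trans ?_
      nlinarith
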